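/- \textbf{Setting.} Let $\Omega_B,\Omega_D\subset\mathbb R^2$ be disjoint bounded connected polygonal domains with a conforming mesh, as follows. Each $\Omega_i$ ($i=B,D$) is partitioned into finitely many primal elements, each a triangle or a quadrilateral; each primal element is divided into subtriangles by joining an interior point $\nu$ (with respect to which the element is star-shaped) to all its vertices. All the subtriangles, $\mathcal T_{h,B}\cup\mathcal T_{h,D}$, form a conforming triangulation (any two of them do not overlap and meet in nothing, in a common vertex or in a common edge), and $\Omega_i$ is the interior of the union of $\mathcal T_{h,i}$. Let $\Gamma$ be the interface, $\mathcal F_{h,\Gamma}$ the set of mesh edges on $\Gamma$ (edges shared by a triangle of $\mathcal T_{h,B}$ and one of $\mathcal T_{h,D}$), assumed non-empty, $\Gamma_i=\partial\Omega_i\setminus\Gamma$, $\mathcal F_{pr,B}^0$ the edges of primal elements that are interior to $\Omega_B$, $\mathcal F_{pr,B}$ those together with the edges on $\Gamma_B$, and $\mathcal F_{dl,B}$ the edges created by the subdivision in $\Omega_B$. Each edge has a fixed unit normal $\boldsymbol n$ and unit tangent $\boldsymbol t$; on an interior edge shared by $\tau_1,\tau_2$, $\boldsymbol n$ points from $\tau_1$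 to $\tau_2$ and $[\![v]\!]=v|_{\tau_1}-v|_{\tau_2}$; on a boundary edge of $\Omega_i$, $\boldsymbol n=\boldsymbol n_i$ is outward and $[\![v]\!]=v$. $\nabla_h,\operatorname{div}_h$ are elementwise, and $(\cdot,\cdot)_D$ is the $L^2(D)$ inner product. Let $k\ge1$ and let \begin{align*} H_h^B&=\{\boldsymbol v:\boldsymbol v|_\tau\in P^k(\tau)^2\ \forall\tau\in\mathcal T_{h,B};\ [\![\boldsymbol v\cdot\boldsymbol n]\!]_e=0\ \forall e\in\mathcal F_{dl,B}\},\\ W_h^B&=\{\boldsymbol G:\boldsymbol G|_\tau\in P^k(\tau)^{2\times2}\ \forall\tau\in\mathcal T_{h,B};\ [\![\boldsymbol G\boldsymbol n]\!]_e=\boldsymbol 0\ \forall e\in\mathcal F_{pr,B}^0;\ [\![(\boldsymbol G\boldsymbol n)\cdot\boldsymbol t]\!]_e=0\ \forall e\in\mathcal F_{dl,B};\ \boldsymbol G\boldsymbol n=\boldsymbol 0\text{ on }\partial\Omega_B\},\\ Q_h^B&=\{q:q|_\tau\in P^k(\tau)\ \forall\tau\in\mathcal T_{h,B};\ [\![q]\!]_e=0\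 \forall e\in\mathcal F_{pr,B}^0\},\qquad Q_h^0=\{q\in Q_h^B:\textstyle\int_{\Omega_B}q\,dx=0\},\\ H_h^D&=\{\boldsymbol v\in H(\mathrm{div};\Omega_D):\boldsymbol v|_\tau\in P^k(\tau)^2\ \forall\tau\in\mathcal T_{h,D}\},\qquad Q_h^D=\{q:q|_\tau\in P^{k-1}(\tau)\ \forall\tau\in\mathcal T_{h,D}\},\\ H_{h,g}^D&=\{\boldsymbol v\in H_h^D:\boldsymbol v\cdot\boldsymbol n=\Pi_{h,\Gamma_D}g\text{ on }\Gamma_D\}, \end{align*} where $\Pi_{h,\Gamma_D}$ is the edgewise $L^2$ projection onto polynomials of degree at most $k$. Set \begin{align*} B_h^*(\boldsymbol u,\boldsymbol G)&=\sum_{e\in\mathcal F_{dl,B}}([\![\boldsymbol G\boldsymbol n]\!],(\boldsymbol u\cdot\boldsymbol n)\boldsymbol n)_e-(\operatorname{div}_h\boldsymbol G,\boldsymbol u)_{\Omega_B},\\ B_h(\boldsymbol L,\boldsymbol v)&=-\sum_{e\in\mathcal F_{pr,B}^0}(\boldsymbol L\boldsymbol n,[\![\boldsymbol v]\!])_e-\sum_{e\in\mathcal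 F_{dl,B}}((\boldsymbol L\boldsymbol n)\cdot\boldsymbol t,[\![\boldsymbol v\cdot\boldsymbol t]\!])_e+(\boldsymbol L,\nabla_h\boldsymbol v)_{\Omega_B},\\ b_h^*(p,\boldsymbol v)&=\sum_{e\in\mathcal F_{pr,B}}([\![\boldsymbol v\cdot\boldsymbol n]\!],p)_e+\sum_{e\in\mathcal F_{h,\Gamma}}(\boldsymbol v\cdot\boldsymbol n_B,p)_e-(p,\operatorname{div}_h\boldsymbol v)_{\Omega_B},\\ b_h(\boldsymbol u,q)&=-\sum_{e\in\mathcal F_{dl,B}}(\boldsymbol u\cdot\boldsymbol n,[\![q]\!])_e+(\boldsymbol u,\nabla_hq)_{\Omega_B},\\ A_h(\boldsymbol v,p)&=(p,\nabla\cdot\boldsymbol v)_{\Omega_D},\qquad I_h(p,\boldsymbol v)=\sum_{e\in\mathcal F_{h,\Gamma}}(\boldsymbol v\cdot\boldsymbol n_D,p)_e . \end{align*} \textbf{Theorem (unique solvability).} Let $\epsilon>0$, let $\alpha$ be a constant symmetric positive definite $2\times2$ matrix (for instance a positive multiple of the identity), and let $K_D$ be a tensor field on $\Omega_D$ that is symmetric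 and positive definite almost everywhere and such that the entries of $K_D^{-1}$ are integrable on $\Omega_D$ (for instance a constant or uniformly positive definite measurable tensor). Let $\boldsymbol f_B\in L^2(\Omega_B)^2$, $\boldsymbol f_D\in L^2(\Omega_D)^2$, $f\in L^2(\Omega_D)$, $g_1\in L^2(\Gamma_B)$, $g_2\in L^2(\Gamma_D)$. Then there is exactly one $(\boldsymbol L_h,\boldsymbol u_{B,h},p_{B,h},\boldsymbol u_{D,h},p_{D,h})\in W_h^B\times H_h^B\times Q_h^0\times H_{h,g_2}^D\times Q_h^D$ such that \begin{align*} (\epsilon^{-1}\boldsymbol L_h,\boldsymbol G)_{\Omega_B}-B_h^*(\boldsymbol u_{B,h},\boldsymbol G)+(K_D^{-1}\boldsymbol u_{D,h},\boldsymbol v_D)_{\Omega_D}+I_h(p_{B,h},\boldsymbol v_D)-A_h(\boldsymbol v_D,p_{D,h})&=(\boldsymbol f_D,\boldsymbol v_D)_{\Omega_D},\\ B_h(\boldsymbol L_h,\boldsymbol v_B)+(\alpha\boldsymbol u_{B,h},\boldsymbol v_B)_{\Omega_B}+b_h^*(p_{B,h},\boldsymbol v_B)+A_h(\boldsymbol u_{D,h},q_D)&=(\boldsymbol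 f_B,\boldsymbol v_B)_{\Omega_B}+(f,q_D)_{\Omega_D},\\ -I_h(q_B,\boldsymbol u_{D,h})-b_h(\boldsymbol u_{B,h},q_B)&=-(g_1,q_B)_{\Gamma_B} \end{align*} for all $(\boldsymbol G,\boldsymbol v_B,q_B)\in W_h^B\times H_h^B\times Q_h^0$ and $(\boldsymbol v_D,q_D)\in H_{h,0}^D\times Q_h^D$. -/

import Mathlib

open MeasureTheory Matrix
open scoped ContDiff

noncomputable section

namespace BrinkmanDarcy

/-- The Euclidean plane. -/
abbrev Plane := EuclideanSpace ℝ (Fin 2)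

/-- Real polynomials in the two coordinates of the plane. -/
abbrev Poly := MvPolynomial (Fin 2) ℝ

/-- Value of a polynomial at a point. -/
def ev (x : Plane) (p : Poly) : ℝ := MvPolynomial.eval (fun i => x i) p

/-- Value of a polynomial vector field at a point. -/
def evVec (x : Plane) (v : Fin 2 → Poly) : Fin 2 → ℝ := fun i => ev x (v i)

/-- Value of a polynomial tensor field at a point. -/
def evMat (x : Plane) (G : Matrix (Fin 2) (Fin 2) Poly) : Matrix (Fin 2) (Fin 2) ℝ :=
  fun i j => ev x (G i j)

/-- `∇ q`. -/
def grad (q : Poly) : Fin 2 → Poly := fun j => MvPolynomial.pderiv j q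

/-- `∇ ⬝ v`. -/
def div (v : Fin 2 → Poly) : Poly := ∑ j, MvPolynomial.pderiv j (v j)

/-- `(∇ v) i j = ∂ⱼ vᵢ`. -/
def gradVec (v : Fin 2 → Poly) : Matrix (Fin 2) (Fin 2) Poly :=
  fun i j => MvPolynomial.pderiv j (v i)

/-- Row-wise divergence of a tensor field. -/
def divMat (G : Matrix (Fin 2) (Fin 2) Poly) : Fin 2 → Poly :=
  fun i => ∑ j, MvPolynomial.pderiv j (G i j)

/-- The Frobenius product `A : B`. -/
def frob (A B : Matrix (Fin 2) (Fin 2) ℝ) : ℝ := ∑ i, ∑ j, A i j * B i j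

/-- `x₁ y₂ - x₂ y₁`; it is positive iff `y` points to the left of `x`. -/
def cross (x y : Plane) : ℝ := x 0 * y 1 - x 1 * y 0

/-- The line integral of `f` (with respect to arc length) over the segment from `a` to `b`. -/
def segInt (a b : Plane) (f : Plane → ℝ) : ℝ :=
  dist a b * ∫ t in (0 : ℝ)..1, f (AffineMap.lineMap a b t)

/-- `g` is square integrable on the segment from `a` to `b`. -/
def MemL2Seg (a b : Plane) (g : Plane → ℝ) : Prop :=
  MemLp (fun t : ℝ => g (AffineMap.lineMap a b t)) 2 (volume.restrict (Set.Icc 0 1))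

/-- Unit normal of the segment from `a` to `b`, pointing to its right. -/
def normal (a b : Plane) : Fin 2 → ℝ :=
  ![(b 1 - a 1) / dist a b, -(b 0 - a 0) / dist a b]

/-- Unit tangent of the segment from `a` to `b`. -/
def tangent (a b : Plane) : Fin 2 → ℝ :=
  ![(b 0 - a 0) / dist a b, (b 1 - a 1) / dist a b]

/-- `π` is, on the edge from `a` to `b`, the `L²` projection of `g` onto `P^k(e)`; it is applied
to functions `π` that are polynomials of degree at most `k`. -/
def IsEdgeProj (k : ℕ) (a b : Plane) (g π : Plane → ℝ) : Prop :=
  ∀ χ : Poly, χ.totalDegree ≤ k → segInt a b (fun x => (g x - π x) * ev x χ) = 0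

/-- `H(div; Ω)`: square integrable vector fields with a square integrable weak divergence. -/
def MemHdiv (Ω : Set Plane) (v : Plane → Plane) : Prop :=
  MemLp v 2 (volume.restrict Ω) ∧
  ∃ d : Plane → ℝ, MemLp d 2 (volume.restrict Ω) ∧
    ∀ φ : Plane → ℝ, ContDiff ℝ ∞ φ → HasCompactSupport φ → tsupport φ ⊆ Ω →
      ∫ x in Ω, fderiv ℝ φ x (v x) = -∫ x in Ω, d x * φ x

/-! ### Meshes -/

/-- A primal element: a triangle or a quadrilateral, with its vertices in counterclockwise order,
together with an interior point `center` that is joined to all the vertices. The condition `ccw`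
says that all the subtriangles `center, vertex j, vertex j+1` are positively oriented. For a
triangle or a convex quadrilateral this means that `center` is an interior point; a nonconvex
quadrilateral has to be star-shaped with respect to `center`. -/
structure Cell where
  sides : ℕ
  sides_eq : sides = 3 ∨ sides = 4
  vert : Fin sides → Plane
  center : Plane
  ccw : ∀ j, 0 < cross (vert j - center) (vert (finRotate sides j) - center)

/-- A finite family of primal elements. -/
structure CellFamily where
  numCells : ℕ
  cell : Fin numCells → Cell

namespace CellFamily

variable (M : CellFamily)

/-- The subtriangles: `⟨c, j⟩` is spanned by the center of the primal element `c` and by its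
vertices `j` and `j + 1`. -/
abbrev Tri := Σ c : Fin M.numCells, Fin (M.cell c).sides

variable {M}

/-- The vertex of a subtriangle that is the center of the primal element. -/
def apex (s : M.Tri) : Plane := (M.cell s.1).center

/-- The first endpoint of the primal edge of a subtriangle. -/
def base₀ (s : M.Tri) : Plane := (M.cell s.1).vert s.2

/-- The second endpoint of the primal edge of a subtriangle. -/
def base₁ (s : M.Tri) : Plane := (M.cell s.1).vert (finRotate _ s.2)

/-- The preceding subtriangle in the same primal element; it is the other subtriangle that contains
the dual edge from `apex s` to `base₀ s`. -/
def prev (s : M.Tri) : M.Tri := ⟨s.1, (finRotate _).symm s.2⟩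

/-- The three vertices. -/
def verts (s : M.Tri) : Set Plane := {apex s, base₀ s, base₁ s}

/-- The closed triangle. -/
def tri (s : M.Tri) : Set Plane := convexHull ℝ (verts s)

/-- The primal edge of a subtriangle, as an unordered pair of endpoints. -/
def primalEdge (s : M.Tri) : Sym2 Plane := s(base₀ s, base₁ s)

/-- The outward unit normal on the primal edge of a subtriangle. -/
def outNormal (s : M.Tri) : Fin 2 → ℝ := normal (base₀ s) (base₁ s)

/-- The fixed unit normal on the dual edge from `apex s` to `base₀ s`; it points from `s`
to `prev s`. -/
def dualNormal (s : M.Tri) : Fin 2 → ℝ := normal (apex s) (base₀ s)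

/-- The unit tangent on the dual edge from `apex s` to `base₀ s`. -/
def dualTangent (s : M.Tri) : Fin 2 → ℝ := tangent (apex s) (base₀ s)

/-- Integral over the primal edge. -/
def primalInt (s : M.Tri) (f : Plane → ℝ) : ℝ := segInt (base₀ s) (base₁ s) f

/-- Integral over the dual edge from `apex s` to `base₀ s`. -/
def dualInt (s : M.Tri) (f : Plane → ℝ) : ℝ := segInt (apex s) (base₀ s) f

/-- The primal edge of `s` belongs to no other subtriangle of the family. -/
def IsBoundary (s : M.Tri) : Prop := ∀ t : M.Tri, primalEdge t = primalEdge s → t = s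

/-- The pair `(s, t)` represents an interior primal edge: the two subtriangles, which lie in
different primal elements, share it. Each interior edge is represented by one pair, and its fixed
normal is the one that points from `s` to `t`. -/
def IsInteriorPair (p : M.Tri × M.Tri) : Prop :=
  p.1.1 < p.2.1 ∧ primalEdge p.1 = primalEdge p.2

variable (M)

/-- The open polygonal region that the family covers. -/
def region : Set Plane := interior (⋃ s : M.Tri, tri s)

/-- Piecewise polynomial functions, given by one polynomial per subtriangle. -/
abbrev Scalar := M.Tri → Poly

/-- Piecewise polynomial vector fields. -/
abbrev Vec := M.Tri → Fin 2 → Poly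

/-- Piecewise polynomial tensor fields. -/
abbrev Tensor := M.Tri → Matrix (Fin 2) (Fin 2) Poly

variable {M}

/-- The elementwise defined integral of a family of functions. -/
def elemInt (f : M.Tri → Plane → ℝ) : ℝ := ∑ s, ∫ x in tri s, f s x

/-- A piecewise polynomial vector field as a function on the plane (it vanishes on the edges and
outside of the mesh). -/
def toFun (v : M.Vec) (x : Plane) : Plane :=
  ∑ s, (interior (tri s)).indicator (fun y => WithLp.toLp 2 (evVec y (v s))) x

end CellFamily

/-- Two triangles with vertex sets `A` and `B` do not overlap, and they meet in a common face
(nothing, a common vertex or a common edge). -/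
def FaceToFace (A B : Set Plane) : Prop :=
  Disjoint (interior (convexHull ℝ A)) (interior (convexHull ℝ B)) ∧
  convexHull ℝ A ∩ convexHull ℝ B = convexHull ℝ (A ∩ B)

/-- Meshes of the two subdomains `Ω_B` and `Ω_D`, which are connected and separated by an
interface that contains at least one edge; all the subtriangles form a conforming
triangulation. -/
structure CoupledMesh where
  B : CellFamily
  D : CellFamily
  conforming_B : ∀ s t : B.Tri, s ≠ t → FaceToFace (CellFamily.verts s) (CellFamily.verts t)
  conforming_D : ∀ s t : D.Tri, s ≠ t → FaceToFace (CellFamily.verts s) (CellFamily.verts t)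
  conforming_BD : ∀ (s : B.Tri) (t : D.Tri),
    FaceToFace (CellFamily.verts s) (CellFamily.verts t)
  connected_B : IsConnected B.region
  connected_D : IsConnected D.region
  interface_nonempty : ∃ (s : B.Tri) (t : D.Tri),
    CellFamily.primalEdge s = CellFamily.primalEdge t

namespace CoupledMesh

open CellFamily

variable (T : CoupledMesh)

/-- `Ω_B`. -/
def ΩB : Set Plane := T.B.region

/-- `Ω_D`. -/
def ΩD : Set Plane := T.D.region

open Classical in
/-- Interior primal edges of `Ω_B`, each with its two subtriangles. -/
def primalInteriorB : Finset (T.B.Tri × T.B.Tri) := {p | IsInteriorPair p}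

open Classical in
/-- Edges on the interface `Γ`, each with its subtriangles on the two sides. -/
def interfaceEdges : Finset (T.B.Tri × T.D.Tri) := {p | primalEdge p.1 = primalEdge p.2}

open Classical in
/-- Edges on `Γ_B = ∂Ω_B \ Γ`, represented by the adjacent subtriangle. -/
def edgesΓB : Finset T.B.Tri :=
  {s | IsBoundary s ∧ ∀ t : T.D.Tri, primalEdge s ≠ primalEdge t}

open Classical in
/-- Edges on `Γ_D = ∂Ω_D \ Γ`, represented by the adjacent subtriangle. -/
def edgesΓD : Finset T.D.Tri :=
  {t | IsBoundary t ∧ ∀ s : T.B.Tri, primalEdge s ≠ primalEdge t}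

/-! ### Finite element spaces -/

/-- `H_h^B`. -/
def HB (k : ℕ) : Set T.B.Vec :=
  {v | (∀ s i, (v s i).totalDegree ≤ k) ∧
    ∀ s : T.B.Tri, ∀ x ∈ segment ℝ (apex s) (base₀ s),
      (evVec x (v s) - evVec x (v (prev s))) ⬝ᵥ dualNormal s = 0}

/-- `W_h^B`. -/
def WB (k : ℕ) : Set T.B.Tensor :=
  {G | (∀ s i j, (G s i j).totalDegree ≤ k) ∧
    (∀ p ∈ T.primalInteriorB, ∀ x ∈ segment ℝ (base₀ p.1) (base₁ p.1),
      (evMat x (G p.1) - evMat x (G p.2)) *ᵥ outNormal p.1 = 0) ∧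
    (∀ s : T.B.Tri, ∀ x ∈ segment ℝ (apex s) (base₀ s),
      ((evMat x (G s) - evMat x (G (prev s))) *ᵥ dualNormal s) ⬝ᵥ dualTangent s = 0) ∧
    ∀ s : T.B.Tri, IsBoundary s → ∀ x ∈ segment ℝ (base₀ s) (base₁ s),
      evMat x (G s) *ᵥ outNormal s = 0}

/-- `Q_h^B`. -/
def QB (k : ℕ) : Set T.B.Scalar :=
  {q | (∀ s, (q s).totalDegree ≤ k) ∧
    ∀ p ∈ T.primalInteriorB, ∀ x ∈ segment ℝ (base₀ p.1) (base₁ p.1),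
      ev x (q p.1) - ev x (q p.2) = 0}

/-- `Q_h^0`: the functions in `Q_h^B` with mean value zero. -/
def Q0 (k : ℕ) : Set T.B.Scalar :=
  {q | q ∈ T.QB k ∧ elemInt (fun s x => ev x (q s)) = 0}

/-- `H_h^D`. -/
def HD (k : ℕ) : Set T.D.Vec :=
  {v | (∀ s i, (v s i).totalDegree ≤ k) ∧ MemHdiv T.ΩD (toFun v)}

/-- `H_{h,g}^D`: the normal component on each edge of `Γ_D` is the `L²` projection of `g`. -/
def HDbc (k : ℕ) (g : Plane → ℝ) : Set T.D.Vec :=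
  {v | v ∈ T.HD k ∧ ∀ s ∈ T.edgesΓD,
    IsEdgeProj k (base₀ s) (base₁ s) g (fun x => evVec x (v s) ⬝ᵥ outNormal s)}

/-- `Q_h^D`, for `k ≥ 1`. -/
def QD (k : ℕ) : Set T.D.Scalar := {q | ∀ s, (q s).totalDegree ≤ k - 1}

/-! ### Bilinear forms

Quantities that are single-valued on an edge are evaluated from the side of the first
subtriangle. -/

variable {T}

/-- `B_h^*(u, G)`. -/
def formBstar (u : T.B.Vec) (G : T.B.Tensor) : ℝ :=
  (∑ s : T.B.Tri, dualInt s fun x =>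
    ((evMat x (G s) - evMat x (G (prev s))) *ᵥ dualNormal s) ⬝ᵥ
      ((evVec x (u s) ⬝ᵥ dualNormal s) • dualNormal s)) -
  elemInt fun s x => evVec x (divMat (G s)) ⬝ᵥ evVec x (u s)

/-- `B_h(L, v)`. -/
def formB (L : T.B.Tensor) (v : T.B.Vec) : ℝ :=
  -(∑ p ∈ T.primalInteriorB, primalInt p.1 fun x =>
    (evMat x (L p.1) *ᵥ outNormal p.1) ⬝ᵥ (evVec x (v p.1) - evVec x (v p.2))) -
  (∑ s : T.B.Tri, dualInt s fun x =>
    ((evMat x (L s) *ᵥ dualNormal s) ⬝ᵥ dualTangent s) *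
      ((evVec x (v s) - evVec x (v (prev s))) ⬝ᵥ dualTangent s)) +
  elemInt fun s x => frob (evMat x (L s)) (evMat x (gradVec (v s)))

/-- `b_h^*(p, v)`; the sum over the primal edges that are not on `Γ` is split into the interior
edges and those on `Γ_B`. -/
def formbstar (p : T.B.Scalar) (v : T.B.Vec) : ℝ :=
  (∑ e ∈ T.primalInteriorB, primalInt e.1 fun x =>
    ((evVec x (v e.1) - evVec x (v e.2)) ⬝ᵥ outNormal e.1) * ev x (p e.1)) +
  (∑ s ∈ T.edgesΓB, primalInt s fun x =>
    (evVec x (v s) ⬝ᵥ outNormal s) * ev x (p s)) +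
  (∑ e ∈ T.interfaceEdges, primalInt e.1 fun x =>
    (evVec x (v e.1) ⬝ᵥ outNormal e.1) * ev x (p e.1)) -
  elemInt fun s x => ev x (p s) * ev x (div (v s))

/-- `b_h(u, q)`. -/
def formb (u : T.B.Vec) (q : T.B.Scalar) : ℝ :=
  -(∑ s : T.B.Tri, dualInt s fun x =>
    (evVec x (u s) ⬝ᵥ dualNormal s) * (ev x (q s) - ev x (q (prev s)))) +
  elemInt fun s x => evVec x (u s) ⬝ᵥ evVec x (grad (q s))

/-- `A_h(v, p)`; the divergence of a piecewise polynomial field in `H(div)` is the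
elementwise one. -/
def formA (v : T.D.Vec) (p : T.D.Scalar) : ℝ :=
  elemInt fun s x => ev x (p s) * ev x (div (v s))

/-- `I_h(p, v)`, where the normal `n_D` points out of `Ω_D`. -/
def formI (p : T.B.Scalar) (v : T.D.Vec) : ℝ :=
  ∑ e ∈ T.interfaceEdges, primalInt e.1 fun x =>
    (evVec x (v e.2) ⬝ᵥ outNormal e.2) * ev x (p e.1)

variable (T)

/-- The discrete Brinkman-Darcy problem. -/
structure IsDiscreteSolution (k : ℕ) (ε : ℝ) (α : Matrix (Fin 2) (Fin 2) ℝ)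
    (K : Plane → Matrix (Fin 2) (Fin 2) ℝ) (fB fD : Plane → Plane) (f g₁ g₂ : Plane → ℝ)
    (L : T.B.Tensor) (uB : T.B.Vec) (pB : T.B.Scalar) (uD : T.D.Vec) (pD : T.D.Scalar) :
    Prop where
  mem_L : L ∈ T.WB k
  mem_uB : uB ∈ T.HB k
  mem_pB : pB ∈ T.Q0 k
  mem_uD : uD ∈ T.HDbc k g₂
  mem_pD : pD ∈ T.QD k
  eq₁ : ∀ G ∈ T.WB k, ∀ vD ∈ T.HDbc k 0,
    (elemInt fun s x => ε⁻¹ * frob (evMat x (L s)) (evMat x (G s))) - formBstar uB G +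
      (elemInt fun s x => ((K x)⁻¹ *ᵥ evVec x (uD s)) ⬝ᵥ evVec x (vD s)) +
      formI pB vD - formA vD pD =
    elemInt fun s x => (fD x).ofLp ⬝ᵥ evVec x (vD s)
  eq₂ : ∀ vB ∈ T.HB k, ∀ qD ∈ T.QD k,
    formB L vB + (elemInt fun s x => (α *ᵥ evVec x (uB s)) ⬝ᵥ evVec x (vB s)) +
      formbstar pB vB + formA uD qD =
    (elemInt fun s x => (fB x).ofLp ⬝ᵥ evVec x (vB s)) + elemInt fun s x => f x * ev x (qD s)
  eq₃ : ∀ qB ∈ T.Q0 k,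
    -formI qB uD - formb uB qB =
    -∑ s ∈ T.edgesΓB, primalInt s fun x => g₁ x * ev x (qB s)

end CoupledMesh

end BrinkmanDarcy

end

noncomputable section

namespace BrinkmanDarcy

/-! ### Evaluation of polynomials -/

section Evaluation

variable (x : Plane) (p q : Poly)

/-! Unique solvability is injectivity of a square linear system. The three equations use disjoint
components of the test tuple, so they are equivalent to their sum, a single identity for the
bilinear form `system` (`isDiscreteSolution_iff`). After subtraction of a field that carries the
boundary datum `g₂` (`HDbc_nonempty`), trial and test functions range over the same
finite-dimensional space `testSpace`. There a trivial kernel gives existence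
(`exists_solution_of_injective`), and applied to the difference of two solutions it gives
uniqueness.

The kernel is treated in `eq_zero_of_system_eq_zero`. A homogeneous solution is tested with itself.
The terms `formA` and `formI` cancel by their signs. The other coupling terms cancel because the
staggered continuity makes the forms adjoint in pairs: `formBstar_eq_formB` and
`formbstar_eq_formb`, both obtained from the divergence theorem on each triangle with the boundary
terms sorted by edges. What is left is the sum of the energies of `L`, `uB` and `uD`, weighted by
`ε⁻¹`, `α` and `K⁻¹`; each is definite, so these three fields vanish.

The pressures are then orthogonal to all admissible velocities. Local test fields that have no flux
through the constrained edges, and whose product with the gradient is a weighted sum of squares,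
show that each pressure is constant on every triangle. Constant fields on two neighbours (Brinkman)
or Raviart-Thomas fields (Darcy) remove the jumps across the remaining edges; on primal edges the
Brinkman pressure is continuous by definition. Connectedness of the region
(`Conforming.eq_of_adjacent`) leaves one constant per subdomain. The Brinkman constant is zero by
the mean value condition. The Darcy constant is zero because an interface edge carries no flux
condition: a Raviart-Thomas field there has a divergence with integral one
(`eq_zero_of_formA_eq_zero`).

Although the Darcy velocities are defined by a weak divergence, only one implication is needed:
normal continuity puts a piecewise polynomial in `H(div)` (`Conforming.memHdiv_toFun`). The converse
never enters, since the energy argument uses no integration by parts in `Ω_D`. -/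

@[simp] lemma ev_add : ev x (p + q) = ev x p + ev x q := by simp [ev]
@[simp] lemma ev_sub : ev x (p - q) = ev x p - ev x q := by simp [ev]
@[simp] lemma ev_neg : ev x (-p) = -ev x p := by simp [ev]
@[simp] lemma ev_mul : ev x (p * q) = ev x p * ev x q := by simp [ev]
@[simp] lemma ev_smul (c : ℝ) : ev x (c • p) = c * ev x p := by simp [ev, MvPolynomial.smul_eval]
@[simp] lemma ev_zero : ev x 0 = 0 := by simp [ev]
@[simp] lemma ev_C (c : ℝ) : ev x (MvPolynomial.C c) = c := by simp [ev]
@[simp] lemma ev_X (i : Fin 2) : ev x (MvPolynomial.X i) = x i := by simp [ev]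

end Evaluation

lemma contDiff_ev (p : Poly) {n : WithTop ℕ∞} : ContDiff ℝ n fun x => ev x p := by
  induction p using MvPolynomial.induction_on with
  | C a => simpa using contDiff_const
  | add p q hp hq => simpa using hp.add hq
  | mul_X p i hp =>
    simp only [ev_mul, ev_X]
    exact hp.mul (by fun_prop)

@[fun_prop] lemma continuous_ev (p : Poly) : Continuous fun x => ev x p :=
  (contDiff_ev p (n := 0)).continuous

lemma differentiable_ev (p : Poly) : Differentiable ℝ fun x => ev x p :=
  (contDiff_ev p (n := 1)).differentiable (by simp)

lemma fderiv_ev (p : Poly) (x v : Plane) :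
    fderiv ℝ (fun x => ev x p) x v = ∑ j, v j * ev x (MvPolynomial.pderiv j p) := by
  induction p using MvPolynomial.induction_on with
  | C a => simp
  | add p q hp hq =>
    simp only [ev_add, map_add]
    rw [fderiv_fun_add (differentiable_ev p x) (differentiable_ev q x)]
    simp [hp, hq, mul_add, Finset.sum_add_distrib]
  | mul_X p i hp =>
    simp only [ev_mul, ev_X, MvPolynomial.pderiv_mul, MvPolynomial.pderiv_X]
    have hX : HasFDerivAt (fun x : Plane => x i) (EuclideanSpace.proj i : Plane →L[ℝ] ℝ) x :=
      (EuclideanSpace.proj i : Plane →L[ℝ] ℝ).hasFDerivAt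
    rw [((differentiable_ev p x).hasFDerivAt.fun_mul hX).fderiv]
    simp only [_root_.add_apply, _root_.smul_apply, hp,
      Fin.sum_univ_two]
    fin_cases i <;> simp <;> ring

/-- A polynomial that vanishes on a nonempty open set is zero. -/
lemma eq_zero_of_ev_eq_zero {U : Set Plane} (hU : IsOpen U) (hne : U.Nonempty) {p : Poly}
    (h : ∀ x ∈ U, ev x p = 0) : p = 0 := by
  obtain ⟨x, hx⟩ := hne
  have hV : IsOpen ((fun y : Fin 2 → ℝ => (WithLp.toLp 2 y : Plane)) ⁻¹' U) :=
    hU.preimage (by fun_prop)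
  obtain ⟨r, hr, hball⟩ := Metric.isOpen_iff.1 hV (fun i => x i) hx
  refine MvPolynomial.funext_set (fun i => Metric.ball (x i) r) (fun i => ?_) fun y hy => ?_
  · rw [Real.ball_eq_Ioo]
    exact Set.Ioo_infinite (by linarith)
  · rw [← ball_pi _ hr] at hy
    have := h _ (hball hy)
    simpa [ev] using this

/-! ### Triangles -/

lemma cross_swap (x y : Plane) : cross y x = -cross x y := by simp [cross]; ring

/-- Both sides are twice the signed area of the triangle. -/
lemma cross_rotate (a b c : Plane) : cross (c - b) (a - b) = cross (b - a) (c - a) := by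
  simp [cross]; ring

/-- The points strictly inside a counterclockwise triangle. -/
def openTri (a b c : Plane) : Set Plane :=
  {x | 0 < cross (b - a) (x - a) ∧ 0 < cross (c - b) (x - b) ∧ 0 < cross (a - c) (x - c)}

lemma continuous_cross_sub (d a : Plane) : Continuous fun x : Plane => cross d (x - a) := by
  simp only [cross, PiLp.sub_apply]
  fun_prop

lemma isOpen_openTri (a b c : Plane) : IsOpen (openTri a b c) :=
  (isOpen_lt continuous_const (continuous_cross_sub _ _)).inter
    ((isOpen_lt continuous_const (continuous_cross_sub _ _)).inter
      (isOpen_lt continuous_const (continuous_cross_sub _ _)))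

lemma mem_convexHull_triple {a b c x : Plane} :
    x ∈ convexHull ℝ {a, b, c} ↔
      ∃ u v w : ℝ, 0 ≤ u ∧ 0 ≤ v ∧ 0 ≤ w ∧ u + v + w = 1 ∧ x = u • a + v • b + w • c := by
  rw [convexHull_insert (by simp), convexHull_pair, mem_convexJoin]
  constructor
  · rintro ⟨a', ha', y, ⟨v, w, hv, hw, hvw, rfl⟩, ⟨u, u', hu, hu', huu, rfl⟩⟩
    rw [Set.mem_singleton_iff] at ha'
    subst ha'
    refine ⟨u, u' * v, u' * w, hu, by positivity, by positivity, ?_, ?_⟩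
    · rw [add_assoc, ← mul_add, hvw, mul_one, huu]
    · rw [smul_add, smul_smul, smul_smul, add_assoc]
  · rintro ⟨u, v, w, hu, hv, hw, h1, rfl⟩
    refine ⟨a, rfl, ?_⟩
    -- If `v + w = 0` the point is `a` itself, and any point of the opposite side serves as the
    -- second endpoint.
    rcases (add_nonneg hv hw).eq_or_lt with h0 | h0
    · have hv0 : v = 0 := by linarith
      have hw0 : w = 0 := by linarith
      have hu1 : u = 1 := by linarith
      subst hv0 hw0 hu1
      exact ⟨b, left_mem_segment ℝ b c, by simpa using left_mem_segment ℝ a b⟩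
    · refine ⟨(v / (v + w)) • b + (w / (v + w)) • c,
        ⟨v / (v + w), w / (v + w), by positivity, by positivity, by field_simp, rfl⟩,
        ⟨u, v + w, hu, h0.le, by linarith, ?_⟩⟩
      rw [smul_add, smul_smul, smul_smul, mul_div_cancel₀ _ h0.ne', mul_div_cancel₀ _ h0.ne',
        add_assoc]

/-- The barycentric coordinates of `x` are the signed areas cut off by the three edges, divided by
the total `D`; membership means that all three are nonnegative. -/
lemma mem_convexHull_iff_cross {a b c : Plane} (h : 0 < cross (b - a) (c - a)) {x : Plane} :
    x ∈ convexHull ℝ {a, b, c} ↔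
      0 ≤ cross (b - a) (x - a) ∧ 0 ≤ cross (c - b) (x - b) ∧ 0 ≤ cross (a - c) (x - c) := by
  rw [mem_convexHull_triple]
  constructor
  · rintro ⟨u, v, w, hu, hv, hw, h1, rfl⟩
    obtain rfl : u = 1 - v - w := by linarith
    refine ⟨(mul_nonneg hw h.le).trans_eq ?_, (mul_nonneg hu h.le).trans_eq ?_,
      (mul_nonneg hv h.le).trans_eq ?_⟩ <;> simp [cross] <;> ring
  · rintro ⟨h1, h2, h3⟩
    set D := cross (b - a) (c - a) with hD
    refine ⟨cross (c - b) (x - b) / D, cross (a - c) (x - c) / D, cross (b - a) (x - a) / D,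
      by positivity, by positivity, by positivity, ?_, ?_⟩
    · field_simp
      simp [hD, cross]; ring
    · ext i
      simp only [PiLp.add_apply, PiLp.smul_apply, smul_eq_mul]
      field_simp
      fin_cases i <;> simp [hD, cross] <;> ring

lemma openTri_subset_interior {a b c : Plane} (h : 0 < cross (b - a) (c - a)) :
    openTri a b c ⊆ interior (convexHull ℝ {a, b, c}) :=
  interior_maximal (fun _ hx => (mem_convexHull_iff_cross h).2 ⟨hx.1.le, hx.2.1.le, hx.2.2.le⟩)
    (isOpen_openTri a b c)

lemma openTri_nonempty {a b c : Plane} (h : 0 < cross (b - a) (c - a)) :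
    (openTri a b c).Nonempty := by
  -- At the centroid each of the three areas is a third of the whole.
  refine ⟨(3 : ℝ)⁻¹ • (a + b + c), ?_, ?_, ?_⟩ <;>
    refine (div_pos h (by norm_num : (0 : ℝ) < 3)).trans_eq ?_ <;> simp [cross] <;> ring

lemma isCompact_convexHull_triple (a b c : Plane) : IsCompact (convexHull ℝ {a, b, c}) :=
  (Set.toFinite {a, b, c}).isCompact_convexHull ℝ

/-- Two triangles on the same side of a common edge overlap. -/
lemma not_disjoint_of_common_edge {a b c d : Plane} (hc : 0 < cross (b - a) (c - a))
    (hd : 0 < cross (b - a) (d - a)) :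
    ¬Disjoint (interior (convexHull ℝ {a, b, c})) (interior (convexHull ℝ {a, b, d})) := by
  rw [Set.not_disjoint_iff]
  let m : Plane := (2 : ℝ)⁻¹ • (a + b)
  -- Start at the midpoint `m` of the common edge and move towards `c`. The area over `a b` becomes
  -- positive at once for either triangle; the other two are positive at `m` (half of the total) and
  -- remain so for small `δ`.
  let γ : ℝ → Plane := fun δ => m + δ • (c - m)
  have hγ : Continuous γ := by fun_prop
  have hγ0 : γ 0 = m := by simp [γ]
  have key : ∀ e : Plane, 0 < cross (b - a) (e - a) →
      ∀ᶠ δ in nhdsWithin (0 : ℝ) (Set.Ioi 0), γ δ ∈ openTri a b e := by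
    intro e he
    have c1 : ∀ᶠ δ in nhdsWithin (0 : ℝ) (Set.Ioi 0), 0 < cross (e - b) (γ δ - b) := by
      refine nhdsWithin_le_nhds (((continuous_cross_sub (e - b) b).comp hγ).tendsto 0
        |>.eventually (lt_mem_nhds ?_))
      simp only [Function.comp, hγ0]
      refine (half_pos he).trans_eq ?_
      simp [m, cross]; ring
    have c2 : ∀ᶠ δ in nhdsWithin (0 : ℝ) (Set.Ioi 0), 0 < cross (a - e) (γ δ - e) := by
      refine nhdsWithin_le_nhds (((continuous_cross_sub (a - e) e).comp hγ).tendsto 0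
        |>.eventually (lt_mem_nhds ?_))
      simp only [Function.comp, hγ0]
      refine (half_pos he).trans_eq ?_
      simp [m, cross]; ring
    filter_upwards [c1, c2, self_mem_nhdsWithin] with δ h1 h2 h3
    refine ⟨(mul_pos h3 hc).trans_eq ?_, h1, h2⟩
    simp [γ, m, cross]; ring
  obtain ⟨δ, h1, h2⟩ := ((key c hc).and (key d hd)).exists
  exact ⟨γ δ, openTri_subset_interior hc h1, openTri_subset_interior hd h2⟩

/-- A nonnegative continuous function with vanishing integral over a triangle vanishes inside. -/
lemma eq_zero_of_setIntegral_eq_zero {a b c : Plane} {f : Plane → ℝ} (hf : Continuous f)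
    (h0 : ∀ x ∈ convexHull ℝ {a, b, c}, 0 ≤ f x)
    (hint : ∫ x in convexHull ℝ {a, b, c}, f x = 0) :
    ∀ x ∈ interior (convexHull ℝ {a, b, c}), f x = 0 := by
  have hK := isCompact_convexHull_triple a b c
  rw [setIntegral_eq_zero_iff_of_nonneg_ae
    (ae_restrict_of_forall_mem hK.measurableSet h0) (hf.continuousOn.integrableOn_compact hK)] at hint
  -- Continuity upgrades the almost everywhere statement to every point of the open set.
  exact Measure.eqOn_open_of_ae_eq (ae_restrict_of_ae_restrict_of_subset interior_subset hint)
    isOpen_interior hf.continuousOn continuousOn_const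

/-! ### Integration over triangles -/

/-- The linear map of the plane with columns `u` and `v`. -/
def colMap (u v : Plane) : Plane →L[ℝ] Plane :=
  (EuclideanSpace.proj 0 : Plane →L[ℝ] ℝ).smulRight u +
    (EuclideanSpace.proj 1 : Plane →L[ℝ] ℝ).smulRight v

@[simp] lemma colMap_apply (u v y : Plane) : colMap u v y = y 0 • u + y 1 • v := by
  simp [colMap]

lemma det_colMap (u v : Plane) : (colMap u v).det = cross u v := by
  rw [ContinuousLinearMap.det,
    ← LinearMap.det_toMatrix (EuclideanSpace.basisFun (Fin 2) ℝ).toBasis, Matrix.det_fin_two]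
  simp [LinearMap.toMatrix_apply, cross]
  ring

lemma colMap_injective {u v : Plane} (h : cross u v ≠ 0) : Function.Injective (colMap u v) := by
  rw [injective_iff_map_eq_zero]
  intro y hy
  have h0 := congrArg (fun z : Plane => z 0) hy
  have h1 := congrArg (fun z : Plane => z 1) hy
  simp at h0 h1
  have e0 : y 0 * cross u v = 0 := by simp only [cross]; linear_combination v 1 * h0 - v 0 * h1
  have e1 : y 1 * cross u v = 0 := by simp only [cross]; linear_combination u 0 * h1 - u 1 * h0
  ext i
  fin_cases i
  · simpa [h] using e0
  · simpa [h] using e1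

/-- The reference triangle. -/
def refTri : Set (ℝ × ℝ) := {p | 0 ≤ p.1 ∧ 0 ≤ p.2 ∧ p.1 + p.2 ≤ 1}

lemma isCompact_refTri : IsCompact refTri := by
  refine (isCompact_Icc (a := (0 : ℝ × ℝ)) (b := 1)).of_isClosed_subset ?_ ?_
  · exact (isClosed_le continuous_const continuous_fst).inter
      ((isClosed_le continuous_const continuous_snd).inter
        (isClosed_le (continuous_fst.add continuous_snd) continuous_const))
  · rintro ⟨s, t⟩ ⟨h1, h2, h3⟩
    simp only at h1 h2 h3
    exact ⟨⟨h1, h2⟩, ⟨by simp; linarith, by simp; linarith⟩⟩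

/-- Fubini, with the first coordinate as the inner variable: it later runs along the edge whose
directional derivative is integrated. -/
lemma setIntegral_refTri {h : ℝ × ℝ → ℝ} (hh : Continuous h) :
    ∫ p in refTri, h p = ∫ t in (0 : ℝ)..1, ∫ s in (0 : ℝ)..(1 - t), h (s, t) := by
  have hm := isCompact_refTri.measurableSet
  have hi : Integrable (refTri.indicator h) :=
    (integrable_indicator_iff hm).2 (hh.continuousOn.integrableOn_compact isCompact_refTri)
  rw [← integral_indicator hm, Measure.volume_eq_prod, integral_prod_symm _ hi,
    intervalIntegral.integral_of_le zero_le_one, ← integral_Icc_eq_integral_Ioc,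
    ← integral_indicator measurableSet_Icc]
  congr 1 with t
  by_cases ht : t ∈ Set.Icc (0 : ℝ) 1
  · rw [Set.indicator_of_mem ht, intervalIntegral.integral_of_le (by linarith [ht.2]),
      ← integral_Icc_eq_integral_Ioc, ← integral_indicator measurableSet_Icc]
    congr 1 with s
    simp only [Set.indicator_apply, refTri, Set.mem_ofPred_eq, Set.mem_Icc]
    have : (0 ≤ s ∧ 0 ≤ t ∧ s + t ≤ 1) ↔ (0 ≤ s ∧ s ≤ 1 - t) :=
      ⟨fun h => ⟨h.1, by linarith [h.2.2]⟩, fun h => ⟨h.1, ht.1, by linarith [h.2]⟩⟩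
    simp only [this]
  · rw [Set.indicator_of_notMem ht]
    refine integral_eq_zero_of_ae (Filter.Eventually.of_forall fun s => ?_)
    refine Set.indicator_of_notMem ?_ h
    rintro ⟨h1, h2, h3⟩
    simp only at h1 h2 h3
    exact ht ⟨h2, by linarith⟩

/-- The measurable identification of the plane with `ℝ × ℝ`. -/
def planeEquivProd : Plane ≃ᵐ ℝ × ℝ :=
  (MeasurableEquiv.toLp 2 (Fin 2 → ℝ)).symm.trans MeasurableEquiv.finTwoArrow

lemma measurePreserving_planeEquivProd : MeasurePreserving planeEquivProd :=
  (PiLp.volume_preserving_ofLp (Fin 2)).trans (volume_preserving_finTwoArrow ℝ)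

lemma convexHull_eq_image (a b c : Plane) :
    convexHull ℝ {a, b, c} =
      (fun y => a + colMap (b - a) (c - a) y) '' (planeEquivProd ⁻¹' refTri) := by
  ext x
  rw [mem_convexHull_triple]
  constructor
  · rintro ⟨u, v, w, hu, hv, hw, h1, rfl⟩
    refine ⟨!₂[v, w], ⟨?_, ?_, ?_⟩, ?_⟩
    · simpa [planeEquivProd] using hv
    · simpa [planeEquivProd] using hw
    · simp [planeEquivProd]; linarith
    · obtain rfl : u = 1 - v - w := by linarith
      simp only [colMap_apply]
      ext i; fin_cases i <;> simp <;> ring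
  · rintro ⟨y, ⟨h1, h2, h3⟩, rfl⟩
    simp [planeEquivProd] at h1 h2 h3
    refine ⟨1 - y 0 - y 1, y 0, y 1, by linarith, h1, h2, by ring, ?_⟩
    simp only [colMap_apply]
    ext i; fin_cases i <;> simp <;> ring

/-- The integral over a triangle as an iterated integral. -/
lemma setIntegral_triangle {a b c : Plane} (h : cross (b - a) (c - a) ≠ 0) {f : Plane → ℝ}
    (hf : Continuous f) :
    ∫ x in convexHull ℝ {a, b, c}, f x = |cross (b - a) (c - a)| *
      ∫ t in (0 : ℝ)..1, ∫ s in (0 : ℝ)..(1 - t), f (a + (s • (b - a) + t • (c - a))) := by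
  have hd : ∀ y ∈ planeEquivProd ⁻¹' refTri,
      HasFDerivWithinAt (fun y => a + colMap (b - a) (c - a) y) (colMap (b - a) (c - a))
        (planeEquivProd ⁻¹' refTri) y := fun y _ =>
    ((colMap (b - a) (c - a)).hasFDerivAt.const_add a).hasFDerivWithinAt
  have hinj : Set.InjOn (fun y => a + colMap (b - a) (c - a) y) (planeEquivProd ⁻¹' refTri) :=
    fun y _ z _ hyz => colMap_injective h (add_left_cancel hyz)
  rw [convexHull_eq_image, integral_image_eq_integral_abs_det_fderiv_smul volume
    (planeEquivProd.measurable isCompact_refTri.measurableSet) hd hinj, det_colMap]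
  simp only [smul_eq_mul]
  rw [integral_const_mul]
  congr 1
  have := setIntegral_refTri (h := fun p => f (a + (p.1 • (b - a) + p.2 • (c - a)))) (by fun_prop)
  rw [← this, ← measurePreserving_planeEquivProd.setIntegral_preimage_emb
    planeEquivProd.measurableEmbedding]
  congr 1

/-- The integral over a triangle of a derivative in the direction of an edge. -/
lemma setIntegral_fderiv_edge {a b c : Plane} (h : cross (b - a) (c - a) ≠ 0) {φ : Plane → ℝ}
    (hφ : ContDiff ℝ 1 φ) :
    ∫ x in convexHull ℝ {a, b, c}, fderiv ℝ φ x (b - a) = |cross (b - a) (c - a)| *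
      ((∫ t in (0 : ℝ)..1, φ (AffineMap.lineMap b c t)) -
        ∫ t in (0 : ℝ)..1, φ (AffineMap.lineMap a c t)) := by
  have hφ' : Continuous fun x => fderiv ℝ φ x (b - a) :=
    (hφ.continuous_fderiv (by simp)).clm_apply continuous_const
  have hφc := hφ.continuous
  rw [setIntegral_triangle h hφ']
  congr 1
  rw [← intervalIntegral.integral_sub
    (Continuous.intervalIntegrable (by simp only [AffineMap.lineMap_apply_module]; fun_prop) _ _)
    (Continuous.intervalIntegrable (by simp only [AffineMap.lineMap_apply_module]; fun_prop) _ _)]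
  congr 1 with t
  -- The inner variable runs in the direction `b - a`, so the fundamental theorem applies on each
  -- slice; the slice ends at `s = 0` on the edge `a c` and at `s = 1 - t` on the edge `b c`.
  have hder : ∀ s : ℝ, HasDerivAt (fun s : ℝ => φ (a + (s • (b - a) + t • (c - a))))
      (fderiv ℝ φ (a + (s • (b - a) + t • (c - a))) (b - a)) s := by
    intro s
    have h1 : HasDerivAt (fun s : ℝ => a + (s • (b - a) + t • (c - a))) (b - a) s := by
      simpa using (((hasDerivAt_id s).smul_const (b - a)).add_const (t • (c - a))).const_add a
    exact ((hφ.differentiable (by simp) _).hasFDerivAt.comp_hasDerivAt s h1)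
  rw [intervalIntegral.integral_eq_sub_of_hasDerivAt (fun s _ => hder s)
    (Continuous.intervalIntegrable (hφ'.comp (by fun_prop)) _ _)]
  congr 2 <;>
  · simp only [AffineMap.lineMap_apply_module]
    ext i; simp; ring

/-- The flux of a vector field through the segment from `a` to `b`, from left to right. -/
def flux (a b : Plane) (F : Plane → Fin 2 → ℝ) : ℝ :=
  segInt a b fun x => F x ⬝ᵥ normal a b

/-- The length factor of the line integral cancels the normalisation of the normal, which leaves an
expression without denominators that also holds for a degenerate segment. -/
lemma flux_eq (a b : Plane) (F : Plane → Fin 2 → ℝ) :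
    flux a b F = ∫ t in (0 : ℝ)..1, (F (AffineMap.lineMap a b t) 0 * (b 1 - a 1) -
      F (AffineMap.lineMap a b t) 1 * (b 0 - a 0)) := by
  rw [flux, segInt, ← intervalIntegral.integral_const_mul]
  congr 1 with t
  rcases eq_or_ne a b with rfl | hab
  · simp
  · have := dist_ne_zero.2 hab
    simp [normal, dotProduct, Fin.sum_univ_two]
    field_simp
    ring

lemma segInt_symm (a b : Plane) (f : Plane → ℝ) : segInt a b f = segInt b a f := by
  rw [segInt, segInt, dist_comm]
  congr 1
  have := intervalIntegral.integral_comp_sub_left (a := 0) (b := 1)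
    (fun t : ℝ => f (AffineMap.lineMap a b t)) 1
  simp only [sub_self, sub_zero] at this
  rw [← this]
  simp only [AffineMap.lineMap_apply_one_sub]

lemma normal_symm (a b : Plane) : normal b a = -normal a b := by
  ext i
  fin_cases i <;> simp [normal, dist_comm b a] <;> ring

lemma flux_symm (a b : Plane) (F : Plane → Fin 2 → ℝ) : flux b a F = -flux a b F := by
  rw [flux, segInt_symm b a]
  simp only [flux, normal_symm a b, segInt, dotProduct_neg,
    intervalIntegral.integral_neg, mul_neg]

/-- The divergence theorem on a triangle. -/
lemma setIntegral_div_triangle {a b c : Plane} (h : 0 < cross (b - a) (c - a))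
    {F : Plane → Fin 2 → ℝ} (hF : ∀ i, ContDiff ℝ 1 fun x => F x i) :
    ∫ x in convexHull ℝ {a, b, c},
      ∑ i, fderiv ℝ (fun y => F y i) x (EuclideanSpace.single i 1) =
    flux a b F + flux b c F + flux c a F := by
  set D := cross (b - a) (c - a) with hD
  -- By Cramer's rule `F = α (b - a) + β (c - a)`, hence `div F` is the derivative of `α` along `b -
  -- a` plus that of `β` along `c - a`, and each is handled by `setIntegral_fderiv_edge`.
  let α : Plane → ℝ := fun x => (F x 0 * (c 1 - a 1) - F x 1 * (c 0 - a 0)) / D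
  let β : Plane → ℝ := fun x => ((b 0 - a 0) * F x 1 - (b 1 - a 1) * F x 0) / D
  have hα : ContDiff ℝ 1 α :=
    (((hF 0).mul contDiff_const).sub ((hF 1).mul contDiff_const)).div_const _
  have hβ : ContDiff ℝ 1 β :=
    ((contDiff_const.mul (hF 1)).sub (contDiff_const.mul (hF 0))).div_const _
  have hαc := hα.continuous
  have hβc := hβ.continuous
  have hdiv : ∀ x, ∑ i, fderiv ℝ (fun y => F y i) x (EuclideanSpace.single i 1) =
      fderiv ℝ α x (b - a) + fderiv ℝ β x (c - a) := by
    intro x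
    have d0 := (((hF 0).differentiable (by simp)) x).hasFDerivAt
    have d1 := (((hF 1).differentiable (by simp)) x).hasFDerivAt
    have eα : HasFDerivAt α (D⁻¹ • ((c 1 - a 1) • fderiv ℝ (fun y => F y 0) x -
        (c 0 - a 0) • fderiv ℝ (fun y => F y 1) x)) x := by
      have : α = fun x => D⁻¹ * ((c 1 - a 1) * F x 0 - (c 0 - a 0) * F x 1) := by
        ext y; simp only [α]; ring
      rw [this]
      exact ((d0.const_mul (c 1 - a 1)).fun_sub (d1.const_mul (c 0 - a 0))).const_mul D⁻¹
    have eβ : HasFDerivAt β (D⁻¹ • ((b 0 - a 0) • fderiv ℝ (fun y => F y 1) x -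
        (b 1 - a 1) • fderiv ℝ (fun y => F y 0) x)) x := by
      have : β = fun x => D⁻¹ * ((b 0 - a 0) * F x 1 - (b 1 - a 1) * F x 0) := by
        ext y; simp only [β]; ring
      rw [this]
      exact ((d1.const_mul (b 0 - a 0)).fun_sub (d0.const_mul (b 1 - a 1))).const_mul D⁻¹
    have hv : ∀ v : Plane, v = v 0 • EuclideanSpace.single 0 1 + v 1 • EuclideanSpace.single 1 1 := by
      intro v; ext i; fin_cases i <;> simp
    rw [eα.fderiv, eβ.fderiv, Fin.sum_univ_two, hv (b - a), hv (c - a)]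
    simp only [map_add, map_smul, _root_.smul_apply, _root_.sub_apply, smul_eq_mul,
      PiLp.sub_apply]
    field_simp
    simp only [hD, cross, PiLp.sub_apply]
    ring
  -- For the derivative along `c - a` the roles of `b` and `c` are exchanged, which reverses the
  -- orientation; only the absolute value of the determinant matters.
  have hD' : cross (c - a) (b - a) ≠ 0 := by rw [cross_swap, ← hD]; simpa using h.ne'
  have habs : |cross (c - a) (b - a)| = D := by rw [cross_swap, abs_neg, ← hD, abs_of_pos h]
  have hK := isCompact_convexHull_triple a b c
  have iα : Continuous fun x => fderiv ℝ α x (b - a) :=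
    (hα.continuous_fderiv (by simp)).clm_apply continuous_const
  have iβ : Continuous fun x => fderiv ℝ β x (c - a) :=
    (hβ.continuous_fderiv (by simp)).clm_apply continuous_const
  simp only [hdiv]
  rw [integral_add (iα.continuousOn.integrableOn_compact hK)
      (iβ.continuousOn.integrableOn_compact hK), setIntegral_fderiv_edge h.ne' hα]
  have hset : ({a, b, c} : Set Plane) = {a, c, b} := by
    ext; simp; tauto
  rw [hset, setIntegral_fderiv_edge hD' hβ, habs, abs_of_pos h]
  have line : ∀ p q : Plane, Continuous fun t : ℝ => AffineMap.lineMap (k := ℝ) p q t := by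
    intro p q; simp only [AffineMap.lineMap_apply_module]; fun_prop
  have seg : ∀ (f : Plane → ℝ) (p q : Plane), (∫ t in (0 : ℝ)..1, f (AffineMap.lineMap p q t)) =
      ∫ t in (0 : ℝ)..1, f (AffineMap.lineMap q p t) := by
    intro f p q
    have := intervalIntegral.integral_comp_sub_left (a := 0) (b := 1)
      (fun t : ℝ => f (AffineMap.lineMap p q t)) 1
    simp only [sub_self, sub_zero] at this
    rw [← this]
    simp only [AffineMap.lineMap_apply_one_sub]
  rw [seg β c b, seg α a c, flux_eq, flux_eq, flux_eq]
  have int : ∀ (f : Plane → ℝ) (p q : Plane), Continuous f →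
      IntervalIntegrable (fun t : ℝ => f (AffineMap.lineMap p q t)) volume 0 1 :=
    fun f p q hf => (hf.comp (line p q)).intervalIntegrable _ _
  -- The part of `F` parallel to an edge has no flux through it: `a b` sees only `β`, `c a` only
  -- `α`, and `b c` sees both.
  have e1 : (∫ t in (0 : ℝ)..1, (F (AffineMap.lineMap a b t) 0 * (b 1 - a 1) -
      F (AffineMap.lineMap a b t) 1 * (b 0 - a 0))) =
      -(D * ∫ t in (0 : ℝ)..1, β (AffineMap.lineMap a b t)) := by
    rw [← intervalIntegral.integral_const_mul, ← intervalIntegral.integral_neg]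
    congr 1 with t
    simp only [β]; field_simp; ring
  have e2 : (∫ t in (0 : ℝ)..1, (F (AffineMap.lineMap c a t) 0 * (a 1 - c 1) -
      F (AffineMap.lineMap c a t) 1 * (a 0 - c 0))) =
      -(D * ∫ t in (0 : ℝ)..1, α (AffineMap.lineMap c a t)) := by
    rw [← intervalIntegral.integral_const_mul, ← intervalIntegral.integral_neg]
    congr 1 with t
    simp only [α]; field_simp; ring
  have e3 : (∫ t in (0 : ℝ)..1, (F (AffineMap.lineMap b c t) 0 * (c 1 - b 1) -
      F (AffineMap.lineMap b c t) 1 * (c 0 - b 0))) =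
      D * (∫ t in (0 : ℝ)..1, α (AffineMap.lineMap b c t)) +
      D * ∫ t in (0 : ℝ)..1, β (AffineMap.lineMap b c t) := by
    rw [← intervalIntegral.integral_const_mul, ← intervalIntegral.integral_const_mul,
      ← intervalIntegral.integral_add ((int α b c hαc).const_mul D) ((int β b c hβc).const_mul D)]
    congr 1 with t
    simp only [α, β]; field_simp; ring
  rw [e1, e2, e3]
  ring

namespace CellFamily

/-! ### Combinatorics of conforming meshes -/

/-- Any two subtriangles do not overlap and meet in a common face. -/
def Conforming (M : CellFamily) : Prop := ∀ s t : M.Tri, s ≠ t → FaceToFace (verts s) (verts t)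

variable {M N : CellFamily}

lemma cross_pos (s : M.Tri) : 0 < cross (base₀ s - apex s) (base₁ s - apex s) :=
  (M.cell s.1).ccw s.2

lemma tri_eq (s : M.Tri) : tri s = convexHull ℝ {apex s, base₀ s, base₁ s} := rfl

lemma isCompact_tri (s : M.Tri) : IsCompact (tri s) := isCompact_convexHull_triple _ _ _

lemma interior_tri_nonempty (s : M.Tri) : (interior (tri s)).Nonempty :=
  (openTri_nonempty (cross_pos s)).mono (openTri_subset_interior (cross_pos s))

lemma interior_tri_subset_region (s : M.Tri) : interior (tri s) ⊆ M.region :=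
  interior_mono (Set.subset_iUnion _ s)

lemma isOpen_region : IsOpen M.region := isOpen_interior

/-- The rotation of the subtriangles of a primal element. -/
def prevEquiv : M.Tri ≃ M.Tri :=
  Equiv.sigmaCongrRight fun _ => (finRotate _).symm

lemma prevEquiv_apply (s : M.Tri) : prevEquiv s = prev s := rfl

@[simp] lemma apex_prev (s : M.Tri) : apex (prev s) = apex s := rfl

@[simp] lemma base₁_prev (s : M.Tri) : base₁ (prev s) = base₀ s := by
  show (M.cell s.1).vert (finRotate _ ((finRotate _).symm s.2)) = _
  rw [Equiv.apply_symm_apply]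
  rfl

lemma exists_prev_eq (s : M.Tri) : ∃ t, prev t = s :=
  ⟨prevEquiv.symm s, prevEquiv.apply_symm_apply s⟩

/-- The vertices in counterclockwise order. -/
def vtx (s : M.Tri) : Fin 3 → Plane := ![apex s, base₀ s, base₁ s]

/-- The directed edges, with the triangle on their left. -/
def dedge (s : M.Tri) (i : Fin 3) : Plane × Plane := (vtx s i, vtx s (i + 1))

lemma dedge_zero (s : M.Tri) : dedge s 0 = (apex s, base₀ s) := rfl
lemma dedge_one (s : M.Tri) : dedge s 1 = (base₀ s, base₁ s) := rfl
lemma dedge_two (s : M.Tri) : dedge s 2 = (base₁ s, apex s) := rfl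

lemma verts_eq (s : M.Tri) (i : Fin 3) : verts s = {vtx s i, vtx s (i + 1), vtx s (i + 2)} := by
  fin_cases i <;> ext x <;> simp [verts, vtx] <;> tauto

lemma cross_vtx_pos (s : M.Tri) (i : Fin 3) :
    0 < cross (vtx s (i + 1) - vtx s i) (vtx s (i + 2) - vtx s i) := by
  have := cross_pos s
  fin_cases i
  · exact this
  · exact this.trans_eq (cross_rotate _ _ _).symm
  · exact this.trans_eq ((cross_rotate _ _ _).symm.trans (cross_rotate _ _ _).symm)

lemma vtx_ne (s : M.Tri) (i : Fin 3) : vtx s i ≠ vtx s (i + 1) := by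
  intro h
  have := cross_vtx_pos s i
  simp [h, cross] at this

lemma apex_ne_base₀ (s : M.Tri) : apex s ≠ base₀ s := vtx_ne s 0
lemma base₀_ne_base₁ (s : M.Tri) : base₀ s ≠ base₁ s := vtx_ne s 1
lemma base₁_ne_apex (s : M.Tri) : base₁ s ≠ apex s := vtx_ne s 2

/-- Every triangle lies to the left of its directed edges, so a common directed edge would make the
two triangles overlap. The second triangle may belong to another family, as needed at the interface.
-/
lemma dedge_ne {s : M.Tri} {t : N.Tri} (h : FaceToFace (verts s) (verts t)) (i j : Fin 3) :
    dedge s i ≠ dedge t j := by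
  intro he
  simp only [dedge, Prod.mk.injEq] at he
  have hs := cross_vtx_pos s i
  have ht := cross_vtx_pos t j
  have hd := h.1
  rw [verts_eq s i, verts_eq t j, he.1, he.2] at hd
  rw [he.1, he.2] at hs
  exact not_disjoint_of_common_edge hs ht hd

lemma Conforming.eq_of_dedge (hM : M.Conforming) {s t : M.Tri} {i j : Fin 3}
    (h : dedge s i = dedge t j) : s = t := by
  by_contra hst
  exact dedge_ne (hM s t hst) i j h

/-- The two triangles at an edge. -/
lemma Conforming.of_opposite_dedge (hM : M.Conforming) {s t : M.Tri} {i j : Fin 3}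
    (h : dedge t j = (dedge s i).swap) :
    (i = 0 → t = prev s) ∧ (i = 2 → s = prev t) ∧ (i = 1 → primalEdge s = primalEdge t) := by
  refine ⟨?_, ?_, ?_⟩
  · rintro rfl
    -- The reversed edge is also a directed edge of `prev s`, and a directed edge determines its
    -- triangle.
    exact hM.eq_of_dedge (i := j) (j := 2) (by rw [h, dedge_zero, dedge_two]; simp)
  · rintro rfl
    obtain ⟨s', rfl⟩ := exists_prev_eq s
    rw [hM.eq_of_dedge (s := t) (t := s') (i := j) (j := 0)
      (by rw [h, dedge_zero, dedge_two]; simp)]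
  · rintro rfl
    rw [dedge_one] at h
    -- A primal edge of `s` cannot be a dual edge of `t`: the second triangle at that dual edge
    -- would be `s`, and the apex of `s` would coincide with one of its other vertices.
    have hj : j = 0 ∨ j = 1 ∨ j = 2 := by fin_cases j <;> simp
    rcases hj with rfl | rfl | rfl
    · rw [dedge_zero] at h
      simp only [Prod.swap_prod_mk, Prod.mk.injEq] at h
      have := hM.eq_of_dedge (s := s) (t := prev t) (i := 1) (j := 2)
        (by rw [dedge_one, dedge_two]; simp [h])
      exact absurd (by rw [this, apex_prev, h.1, ← this]) (base₁_ne_apex s)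
    · rw [dedge_one] at h
      simp only [Prod.swap_prod_mk, Prod.mk.injEq] at h
      rw [primalEdge, primalEdge, h.1, h.2, Sym2.eq_swap]
    · rw [dedge_two] at h
      simp only [Prod.swap_prod_mk, Prod.mk.injEq] at h
      obtain ⟨t', rfl⟩ := exists_prev_eq t
      have := hM.eq_of_dedge (s := s) (t := t') (i := 1) (j := 0)
        (by rw [dedge_one, dedge_zero]; simp [← h.1, ← h.2])
      subst this
      exact absurd h.2 (apex_ne_base₀ s)

lemma exists_dedge {s : M.Tri} {p q : Plane} (hp : p ∈ verts s) (hq : q ∈ verts s) (hpq : p ≠ q) :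
    ∃ i, dedge s i = (p, q) ∨ dedge s i = (q, p) := by
  simp only [verts, Set.mem_insert_iff, Set.mem_singleton_iff] at hp hq
  rcases hp with rfl | rfl | rfl <;> rcases hq with rfl | rfl | rfl
  · exact absurd rfl hpq
  · exact ⟨0, Or.inl rfl⟩
  · exact ⟨2, Or.inr rfl⟩
  · exact ⟨0, Or.inr rfl⟩
  · exact absurd rfl hpq
  · exact ⟨1, Or.inl rfl⟩
  · exact ⟨2, Or.inl rfl⟩
  · exact ⟨1, Or.inr rfl⟩
  · exact absurd rfl hpq

/-- Distinct triangles traverse a shared edge in opposite directions, since the same direction would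
force them to be equal. -/
lemma Conforming.exists_opposite_dedge (hM : M.Conforming) {s t : M.Tri} (hst : s ≠ t)
    {p q : Plane} (hps : p ∈ verts s) (hqs : q ∈ verts s) (hpt : p ∈ verts t) (hqt : q ∈ verts t)
    (hpq : p ≠ q) :
    ∃ i j, dedge t j = (dedge s i).swap ∧ (dedge s i = (p, q) ∨ dedge s i = (q, p)) := by
  obtain ⟨i, hi⟩ := exists_dedge hps hqs hpq
  obtain ⟨j, hj⟩ := exists_dedge hpt hqt hpq
  refine ⟨i, j, ?_, hi⟩
  rcases hi with hi | hi <;> rcases hj with hj | hj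
  · exact absurd (hM.eq_of_dedge (hi.trans hj.symm)) hst
  · rw [hi, hj]; rfl
  · rw [hi, hj]; rfl
  · exact absurd (hM.eq_of_dedge (hi.trans hj.symm)) hst

lemma Conforming.base_eq (hM : M.Conforming) {s t : M.Tri} (hst : s ≠ t)
    (h : primalEdge s = primalEdge t) : base₀ t = base₁ s ∧ base₁ t = base₀ s := by
  rw [primalEdge, primalEdge, Sym2.eq_iff] at h
  rcases h with h | h
  · exact absurd (hM.eq_of_dedge (i := 1) (j := 1) (by rw [dedge_one, dedge_one, h.1, h.2])) hst
  · exact ⟨h.2.symm, h.1.symm⟩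

lemma Conforming.eq_of_primalEdge (hM : M.Conforming) {s t t' : M.Tri} (hst : s ≠ t)
    (hst' : s ≠ t') (h : primalEdge s = primalEdge t) (h' : primalEdge s = primalEdge t') :
    t = t' := by
  have e := hM.base_eq hst h
  have e' := hM.base_eq hst' h'
  exact hM.eq_of_dedge (i := 1) (j := 1) (by rw [dedge_one, dedge_one, e.1, e.2, e'.1, e'.2])

/-- Two triangles of one element have the same apex, and reversing the base would reverse the sign
of the area. Hence the strict order on element indices selects exactly one representative of each
interior edge. -/
lemma Conforming.cell_ne (hM : M.Conforming) {s t : M.Tri} (hst : s ≠ t)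
    (h : primalEdge s = primalEdge t) : s.1 ≠ t.1 := by
  intro hc
  have e := hM.base_eq hst h
  have ha : apex s = apex t := by simp only [apex, hc]
  have h1 := cross_pos s
  have h2 := cross_pos t
  rw [e.1, e.2, ← ha, cross_swap] at h2
  linarith

/-- Two triangles of `M` traverse the edge in opposite directions, so one of them would agree with
the direction in `t`. This makes interface edges boundary edges of each subdomain. -/
lemma Conforming.not_primalEdge_eq {s s' : M.Tri} {t : N.Tri} (hM : M.Conforming)
    (hf : ∀ s : M.Tri, FaceToFace (verts s) (verts t)) (h : primalEdge s = primalEdge t)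
    (h' : primalEdge s' = primalEdge t) : s = s' := by
  by_contra hst
  have e := hM.base_eq hst (h.trans h'.symm)
  rw [primalEdge, primalEdge, Sym2.eq_iff] at h
  rcases h with h | h
  · exact dedge_ne (hf s) 1 1 (by rw [dedge_one, dedge_one, h.1, h.2])
  · exact dedge_ne (hf s') 1 1 (by rw [dedge_one, dedge_one, e.1, e.2, h.1, h.2])

/-- The normals on the two sides of an interior edge are opposite. -/
lemma Conforming.outNormal_eq (hM : M.Conforming) {s t : M.Tri} (hst : s ≠ t)
    (h : primalEdge s = primalEdge t) : outNormal t = -outNormal s := by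
  have e := hM.base_eq hst h
  rw [outNormal, outNormal, e.1, e.2, normal_symm]

lemma Conforming.primalInt_eq (hM : M.Conforming) {s t : M.Tri} (hst : s ≠ t)
    (h : primalEdge s = primalEdge t) (f : Plane → ℝ) : primalInt t f = primalInt s f := by
  have e := hM.base_eq hst h
  rw [primalInt, primalInt, e.1, e.2, segInt_symm]

lemma IsInteriorPair.ne {p : M.Tri × M.Tri} (hp : IsInteriorPair p) : p.1 ≠ p.2 := by
  intro h
  exact absurd hp.1 (by rw [h]; exact lt_irrefl _)

open Classical in
/-- Every primal edge is an interior or a boundary edge. -/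
lemma Conforming.sum_primal (hM : M.Conforming) (f : M.Tri → ℝ) :
    ∑ s, f s = ∑ p ∈ Finset.univ.filter (IsInteriorPair (M := M)), (f p.1 + f p.2) +
      ∑ s ∈ Finset.univ.filter (IsBoundary (M := M)), f s := by
  set P := Finset.univ.filter (IsInteriorPair (M := M)) with hP
  have mem {p} : p ∈ P ↔ p.1.1 < p.2.1 ∧ primalEdge p.1 = primalEdge p.2 := by
    simp [hP, IsInteriorPair]
  have ne1 {p} (hp : p ∈ P) : p.1 ≠ p.2 := (Finset.mem_filter.1 hp).2.ne
  have i1 : Set.InjOn Prod.fst (P : Set (M.Tri × M.Tri)) := by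
    rintro ⟨s, t⟩ hp ⟨s', t'⟩ hp' (rfl : s = s')
    have := hM.eq_of_primalEdge (ne1 hp) (ne1 (p := (s, t')) hp') (mem.1 hp).2
      ((mem (p := (s, t'))).1 hp').2
    exact Prod.ext rfl this
  have i2 : Set.InjOn Prod.snd (P : Set (M.Tri × M.Tri)) := by
    rintro ⟨s, t⟩ hp ⟨s', t'⟩ hp' (rfl : t = t')
    have := hM.eq_of_primalEdge (ne1 hp).symm (ne1 (p := (s', t)) hp').symm (mem.1 hp).2.symm
      ((mem (p := (s', t))).1 hp').2.symm
    exact Prod.ext this rfl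
  -- A triangle that is first in one pair and second in another has the same neighbour in both,
  -- whose element index would be both larger and smaller than its own.
  have d12 : Disjoint (P.image Prod.fst) (P.image Prod.snd) := by
    rw [Finset.disjoint_left]
    intro s hs hs'
    obtain ⟨p, hp, rfl⟩ := Finset.mem_image.1 hs
    obtain ⟨q, hq, hqs⟩ := Finset.mem_image.1 hs'
    have h1 := mem.1 hp
    have h2 := mem.1 hq
    have := hM.eq_of_primalEdge (ne1 hp) (hqs ▸ (ne1 hq).symm) h1.2 (hqs ▸ h2.2.symm)
    rw [hqs, ← this] at h2
    exact lt_asymm h1.1 h2.1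
  -- So the triangles split into first members of pairs, second members of pairs, and boundary
  -- triangles.
  have hB : Finset.univ.filter (IsBoundary (M := M)) =
      (P.image Prod.fst ∪ P.image Prod.snd)ᶜ := by
    ext s
    simp only [Finset.mem_filter, Finset.mem_univ, true_and, Finset.mem_compl, Finset.mem_union,
      Finset.mem_image, not_or, not_exists, not_and]
    constructor
    · intro hs
      refine ⟨?_, ?_⟩
      · rintro p hp rfl
        exact ne1 hp (hs _ (mem.1 hp).2.symm).symm
      · rintro p hp rfl
        exact ne1 hp (hs _ (mem.1 hp).2)
    · rintro ⟨h1, h2⟩ t ht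
      by_contra hts
      rcases lt_or_gt_of_ne (hM.cell_ne hts ht) with h | h
      · exact h2 (t, s) (mem.2 ⟨h, ht⟩) rfl
      · exact h1 (s, t) (mem.2 ⟨h, ht.symm⟩) rfl
  rw [hB, ← Finset.sum_add_sum_compl (P.image Prod.fst ∪ P.image Prod.snd) f,
    Finset.sum_union d12, Finset.sum_image i1, Finset.sum_image i2, Finset.sum_add_distrib]

/-! ### Topology of the covered region -/

lemma finite_iUnion_verts : (⋃ s : M.Tri, verts s).Finite :=
  Set.finite_iUnion fun s => by simp [verts]

/-- Quantities that agree on adjacent subtriangles of a connected conforming mesh are constant. -/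
lemma Conforming.eq_of_adjacent (hM : M.Conforming) (hconn : IsConnected M.region) {β : Type*}
    (f : M.Tri → β) (h1 : ∀ s, f s = f (prev s))
    (h2 : ∀ s t, primalEdge s = primalEdge t → f s = f t) (s₀ t₀ : M.Tri) : f t₀ = f s₀ := by
  by_contra hne
  set F : Set Plane := ⋃ t ∈ {t : M.Tri | f t = f s₀}, tri t with hF
  set F' : Set Plane := ⋃ t ∈ {t : M.Tri | f t ≠ f s₀}, tri t with hF'
  have cF : IsClosed F := (Set.toFinite _).isClosed_biUnion fun t _ => (isCompact_tri t).isClosed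
  have cF' : IsClosed F' := (Set.toFinite _).isClosed_biUnion fun t _ => (isCompact_tri t).isClosed
  have cover : M.region ⊆ F ∪ F' := by
    intro x hx
    obtain ⟨t, ht⟩ := Set.mem_iUnion.1 (interior_subset hx)
    by_cases h : f t = f s₀
    · exact Or.inl (Set.mem_biUnion (x := t) h ht)
    · exact Or.inr (Set.mem_biUnion (x := t) h ht)
  -- Two triangles with different values share no edge, because `f` agrees across every edge; by
  -- conformity they meet at most in a vertex.
  have meet : F ∩ F' ⊆ ⋃ s : M.Tri, verts s := by
    rintro x ⟨hx, hx'⟩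
    obtain ⟨s, hs, hxs⟩ := Set.mem_iUnion₂.1 hx
    obtain ⟨t, ht, hxt⟩ := Set.mem_iUnion₂.1 hx'
    have hs : f s = f s₀ := hs
    have ht : f t ≠ f s₀ := ht
    have hst : s ≠ t := by rintro rfl; exact ht hs
    have hx'' : x ∈ convexHull ℝ (verts s ∩ verts t) := (hM s t hst).2 ▸ ⟨hxs, hxt⟩
    by_cases hsub : (verts s ∩ verts t).Subsingleton
    · have hconv : Convex ℝ (verts s ∩ verts t) := hsub.convex
      rw [hconv.convexHull_eq] at hx''
      exact Set.mem_iUnion.2 ⟨s, hx''.1⟩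
    · rw [Set.not_subsingleton_iff] at hsub
      obtain ⟨p, hp, q, hq, hpq⟩ := hsub
      obtain ⟨i, j, hij, -⟩ := hM.exists_opposite_dedge hst hp.1 hq.1 hp.2 hq.2 hpq
      have := hM.of_opposite_dedge hij
      exfalso
      have hi : i = 0 ∨ i = 1 ∨ i = 2 := by fin_cases i <;> simp
      rcases hi with hi | hi | hi
      · exact ht (by rw [this.1 hi, ← h1, hs])
      · exact ht (by rw [← h2 _ _ (this.2.2 hi), hs])
      · exact ht (by rw [h1, ← this.2.1 hi, hs])
  have ne (t : M.Tri) (G : Set Plane) (hG : tri t ⊆ G) : (M.region ∩ G).Nonempty := by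
    obtain ⟨x, hx⟩ := interior_tri_nonempty t
    exact ⟨x, interior_tri_subset_region t hx, hG (interior_subset hx)⟩
  -- Connectedness of the region gives a point common to both closed sets. It may well be a vertex,
  -- so this is not yet a contradiction.
  obtain ⟨x, hxU, hxF, hxF'⟩ := isPreconnected_closed_iff.1 hconn.isPreconnected F F' cF cF' cover
    (ne s₀ F (Set.subset_biUnion_of_mem (u := fun t : M.Tri => tri t)
      (show s₀ ∈ {t : M.Tri | f t = f s₀} from rfl)))
    (ne t₀ F' (Set.subset_biUnion_of_mem (u := fun t : M.Tri => tri t)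
      (show t₀ ∈ {t : M.Tri | f t ≠ f s₀} from hne)))
  -- Choose a ball about `x` inside the region that contains no other vertex.
  have hV : IsOpen (M.region ∩ ((⋃ s : M.Tri, verts s) \ {x})ᶜ) :=
    isOpen_region.inter (finite_iUnion_verts.subset Set.sdiff_subset).isClosed.isOpen_compl
  obtain ⟨r, hr, hball⟩ := Metric.isOpen_iff.1 hV x ⟨hxU, fun h => h.2 rfl⟩
  -- By convexity a triangle that contains `x` meets every sufficiently small circle about `x`.
  have far (t : M.Tri) (hxt : x ∈ tri t) :
      ∃ d > 0, ∀ ρ, 0 < ρ → ρ ≤ d → (Metric.sphere x ρ ∩ tri t).Nonempty := by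
    obtain ⟨y, hy, hyx⟩ : ∃ y ∈ tri t, y ≠ x := by
      by_cases h : apex t = x
      · exact ⟨base₀ t, subset_convexHull ℝ _ (by simp [verts]), fun h' =>
          apex_ne_base₀ t (h.trans h'.symm)⟩
      · exact ⟨apex t, subset_convexHull ℝ _ (by simp [verts]), h⟩
    have hd : 0 < dist x y := dist_pos.2 hyx.symm
    refine ⟨dist x y, hd, fun ρ h0 hρ => ⟨AffineMap.lineMap x y (ρ / dist x y), ?_, ?_⟩⟩
    · rw [Metric.mem_sphere, dist_lineMap_left, Real.norm_of_nonneg (by positivity)]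
      field_simp
    · exact (convex_convexHull ℝ _).lineMap_mem hxt hy
        ⟨by positivity, (div_le_one hd).2 hρ⟩
  obtain ⟨s, hs, hxs⟩ := Set.mem_iUnion₂.1 hxF
  obtain ⟨t, ht, hxt⟩ := Set.mem_iUnion₂.1 hxF'
  obtain ⟨d, hd, hds⟩ := far s hxs
  obtain ⟨d', hd', hdt⟩ := far t hxt
  set ρ := min (r / 2) (min d d') with hρ
  have hρ0 : 0 < ρ := by positivity
  have hρr : ρ < r := (min_le_left _ _).trans_lt (by linarith)
  have hsph : Metric.sphere x ρ ⊆ Metric.ball x r := fun y hy =>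
    Metric.mem_ball.2 ((Metric.mem_sphere.1 hy).trans_lt hρr)
  have hrank : 1 < Module.rank ℝ Plane := by
    rw [← Module.finrank_eq_rank, finrank_euclideanSpace_fin]
    norm_num
  -- A small circle about `x` is connected, is covered by `F ∪ F'` and meets both sets. Hence it
  -- contains a point of `F ∩ F'`, a vertex different from `x`, against the choice of the ball.
  obtain ⟨w, hw, hwF⟩ := isPreconnected_closed_iff.1
    (isConnected_sphere hrank x hρ0.le).isPreconnected F F' cF cF'
    (fun y hy => cover (hball (hsph hy)).1)
    ((hds ρ hρ0 ((min_le_right _ _).trans (min_le_left _ _))).mono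
      (Set.inter_subset_inter_right _ (Set.subset_biUnion_of_mem (u := fun t : M.Tri => tri t) hs)))
    ((hdt ρ hρ0 ((min_le_right _ _).trans (min_le_right _ _))).mono
      (Set.inter_subset_inter_right _ (Set.subset_biUnion_of_mem (u := fun t : M.Tri => tri t) ht)))
  refine (hball (hsph hw)).2 ⟨meet hwF, ?_⟩
  rintro (rfl : w = x)
  rw [Metric.mem_sphere, dist_self] at hw
  exact hρ0.ne hw

/-- Relatively interior points of boundary edges do not belong to the open region. -/
lemma Conforming.notMem_region_of_isBoundary (hM : M.Conforming) {s : M.Tri} (hs : IsBoundary s)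
    {l : ℝ} (hl0 : 0 < l) (hl1 : l < 1) :
    AffineMap.lineMap (base₀ s) (base₁ s) l ∉ M.region := by
  set x : Plane := AffineMap.lineMap (base₀ s) (base₁ s) l with hx
  have hxe : x = (1 - l) • base₀ s + l • base₁ s := AffineMap.lineMap_apply_module _ _ _
  intro hxr
  have hpos := cross_pos s
  have hxs : x ∈ tri s := by
    rw [tri_eq, mem_convexHull_triple]
    exact ⟨0, 1 - l, l, le_rfl, by linarith, hl0.le, by ring, by rw [hxe]; simp⟩
  -- This path leaves `s` across its primal edge.
  let γ : ℝ → Plane := fun δ => x + δ • (base₀ s - apex s)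
  have hγ : Continuous γ := by fun_prop
  have hγ0 : γ 0 = x := by simp [γ]
  -- If no other triangle contained `x`, the points just beyond the edge would be in the region but
  -- in no triangle.
  obtain ⟨t, hts, hxt⟩ : ∃ t, t ≠ s ∧ x ∈ tri t := by
    by_contra! hcon
    have e1 : ∀ t, t ≠ s → ∀ᶠ δ in nhdsWithin (0 : ℝ) (Set.Ioi 0), γ δ ∉ tri t := by
      intro t ht
      exact nhdsWithin_le_nhds (hγ.continuousAt.preimage_mem_nhds
        (hγ0 ▸ (isCompact_tri t).isClosed.isOpen_compl.mem_nhds (hcon t ht)))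
    have e2 : ∀ᶠ δ in nhdsWithin (0 : ℝ) (Set.Ioi 0), γ δ ∈ M.region := by
      exact nhdsWithin_le_nhds (hγ.continuousAt.preimage_mem_nhds
        (hγ0 ▸ isOpen_region.mem_nhds hxr))
    have e3 : ∀ᶠ δ in nhdsWithin (0 : ℝ) (Set.Ioi 0), γ δ ∉ tri s := by
      filter_upwards [self_mem_nhdsWithin] with δ hδ hmem
      have hδ : 0 < δ := hδ
      rw [tri_eq, mem_convexHull_iff_cross hpos] at hmem
      have : cross (base₁ s - base₀ s) (γ δ - base₀ s) =
          -(δ * cross (base₀ s - apex s) (base₁ s - apex s)) := by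
        simp [γ, hxe, cross]; ring
      have h2 := hmem.2.1
      rw [this] at h2
      have := mul_pos hδ hpos
      linarith
    have e4 : ∀ᶠ δ in nhdsWithin (0 : ℝ) (Set.Ioi 0), ∀ t : M.Tri, γ δ ∉ tri t := by
      rw [Filter.eventually_all]
      intro t
      by_cases h : t = s
      · rw [h]; exact e3
      · exact e1 t h
    obtain ⟨δ, hδ, hδ'⟩ := (e2.and e4).exists
    obtain ⟨t, ht⟩ := Set.mem_iUnion.1 (interior_subset hδ)
    exact hδ' t ht
  have hxh : x ∈ convexHull ℝ (verts s ∩ verts t) := (hM s t hts.symm).2 ▸ ⟨hxs, hxt⟩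
  -- Otherwise the common face would lie on the side from `apex s` to `base₁ s`, which contains no
  -- point of the open primal edge.
  have hb0 : base₀ s ∈ verts t := by
    by_contra hb
    have hsub : verts s ∩ verts t ⊆ {apex s, base₁ s} := by
      rintro y ⟨(rfl | rfl | rfl), hy⟩
      · simp
      · exact absurd hy hb
      · simp
    have := convexHull_mono hsub hxh
    rw [convexHull_pair] at this
    obtain ⟨u, v, hu, hv, huv, he⟩ := this
    obtain rfl : u = 1 - v := by linarith
    have c1 : cross (apex s - base₁ s) (x - base₁ s) = 0 := by
      rw [← he]; simp [cross]; ring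
    have c2 : cross (apex s - base₁ s) (x - base₁ s) =
        (1 - l) * cross (base₀ s - apex s) (base₁ s - apex s) := by
      rw [hxe]; simp [cross]; ring
    have := mul_pos (sub_pos.2 hl1) hpos
    linarith
  have hb1 : base₁ s ∈ verts t := by
    by_contra hb
    have hsub : verts s ∩ verts t ⊆ {apex s, base₀ s} := by
      rintro y ⟨(rfl | rfl | rfl), hy⟩
      · simp
      · simp
      · exact absurd hy hb
    have := convexHull_mono hsub hxh
    rw [convexHull_pair] at this
    obtain ⟨u, v, hu, hv, huv, he⟩ := this
    obtain rfl : u = 1 - v := by linarith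
    have c1 : cross (base₀ s - apex s) (x - apex s) = 0 := by
      rw [← he]; simp [cross]; ring
    have c2 : cross (base₀ s - apex s) (x - apex s) =
        l * cross (base₀ s - apex s) (base₁ s - apex s) := by
      rw [hxe]; simp [cross]; ring
    have := mul_pos hl0 hpos
    linarith
  obtain ⟨i, j, hij, hi⟩ := hM.exists_opposite_dedge hts.symm (p := base₀ s) (q := base₁ s)
    (by simp [verts]) (by simp [verts]) hb0 hb1 (base₀_ne_base₁ s)
  -- The shared edge is the primal edge of `s`, which a boundary triangle shares with no other
  -- triangle.
  have hi1 : i = 1 := by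
    have h01 := apex_ne_base₀ s
    have h20 := base₁_ne_apex s
    have h3 : i = 0 ∨ i = 1 ∨ i = 2 := by fin_cases i <;> simp
    rcases h3 with rfl | rfl | rfl
    · rw [dedge_zero] at hi; simp [h01, h20.symm] at hi
    · rfl
    · rw [dedge_two] at hi; simp [h01, (base₀_ne_base₁ s).symm] at hi
  exact hts (hs t ((hM.of_opposite_dedge hij).2.2 hi1).symm)

end CellFamily

/-! ### Line integrals -/

lemma continuous_lineMap_plane (a b : Plane) :
    Continuous fun t : ℝ => AffineMap.lineMap (k := ℝ) a b t := by
  simp only [AffineMap.lineMap_apply_module]; fun_prop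

lemma segInt_congr {a b : Plane} {f g : Plane → ℝ} (h : ∀ x ∈ segment ℝ a b, f x = g x) :
    segInt a b f = segInt a b g := by
  rw [segInt, segInt]
  congr 1
  refine intervalIntegral.integral_congr fun t ht => ?_
  rw [Set.uIcc_of_le zero_le_one] at ht
  refine h _ ?_
  rw [segment_eq_image_lineMap]
  exact Set.mem_image_of_mem _ ht

lemma segInt_zero (a b : Plane) : segInt a b (fun _ => 0) = 0 := by simp [segInt]

lemma segInt_add {a b : Plane} {f g : Plane → ℝ} (hf : Continuous f) (hg : Continuous g) :
    segInt a b (fun x => f x + g x) = segInt a b f + segInt a b g := by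
  have h1 : IntervalIntegrable (fun t => f (AffineMap.lineMap (k := ℝ) a b t)) volume 0 1 :=
    (hf.comp (continuous_lineMap_plane a b)).intervalIntegrable _ _
  have h2 : IntervalIntegrable (fun t => g (AffineMap.lineMap (k := ℝ) a b t)) volume 0 1 :=
    (hg.comp (continuous_lineMap_plane a b)).intervalIntegrable _ _
  rw [segInt, segInt, segInt, ← mul_add, intervalIntegral.integral_add h1 h2]

lemma segInt_neg (a b : Plane) (f : Plane → ℝ) :
    segInt a b (fun x => -f x) = -segInt a b f := by
  simp [segInt]

lemma segInt_sub {a b : Plane} {f g : Plane → ℝ} (hf : Continuous f) (hg : Continuous g) :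
    segInt a b (fun x => f x - g x) = segInt a b f - segInt a b g := by
  simp only [sub_eq_add_neg]
  rw [segInt_add hf (g := fun x => -g x) hg.neg, segInt_neg]

lemma normal_dotProduct_self {a b : Plane} (h : a ≠ b) : normal a b ⬝ᵥ normal a b = 1 := by
  have hd := dist_ne_zero.2 h
  have hsq : dist a b ^ 2 = (b 0 - a 0) ^ 2 + (b 1 - a 1) ^ 2 := by
    rw [EuclideanSpace.dist_eq, Real.sq_sqrt (by positivity), Fin.sum_univ_two, Real.dist_eq,
      Real.dist_eq, sq_abs, sq_abs]
    ring
  simp only [normal, dotProduct, Fin.sum_univ_two, Matrix.cons_val_zero, Matrix.cons_val_one]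
  field_simp
  rw [hsq]; ring

/-- Decomposition of the inner product into normal and tangential parts. -/
lemma dotProduct_eq_normal_add_tangent {a b : Plane} (h : a ≠ b) (v w : Fin 2 → ℝ) :
    v ⬝ᵥ w = (v ⬝ᵥ normal a b) * (w ⬝ᵥ normal a b) +
      (v ⬝ᵥ tangent a b) * (w ⬝ᵥ tangent a b) := by
  have h1 := normal_dotProduct_self h
  simp only [normal, tangent, dotProduct, Fin.sum_univ_two, Matrix.cons_val_zero,
    Matrix.cons_val_one] at h1 ⊢
  linear_combination (-(v 0 * w 0 + v 1 * w 1)) * h1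

@[fun_prop] lemma continuous_evVec (v : Fin 2 → Poly) : Continuous fun x => evVec x v :=
  continuous_pi fun i => continuous_ev (v i)

@[fun_prop] lemma continuous_evMat (G : Matrix (Fin 2) (Fin 2) Poly) :
    Continuous fun x => evMat x G :=
  continuous_pi fun i => continuous_pi fun j => continuous_ev (G i j)

lemma fderiv_ev_single (p : Poly) (x : Plane) (i : Fin 2) :
    fderiv ℝ (fun y => ev y p) x (EuclideanSpace.single i 1) = ev x (MvPolynomial.pderiv i p) := by
  rw [fderiv_ev, Fin.sum_univ_two]
  fin_cases i <;> simp

lemma ev_div (v : Fin 2 → Poly) (x : Plane) :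
    ev x (div v) = ∑ i, fderiv ℝ (fun y => evVec y v i) x (EuclideanSpace.single i 1) := by
  simp only [evVec, fderiv_ev_single, div, Fin.sum_univ_two, ev_add]

namespace CellFamily

variable {M : CellFamily}

/-! ### Elementwise integrals and the divergence theorem sorted by edges -/

lemma integrableOn_tri {f : Plane → ℝ} (hf : Continuous f) (s : M.Tri) :
    IntegrableOn f (tri s) := hf.continuousOn.integrableOn_compact (isCompact_tri s)

lemma elemInt_add {f g : M.Tri → Plane → ℝ} (hf : ∀ s, Continuous (f s))
    (hg : ∀ s, Continuous (g s)) :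
    elemInt (fun s x => f s x + g s x) = elemInt f + elemInt g := by
  rw [elemInt, elemInt, elemInt, ← Finset.sum_add_distrib]
  exact Finset.sum_congr rfl fun s _ =>
    integral_add (integrableOn_tri (hf s) s) (integrableOn_tri (hg s) s)

/-- Elementwise divergence theorem, sorted by edges. -/
lemma elemInt_div {F : M.Tri → Plane → Fin 2 → ℝ} (hF : ∀ s i, ContDiff ℝ 1 fun x => F s x i) :
    elemInt (fun s x => ∑ i, fderiv ℝ (fun y => F s y i) x (EuclideanSpace.single i 1)) =
      (∑ s, dualInt s fun x => (F s x - F (prev s) x) ⬝ᵥ dualNormal s) +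
        ∑ s, primalInt s fun x => F s x ⬝ᵥ outNormal s := by
  have hc : ∀ s, Continuous (F s) := fun s => continuous_pi fun i => (hF s i).continuous
  have h1 : ∀ s : M.Tri, (dualInt s fun x => (F s x - F (prev s) x) ⬝ᵥ dualNormal s) =
      flux (apex s) (base₀ s) (F s) - flux (apex s) (base₀ s) (F (prev s)) := by
    intro s
    have h1 := hc s
    have h2 := hc (prev s)
    simp only [dualInt, flux, sub_dotProduct]
    exact segInt_sub (by fun_prop) (by fun_prop)
  -- The side from the apex to `base₁` in `prev s` is the dual edge from the apex to `base₀` of `s`;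
  -- rotation within each element pairs the two contributions of every dual edge.
  have h2 : ∑ s : M.Tri, flux (apex s) (base₁ s) (F s) =
      ∑ s : M.Tri, flux (apex s) (base₀ s) (F (prev s)) := by
    rw [← Equiv.sum_comp prevEquiv]
    simp only [prevEquiv_apply, apex_prev, base₁_prev]
  simp only [h1, Finset.sum_sub_distrib, ← h2, elemInt, tri_eq]
  rw [← Finset.sum_sub_distrib, ← Finset.sum_add_distrib]
  refine Finset.sum_congr rfl fun s _ => ?_
  rw [setIntegral_div_triangle (cross_pos s) (hF s), flux_symm (apex s) (base₁ s)]
  simp only [flux, primalInt, outNormal]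
  ring

open Classical in
/-- The primal part of the boundary terms, sorted into interior and boundary edges. -/
lemma Conforming.sum_primalInt (hM : M.Conforming) {F : M.Tri → Plane → Fin 2 → ℝ}
    (hF : ∀ s, Continuous (F s)) :
    ∑ s, (primalInt s fun x => F s x ⬝ᵥ outNormal s) =
      ∑ p ∈ Finset.univ.filter (IsInteriorPair (M := M)),
        (primalInt p.1 fun x => (F p.1 x - F p.2 x) ⬝ᵥ outNormal p.1) +
      ∑ s ∈ Finset.univ.filter (IsBoundary (M := M)),
        primalInt s fun x => F s x ⬝ᵥ outNormal s := by
  rw [hM.sum_primal]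
  congr 1
  refine Finset.sum_congr rfl fun p hp => ?_
  have hp := (Finset.mem_filter.1 hp).2
  have h1 := hF p.1
  have h2 := hF p.2
  rw [hM.outNormal_eq hp.ne hp.2, hM.primalInt_eq hp.ne hp.2]
  simp only [primalInt, sub_dotProduct, dotProduct_neg]
  rw [segInt_neg, segInt_sub (by fun_prop) (by fun_prop), sub_eq_add_neg]

end CellFamily

namespace CoupledMesh

open CellFamily

variable (T : CoupledMesh)

/-! ### Boundary and interface edges of the coupled mesh -/

lemma confB : T.B.Conforming := T.conforming_B
lemma confD : T.D.Conforming := T.conforming_D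

lemma isBoundary_of_interface_left {s : T.B.Tri} {t : T.D.Tri}
    (h : primalEdge s = primalEdge t) : IsBoundary s := fun _ hs' =>
  T.confB.not_primalEdge_eq (fun s => T.conforming_BD s t) (hs'.trans h) h

lemma faceToFace_symm {A B : Set Plane} (h : FaceToFace A B) : FaceToFace B A :=
  ⟨h.1.symm, by rw [Set.inter_comm, h.2, Set.inter_comm]⟩

lemma isBoundary_of_interface_right {s : T.B.Tri} {t : T.D.Tri}
    (h : primalEdge s = primalEdge t) : IsBoundary t := fun _ ht' =>
  T.confD.not_primalEdge_eq (fun t => faceToFace_symm (T.conforming_BD s t))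
    (ht'.trans h.symm) h.symm

open Classical in
-- An interface edge is determined by its Brinkman triangle, since its Darcy triangle is unique; so
-- the sum over `Γ` can be written over triangles of `Ω_B`.
lemma sum_boundaryB (f : T.B.Tri → ℝ) :
    ∑ s ∈ Finset.univ.filter (IsBoundary (M := T.B)), f s =
      ∑ s ∈ T.edgesΓB, f s + ∑ e ∈ T.interfaceEdges, f e.1 := by
  have inj : Set.InjOn Prod.fst (T.interfaceEdges : Set (T.B.Tri × T.D.Tri)) := by
    rintro ⟨s, t⟩ h ⟨s', t'⟩ h' (rfl : s = s')
    have h : primalEdge s = primalEdge t := (Finset.mem_filter.1 h).2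
    have h' : primalEdge s = primalEdge t' := (Finset.mem_filter.1 h').2
    exact Prod.ext rfl (T.isBoundary_of_interface_right h' t (h.symm.trans h'))
  rw [← Finset.sum_image (f := f) inj, ← Finset.sum_union]
  · refine Finset.sum_congr ?_ fun _ _ => rfl
    ext s
    simp only [Finset.mem_filter, Finset.mem_univ, true_and, Finset.mem_union, Finset.mem_image,
      edgesΓB, interfaceEdges, Prod.exists, exists_and_right, exists_eq_right]
    constructor
    · intro h
      by_cases h' : ∃ t : T.D.Tri, primalEdge s = primalEdge t
      · exact Or.inr h'
      · exact Or.inl ⟨h, fun t ht => h' ⟨t, ht⟩⟩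
    · rintro (h | ⟨t, h⟩)
      · exact h.1
      · exact T.isBoundary_of_interface_left h
  · rw [Finset.disjoint_left]
    intro s hs hs'
    obtain ⟨⟨s', t⟩, h, rfl⟩ := Finset.mem_image.1 hs'
    exact (Finset.mem_filter.1 hs).2.2 t (Finset.mem_filter.1 h).2

/-! ### Discrete integration by parts -/

variable {T}

/-- Divergence theorem for `p v`. On dual edges `v ⬝ n` is continuous and only `p` jumps; on
interior primal edges `p` is continuous and only `v ⬝ n` jumps. The terms on `∂Ω_B` stay and are
exactly the boundary sums in `formbstar`. -/
lemma formbstar_eq_formb {k : ℕ} {p : T.B.Scalar} {v : T.B.Vec} (hp : p ∈ T.QB k)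
    (hv : v ∈ T.HB k) : formbstar p v = formb v p := by
  classical
  have key := elemInt_div (M := T.B) (F := fun s x => ev x (p s) • evVec x (v s)) (fun s i => by
    simpa [evVec] using (contDiff_ev (p s)).mul (contDiff_ev (v s i)))
  have hdiv : ∀ (s : T.B.Tri) x, ∑ i, fderiv ℝ (fun y => (ev y (p s) • evVec y (v s)) i) x
      (EuclideanSpace.single i 1) =
      evVec x (v s) ⬝ᵥ evVec x (grad (p s)) + ev x (p s) * ev x (div (v s)) := by
    intro s x
    have : ∀ i, (fun y => (ev y (p s) • evVec y (v s)) i) = fun y => ev y (p s * v s i) := by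
      intro i; ext y; simp [evVec]
    simp only [this, fderiv_ev_single, MvPolynomial.pderiv_mul]
    simp [evVec, grad, div, dotProduct, Fin.sum_univ_two]
    ring
  simp only [hdiv] at key
  rw [elemInt_add (fun s => by fun_prop) (fun s => by fun_prop),
    T.confB.sum_primalInt (fun s => by fun_prop), T.sum_boundaryB] at key
  have hdual : ∀ s : T.B.Tri, (dualInt s fun x =>
      (ev x (p s) • evVec x (v s) - ev x (p (prev s)) • evVec x (v (prev s))) ⬝ᵥ dualNormal s) =
      dualInt s fun x => (evVec x (v s) ⬝ᵥ dualNormal s) * (ev x (p s) - ev x (p (prev s))) := by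
    intro s
    refine segInt_congr fun x hx => ?_
    have := hv.2 s x hx
    rw [sub_dotProduct] at this
    simp only [sub_dotProduct, smul_dotProduct, smul_eq_mul]
    linear_combination ev x (p (prev s)) * this
  have hint : ∀ e ∈ T.primalInteriorB, (primalInt e.1 fun x =>
      (ev x (p e.1) • evVec x (v e.1) - ev x (p e.2) • evVec x (v e.2)) ⬝ᵥ outNormal e.1) =
      primalInt e.1 fun x => ((evVec x (v e.1) - evVec x (v e.2)) ⬝ᵥ outNormal e.1) *
        ev x (p e.1) := by
    intro e he
    refine segInt_congr fun x hx => ?_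
    have := hp.2 e he x hx
    simp only [sub_dotProduct, smul_dotProduct, smul_eq_mul]
    linear_combination (evVec x (v e.2) ⬝ᵥ outNormal e.1) * this
  have hpI : Finset.univ.filter (IsInteriorPair (M := T.B)) = T.primalInteriorB := by
    ext; simp [primalInteriorB]
  rw [hpI, Finset.sum_congr rfl hint] at key
  simp only [hdual, smul_dotProduct, smul_eq_mul] at key
  simp only [mul_comm (ev _ _) (evVec _ _ ⬝ᵥ _)] at key
  rw [formbstar, formb]
  linarith [key]

/-- Divergence theorem for `Gᵀ u`. On interior primal edges `G n` is continuous, and on `∂Ω_B` it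
vanishes. On dual edges the product splits into a normal part, where `u ⬝ n` is continuous, and a
tangential part, where `(G n) ⬝ t` is continuous. -/
lemma formBstar_eq_formB {k : ℕ} {u : T.B.Vec} {G : T.B.Tensor} (hu : u ∈ T.HB k)
    (hG : G ∈ T.WB k) : formBstar u G = formB G u := by
  classical
  have key := elemInt_div (M := T.B) (F := fun s x => (evMat x (G s))ᵀ *ᵥ evVec x (u s))
    (fun s i => by
      simp only [mulVec, dotProduct, Fin.sum_univ_two, transpose_apply, evMat, evVec]
      exact ((contDiff_ev _).mul (contDiff_ev _)).add ((contDiff_ev _).mul (contDiff_ev _)))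
  have hdiv : ∀ (s : T.B.Tri) x, ∑ i, fderiv ℝ (fun y => ((evMat y (G s))ᵀ *ᵥ evVec y (u s)) i) x
      (EuclideanSpace.single i 1) =
      evVec x (divMat (G s)) ⬝ᵥ evVec x (u s) + frob (evMat x (G s)) (evMat x (gradVec (u s))) := by
    intro s x
    have : ∀ i, (fun y => ((evMat y (G s))ᵀ *ᵥ evVec y (u s)) i) =
        fun y => ev y (G s 0 i * u s 0 + G s 1 i * u s 1) := by
      intro i; ext y; simp [evVec, evMat, mulVec, dotProduct, Fin.sum_univ_two]
    simp only [this, fderiv_ev_single, map_add, MvPolynomial.pderiv_mul]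
    simp [evVec, evMat, gradVec, divMat, frob, dotProduct, Fin.sum_univ_two]
    ring
  have hT : ∀ (s : T.B.Tri) x (n : Fin 2 → ℝ), ((evMat x (G s))ᵀ *ᵥ evVec x (u s)) ⬝ᵥ n =
      (evMat x (G s) *ᵥ n) ⬝ᵥ evVec x (u s) := by
    intro s x n
    simp [mulVec, dotProduct, Fin.sum_univ_two]
    ring
  simp only [hdiv] at key
  have hfrob : ∀ s : T.B.Tri, Continuous fun x => frob (evMat x (G s)) (evMat x (gradVec (u s))) :=
    fun s => by
      simp only [frob, evMat, Fin.sum_univ_two]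
      fun_prop
  rw [elemInt_add (fun s => by fun_prop) hfrob,
    T.confB.sum_primalInt (fun s => by fun_prop)] at key
  have hdual : ∀ s : T.B.Tri, (dualInt s fun x =>
      ((evMat x (G s))ᵀ *ᵥ evVec x (u s) -
        (evMat x (G (prev s)))ᵀ *ᵥ evVec x (u (prev s))) ⬝ᵥ dualNormal s) =
      (dualInt s fun x => ((evMat x (G s) - evMat x (G (prev s))) *ᵥ dualNormal s) ⬝ᵥ
        ((evVec x (u s) ⬝ᵥ dualNormal s) • dualNormal s)) +
      dualInt s fun x => ((evMat x (G s) *ᵥ dualNormal s) ⬝ᵥ dualTangent s) *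
        ((evVec x (u s) - evVec x (u (prev s))) ⬝ᵥ dualTangent s) := by
    intro s
    rw [dualInt, dualInt, dualInt, ← segInt_add (by fun_prop) (by fun_prop)]
    refine segInt_congr fun x hx => ?_
    have h1 := hu.2 s x hx
    have h2 := hG.2.2.1 s x hx
    have hdec : ∀ v w : Fin 2 → ℝ, v ⬝ᵥ w = (v ⬝ᵥ dualNormal s) * (w ⬝ᵥ dualNormal s) +
        (v ⬝ᵥ dualTangent s) * (w ⬝ᵥ dualTangent s) :=
      dotProduct_eq_normal_add_tangent (apex_ne_base₀ s)
    rw [sub_dotProduct, hT s, hT (prev s), hdec (evMat x (G s) *ᵥ dualNormal s) (evVec x (u s)),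
      hdec (evMat x (G (prev s)) *ᵥ dualNormal s) (evVec x (u (prev s)))]
    simp only [sub_dotProduct, sub_mulVec, dotProduct_smul, smul_eq_mul] at h1 h2 ⊢
    linear_combination ((evMat x (G (prev s)) *ᵥ dualNormal s) ⬝ᵥ dualNormal s) * h1 +
      (evVec x (u (prev s)) ⬝ᵥ dualTangent s) * h2
  have hint : ∀ e ∈ T.primalInteriorB, (primalInt e.1 fun x =>
      ((evMat x (G e.1))ᵀ *ᵥ evVec x (u e.1) -
        (evMat x (G e.2))ᵀ *ᵥ evVec x (u e.2)) ⬝ᵥ outNormal e.1) =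
      primalInt e.1 fun x => (evMat x (G e.1) *ᵥ outNormal e.1) ⬝ᵥ
        (evVec x (u e.1) - evVec x (u e.2)) := by
    intro e he
    refine segInt_congr fun x hx => ?_
    have := hG.2.1 e he x hx
    rw [sub_mulVec, sub_eq_zero] at this
    rw [sub_dotProduct, hT e.1, hT e.2, ← this, dotProduct_sub]
  have hbd : ∀ s ∈ Finset.univ.filter (IsBoundary (M := T.B)), (primalInt s fun x =>
      ((evMat x (G s))ᵀ *ᵥ evVec x (u s)) ⬝ᵥ outNormal s) = 0 := by
    intro s hs
    rw [primalInt, ← segInt_zero (base₀ s) (base₁ s)]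
    refine segInt_congr fun x hx => ?_
    rw [hT s, hG.2.2.2 s (Finset.mem_filter.1 hs).2 x hx, zero_dotProduct]
  have hpI : Finset.univ.filter (IsInteriorPair (M := T.B)) = T.primalInteriorB := by
    ext; simp [primalInteriorB]
  rw [hpI, Finset.sum_congr rfl hint, Finset.sum_congr rfl hbd, Finset.sum_const_zero] at key
  simp only [hdual, Finset.sum_add_distrib] at key
  rw [formBstar, formB]
  linarith [key]

end CoupledMesh

/-! ### Piecewise polynomial fields in `H(div)` -/

lemma memLp_two_restrict_of_isCompact {E : Type*} [NormedAddCommGroup E] {f : Plane → E}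
    (hf : Continuous f) {K : Set Plane} (hK : IsCompact K)
    (hm : AEStronglyMeasurable f (volume.restrict K)) : MemLp f 2 (volume.restrict K) := by
  obtain ⟨C, hC⟩ := hK.exists_bound_of_continuousOn hf.continuousOn
  have : IsFiniteMeasure (volume.restrict K) := ⟨by simpa using hK.measure_lt_top⟩
  exact MemLp.of_bound hm C (ae_restrict_of_forall_mem hK.measurableSet hC)

namespace CellFamily

variable {M : CellFamily}

/-- The piecewise defined function that vanishes on the edges and outside of the mesh. -/
def glue {E : Type*} [AddCommMonoid E] (h : M.Tri → Plane → E) (x : Plane) : E :=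
  ∑ s, (interior (tri s)).indicator (h s) x

lemma memLp_glue {E : Type*} [NormedAddCommGroup E] [SecondCountableTopology E]
    {h : M.Tri → Plane → E} (hh : ∀ s, Continuous (h s)) :
    MemLp (glue h) 2 (volume.restrict M.region) := by
  refine MemLp.restrict _ (memLp_finsetSum _ fun s _ => ?_)
  rw [memLp_indicator_iff_restrict isOpen_interior.measurableSet]
  have : MemLp (h s) 2 (volume.restrict (tri s)) :=
    memLp_two_restrict_of_isCompact (hh s) (isCompact_tri s) (hh s).aestronglyMeasurable
  exact this.mono_measure (Measure.restrict_mono interior_subset le_rfl)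

/-- The frontier of a convex set is a null set. -/
lemma interior_tri_ae_eq (s : M.Tri) : (interior (tri s) : Set Plane) =ᵐ[volume] tri s :=
  interior_ae_eq_of_null_frontier ((convex_convexHull ℝ _).addHaar_frontier volume)

lemma setIntegral_glue {h : M.Tri → Plane → ℝ} (hh : ∀ s, Continuous (h s)) :
    ∫ x in M.region, glue h x = elemInt h := by
  have hi : ∀ s : M.Tri, IntegrableOn (h s) (interior (tri s)) := fun s =>
    (integrableOn_tri (hh s) s).mono_set interior_subset
  simp only [glue]
  rw [integral_finsetSum, elemInt]
  · refine Finset.sum_congr rfl fun s _ => ?_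
    rw [setIntegral_indicator isOpen_interior.measurableSet,
      Set.inter_eq_right.2 (interior_tri_subset_region s),
      setIntegral_congr_set (interior_tri_ae_eq s)]
  · intro s _
    exact ((integrable_indicator_iff isOpen_interior.measurableSet).2 (hi s)).integrableOn

/-- The normal components of the field agree on every edge between two subtriangles. -/
def NormalContinuous (v : M.Vec) : Prop :=
  ∀ (s t : M.Tri) (i j : Fin 3), dedge t j = (dedge s i).swap →
    ∀ x ∈ segment ℝ (vtx s i) (vtx s (i + 1)),
      (evVec x (v s) - evVec x (v t)) ⬝ᵥ normal (vtx s i) (vtx s (i + 1)) = 0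

lemma dedge_prev_two (s : M.Tri) : dedge (prev s) 2 = (dedge s 0).swap := by
  rw [dedge_two, dedge_zero]; simp

lemma NormalContinuous.dual {v : M.Vec} (hv : NormalContinuous v) (s : M.Tri) :
    ∀ x ∈ segment ℝ (apex s) (base₀ s),
      (evVec x (v s) - evVec x (v (prev s))) ⬝ᵥ dualNormal s = 0 :=
  hv s (prev s) 0 2 (dedge_prev_two s)

lemma NormalContinuous.primal {v : M.Vec} (hv : NormalContinuous v) (hM : M.Conforming)
    {s t : M.Tri} (hst : s ≠ t) (h : primalEdge s = primalEdge t) :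
    ∀ x ∈ segment ℝ (base₀ s) (base₁ s),
      (evVec x (v s) - evVec x (v t)) ⬝ᵥ outNormal s = 0 := by
  have e := hM.base_eq hst h
  exact hv s t 1 1 (by rw [dedge_one, dedge_one, e.1, e.2]; rfl)

/-- The endpoints, to which `Conforming.notMem_region_of_isBoundary` does not apply, form a null set
of the line integral. -/
lemma Conforming.primalInt_eq_zero_of_isBoundary (hM : M.Conforming) {s : M.Tri}
    (hs : IsBoundary s) {f : Plane → ℝ} (hf : ∀ x, x ∉ M.region → f x = 0) :
    primalInt s f = 0 := by
  rw [primalInt, segInt, intervalIntegral.integral_of_le zero_le_one,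
    integral_Ioc_eq_integral_Ioo, setIntegral_eq_zero_of_forall_eq_zero, mul_zero]
  intro l hl
  exact hf _ (hM.notMem_region_of_isBoundary hs hl.1 hl.2)

/-- Piecewise polynomial fields with continuous normal components belong to `H(div)`. -/
lemma Conforming.memHdiv_toFun (hM : M.Conforming) {v : M.Vec} (hv : NormalContinuous v) :
    MemHdiv M.region (toFun v) := by
  classical
  have cv : ∀ s, Continuous fun y => (WithLp.toLp 2 (evVec y (v s)) : Plane) := fun s => by
    fun_prop
  refine ⟨memLp_glue cv, glue fun s x => ev x (div (v s)), memLp_glue fun s => by fun_prop, ?_⟩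
  intro φ hφ hφc hφs
  have hφ1 : ContDiff ℝ 1 φ := hφ.of_le (by exact_mod_cast le_top)
  have hφ0 : ∀ x, x ∉ M.region → φ x = 0 := fun x hx =>
    image_eq_zero_of_notMem_tsupport fun h => hx (hφs h)
  have cφ := hφ.continuous
  have cφ' := hφ1.continuous_fderiv (by simp)
  have e1 : ∀ x, fderiv ℝ φ x (toFun v x) =
      glue (fun s x => fderiv ℝ φ x (WithLp.toLp 2 (evVec x (v s)))) x := by
    intro x
    simp only [toFun, glue, map_sum]
    refine Finset.sum_congr rfl fun s _ => ?_
    by_cases h : x ∈ interior (tri s) <;> simp [h]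
  have e2 : ∀ x, glue (fun s x => ev x (div (v s))) x * φ x =
      glue (fun s x => φ x * ev x (div (v s))) x := by
    intro x
    simp only [glue, Finset.sum_mul]
    refine Finset.sum_congr rfl fun s _ => ?_
    by_cases h : x ∈ interior (tri s) <;> simp [h, mul_comm]
  simp only [e1, e2]
  have c1 : ∀ s, Continuous fun x => fderiv ℝ φ x (WithLp.toLp 2 (evVec x (v s))) := fun s =>
    cφ'.clm_apply (cv s)
  rw [setIntegral_glue c1, setIntegral_glue (fun s => by fun_prop), ← sub_eq_zero, sub_neg_eq_add,
    ← elemInt_add c1 (fun s => by fun_prop)]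
  -- The two integrals add up to the elementwise divergence of `φ v`, that is, to edge terms. Those
  -- on shared edges vanish by normal continuity, those on boundary edges because the support of `φ`
  -- lies in the open region.
  have key := elemInt_div (M := M) (F := fun s x => φ x • evVec x (v s)) (fun s i => by
    simpa [evVec] using hφ1.mul (contDiff_ev (v s i)))
  have hdiv : ∀ (s : M.Tri) x, ∑ i, fderiv ℝ (fun y => (φ y • evVec y (v s)) i) x
      (EuclideanSpace.single i 1) =
      fderiv ℝ φ x (WithLp.toLp 2 (evVec x (v s))) + φ x * ev x (div (v s)) := by
    intro s x
    have hvec : (WithLp.toLp 2 (evVec x (v s)) : Plane) =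
        ev x (v s 0) • EuclideanSpace.single 0 1 + ev x (v s 1) • EuclideanSpace.single 1 1 := by
      ext i; fin_cases i <;> simp [evVec]
    have hd : ∀ i, fderiv ℝ (fun y => (φ y • evVec y (v s)) i) x (EuclideanSpace.single i 1) =
        φ x * ev x (MvPolynomial.pderiv i (v s i)) +
          ev x (v s i) * fderiv ℝ φ x (EuclideanSpace.single i 1) := by
      intro i
      have : (fun y => (φ y • evVec y (v s)) i) = fun y => φ y * ev y (v s i) := by
        ext y; simp [evVec]
      rw [this, fderiv_fun_mul (hφ1.differentiable (by simp) x) (differentiable_ev _ x)]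
      simp [fderiv_ev_single]
    rw [hvec, Fin.sum_univ_two, hd, hd, map_add, map_smul, map_smul, div, Fin.sum_univ_two]
    simp only [ev_add, smul_eq_mul]
    ring
  simp only [hdiv] at key
  rw [key, hM.sum_primalInt (fun s => by fun_prop)]
  have z1 : ∀ s : M.Tri, (dualInt s fun x =>
      (φ x • evVec x (v s) - φ x • evVec x (v (prev s))) ⬝ᵥ dualNormal s) = 0 := by
    intro s
    rw [dualInt, ← segInt_zero (apex s) (base₀ s)]
    refine segInt_congr fun x hx => ?_
    rw [← smul_sub, smul_dotProduct, hv.dual s x hx, smul_zero]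
  have z2 : ∀ p ∈ Finset.univ.filter (IsInteriorPair (M := M)), (primalInt p.1 fun x =>
      (φ x • evVec x (v p.1) - φ x • evVec x (v p.2)) ⬝ᵥ outNormal p.1) = 0 := by
    intro p hp
    have hp := (Finset.mem_filter.1 hp).2
    rw [primalInt, ← segInt_zero (base₀ p.1) (base₁ p.1)]
    refine segInt_congr fun x hx => ?_
    rw [← smul_sub, smul_dotProduct, hv.primal hM hp.ne hp.2 x hx, smul_zero]
  have z3 : ∀ s ∈ Finset.univ.filter (IsBoundary (M := M)), (primalInt s fun x =>
      (φ x • evVec x (v s)) ⬝ᵥ outNormal s) = 0 := by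
    intro s hs
    refine hM.primalInt_eq_zero_of_isBoundary (Finset.mem_filter.1 hs).2 fun x hx => ?_
    rw [hφ0 x hx, zero_smul, zero_dotProduct]
  rw [Finset.sum_congr rfl fun s _ => z1 s, Finset.sum_congr rfl z2, Finset.sum_congr rfl z3]
  simp

lemma toFun_linear (c : ℝ) (v w : M.Vec) : toFun (c • v + w) = c • toFun v + toFun w := by
  ext1 x
  simp only [toFun, Pi.add_apply, Pi.smul_apply, Finset.smul_sum, ← Finset.sum_add_distrib]
  refine Finset.sum_congr rfl fun s _ => ?_
  by_cases h : x ∈ interior (tri s)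
  · simp only [Set.indicator_of_mem h]
    ext i
    simp [evVec]
  · simp [h]

lemma measure_region_lt_top : volume M.region < ⊤ :=
  (measure_mono interior_subset).trans_lt
    (isCompact_iUnion fun s : M.Tri => isCompact_tri s).measure_lt_top

end CellFamily

/-- The weak divergences combine linearly. The integrals may be split because square integrable
functions are integrable on a set of finite measure, while `φ` and its derivative are bounded. -/
lemma MemHdiv.linear {Ω : Set Plane} (hΩ : volume Ω < ⊤) {v w : Plane → Plane} (c : ℝ)
    (hv : MemHdiv Ω v) (hw : MemHdiv Ω w) : MemHdiv Ω (c • v + w) := by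
  have : IsFiniteMeasure (volume.restrict Ω) := ⟨by simpa using hΩ⟩
  obtain ⟨hv2, d, hd, hvd⟩ := hv
  obtain ⟨hw2, e, he, hwe⟩ := hw
  refine ⟨(hv2.const_smul c).add hw2, c • d + e, (hd.const_smul c).add he, fun φ hφ hc hs => ?_⟩
  have hφ1 : ContDiff ℝ 1 φ := hφ.of_le (by exact_mod_cast le_top)
  have cφ := hφ.continuous
  have cφ' := hφ1.continuous_fderiv (by simp)
  obtain ⟨C, hC⟩ := cφ'.bounded_above_of_compact_support (hc.fderiv (𝕜 := ℝ))
  obtain ⟨C', hC'⟩ := cφ.bounded_above_of_compact_support hc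
  have int1 : ∀ u : Plane → Plane, MemLp u 2 (volume.restrict Ω) →
      IntegrableOn (fun x => fderiv ℝ φ x (u x)) Ω := by
    intro u hu
    refine Integrable.mono' ((hu.integrable (by norm_num)).norm.const_mul C) ?_
      (Filter.Eventually.of_forall fun x => ?_)
    · exact (ContinuousLinearMap.id ℝ (Plane →L[ℝ] ℝ)).aestronglyMeasurable_comp₂
        cφ'.aestronglyMeasurable hu.1
    · exact ((fderiv ℝ φ x).le_opNorm _).trans (by gcongr; exact hC x)
  have int2 : ∀ u : Plane → ℝ, MemLp u 2 (volume.restrict Ω) →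
      IntegrableOn (fun x => u x * φ x) Ω := by
    intro u hu
    refine Integrable.mono' ((hu.integrable (by norm_num)).norm.mul_const C')
      (hu.1.mul cφ.aestronglyMeasurable) (Filter.Eventually.of_forall fun x => ?_)
    rw [norm_mul]
    gcongr
    exact hC' x
  have e1 : ∀ x, fderiv ℝ φ x ((c • v + w) x) =
      c * fderiv ℝ φ x (v x) + fderiv ℝ φ x (w x) := by intro x; simp
  have e2 : ∀ x, (c • d + e) x * φ x = c * (d x * φ x) + e x * φ x := by
    intro x; simp; ring
  simp only [e1, e2]
  rw [integral_add ((int1 v hv2).const_mul c) (int1 w hw2), integral_const_mul,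
    integral_add ((int2 d hd).const_mul c) (int2 e he), integral_const_mul, hvd φ hφ hc hs,
    hwe φ hφ hc hs]
  ring

/-! ### Local polynomial fields -/

lemma totalDegree_pderiv_le (i : Fin 2) (p : Poly) :
    (MvPolynomial.pderiv i p).totalDegree ≤ p.totalDegree - 1 := by
  conv_lhs => rw [p.as_sum, map_sum]
  refine MvPolynomial.totalDegree_finsetSum_le fun s hs => ?_
  rw [MvPolynomial.pderiv_monomial]
  by_cases h : s i = 0
  · simp [h]
  · refine (MvPolynomial.totalDegree_monomial_le _ _).trans ?_
    have h1 : Finsupp.single i 1 ≤ s := by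
      rw [Finsupp.single_le_iff]; omega
    have h2 := MvPolynomial.le_totalDegree hs
    have h3 : (s - Finsupp.single i 1) + Finsupp.single i 1 = s := tsub_add_cancel_of_le h1
    have h4 := congrArg Finsupp.degree h3
    rw [map_add, Finsupp.degree_single] at h4
    have h5 : Finsupp.degree s ≤ p.totalDegree := h2
    change Finsupp.degree (s - Finsupp.single i 1) ≤ _
    omega

lemma totalDegree_C_mul_le (c : ℝ) (p : Poly) :
    (MvPolynomial.C c * p).totalDegree ≤ p.totalDegree :=
  (MvPolynomial.totalDegree_mul _ _).trans (by simp)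

lemma totalDegree_add_le {n : ℕ} {p q : Poly} (hp : p.totalDegree ≤ n) (hq : q.totalDegree ≤ n) :
    (p + q).totalDegree ≤ n := (MvPolynomial.totalDegree_add p q).trans (max_le hp hq)

lemma totalDegree_sub_le {n : ℕ} {p q : Poly} (hp : p.totalDegree ≤ n) (hq : q.totalDegree ≤ n) :
    (p - q).totalDegree ≤ n := (MvPolynomial.totalDegree_sub p q).trans (max_le hp hq)

lemma totalDegree_mul_le {m n : ℕ} {p q : Poly} (hp : p.totalDegree ≤ m) (hq : q.totalDegree ≤ n) :
    (p * q).totalDegree ≤ m + n := (MvPolynomial.totalDegree_mul p q).trans (add_le_add hp hq)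

/-- The affine function `x ↦ cross d (x - a)`. -/
def affineForm (d a : Plane) : Poly :=
  MvPolynomial.C (d 0) * (MvPolynomial.X 1 - MvPolynomial.C (a 1)) -
    MvPolynomial.C (d 1) * (MvPolynomial.X 0 - MvPolynomial.C (a 0))

@[simp] lemma ev_affineForm (x d a : Plane) : ev x (affineForm d a) = cross d (x - a) := by
  simp [affineForm, cross]

lemma totalDegree_X_sub_C_le (i : Fin 2) (c : ℝ) :
    (MvPolynomial.X i - MvPolynomial.C c : Poly).totalDegree ≤ 1 :=
  totalDegree_sub_le (by simp) (by simp)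

lemma totalDegree_affineForm_le (d a : Plane) : (affineForm d a).totalDegree ≤ 1 :=
  totalDegree_sub_le ((totalDegree_C_mul_le _ _).trans (totalDegree_X_sub_C_le _ _))
    ((totalDegree_C_mul_le _ _).trans (totalDegree_X_sub_C_le _ _))

/-- The derivative in the direction `d`. -/
def dirDeriv (d : Plane) (p : Poly) : Poly :=
  MvPolynomial.C (d 0) * MvPolynomial.pderiv 0 p + MvPolynomial.C (d 1) * MvPolynomial.pderiv 1 p

lemma totalDegree_dirDeriv_le (d : Plane) (p : Poly) :
    (dirDeriv d p).totalDegree ≤ p.totalDegree - 1 :=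
  totalDegree_add_le ((totalDegree_C_mul_le _ _).trans (totalDegree_pderiv_le _ _))
    ((totalDegree_C_mul_le _ _).trans (totalDegree_pderiv_le _ _))

lemma ev_dirDeriv (x d : Plane) (p : Poly) :
    ev x (dirDeriv d p) = d.ofLp ⬝ᵥ evVec x (grad p) := by
  simp [dirDeriv, dotProduct, evVec, grad, Fin.sum_univ_two]

lemma eq_C_of_pderiv_eq_zero {p : Poly} (h : ∀ i, MvPolynomial.pderiv i p = 0) :
    ∃ c, p = MvPolynomial.C c := by
  refine ⟨ev 0 p, sub_eq_zero.1 (eq_zero_of_ev_eq_zero isOpen_univ Set.univ_nonempty ?_)⟩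
  intro x _
  have := is_const_of_fderiv_eq_zero (𝕜 := ℝ) (differentiable_ev p) (fun y => by
    ext v; rw [fderiv_ev]; simp [h]) x 0
  simpa [sub_eq_zero] using this

/-- Derivatives in two independent directions determine both partial derivatives, by Cramer's rule
with determinant `cross u v`. -/
lemma eq_C_of_dirDeriv_eq_zero {u v : Plane} (h : cross u v ≠ 0) {p : Poly}
    (hu : dirDeriv u p = 0) (hv : dirDeriv v p = 0) : ∃ c, p = MvPolynomial.C c := by
  have hC : (MvPolynomial.C (cross u v) : Poly) ≠ 0 := by simpa using h
  have hc : (MvPolynomial.C (cross u v) : Poly) =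
      MvPolynomial.C (u 0) * MvPolynomial.C (v 1) - MvPolynomial.C (u 1) * MvPolynomial.C (v 0) := by
    simp [cross]
  refine eq_C_of_pderiv_eq_zero fun i => ?_
  refine (mul_eq_zero.1 ?_).resolve_left hC
  rw [hc]
  simp only [dirDeriv] at hu hv
  fin_cases i
  · simp only [Fin.zero_eta]
    linear_combination MvPolynomial.C (v 1) * hu - MvPolynomial.C (u 1) * hv
  · simp only [Fin.mk_one]
    linear_combination MvPolynomial.C (u 0) * hv - MvPolynomial.C (v 0) * hu

/-- The vector field with the fixed direction `d` and the size `p`. -/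
def dirField (p : Poly) (d : Plane) : Fin 2 → Poly := fun i => p * MvPolynomial.C (d i)

lemma evVec_dirField (x : Plane) (p : Poly) (d : Plane) :
    evVec x (dirField p d) = ev x p • d.ofLp := by
  ext i; simp [evVec, dirField]

lemma evVec_add (x : Plane) (v w : Fin 2 → Poly) : evVec x (v + w) = evVec x v + evVec x w := by
  ext i; simp [evVec]

lemma evVec_neg (x : Plane) (v : Fin 2 → Poly) : evVec x (-v) = -evVec x v := by
  ext i; simp [evVec]

@[simp] lemma evVec_zero (x : Plane) : evVec x 0 = 0 := by
  ext i; simp [evVec]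

lemma totalDegree_dirField_le {p : Poly} {n : ℕ} (h : p.totalDegree ≤ n) (d : Plane) (i : Fin 2) :
    (dirField p d i).totalDegree ≤ n := by
  rw [dirField, mul_comm]
  exact (totalDegree_C_mul_le _ _).trans h

lemma dotProduct_normal (d a b : Plane) :
    d.ofLp ⬝ᵥ normal a b = cross d (b - a) / dist a b := by
  simp [normal, cross, dotProduct, Fin.sum_univ_two]
  ring

lemma cross_self (a : Plane) : cross a a = 0 := by simp [cross]; ring

lemma cross_eq_zero_of_mem_segment {a b x : Plane} (hx : x ∈ segment ℝ a b) :
    cross (b - a) (x - a) = 0 := by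
  obtain ⟨u, v, -, -, huv, rfl⟩ := hx
  obtain rfl : u = 1 - v := by linarith
  simp [cross]; ring

/-! ### Injectivity on the Brinkman side -/

namespace CellFamily

variable {M : CellFamily}

lemma prev_ne (s : M.Tri) : prev s ≠ s := by
  intro h
  have := base₁_prev s
  rw [h] at this
  exact base₀_ne_base₁ s this.symm

/-- Otherwise `s` and `prev s` would have the same vertices in opposite orientation. So the dual
edges on the two sides of `prev s` lead to different triangles. -/
lemma prev_prev_ne (s : M.Tri) : prev (prev s) ≠ s := by
  intro h
  have h1 := cross_pos s
  have h2 := cross_pos (prev s)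
  have h3 := base₁_prev (prev s)
  rw [h] at h3
  rw [base₁_prev, apex_prev, ← h3, cross_swap] at h2
  linarith

lemma prev_injective : Function.Injective (prev (M := M)) :=
  prevEquiv.injective

end CellFamily

namespace CoupledMesh

open CellFamily

variable {T : CoupledMesh} {k : ℕ}

/-- A pressure that is orthogonal to all velocities is elementwise constant. -/
lemma exists_eq_C_of_formb_eq_zero (hk : 1 ≤ k) {q : T.B.Scalar}
    (hdeg : ∀ s, (q s).totalDegree ≤ k) (h : ∀ v ∈ T.HB k, formb v q = 0) (s : T.B.Tri) :
    ∃ c, q s = MvPolynomial.C c := by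
  classical
  set a := apex s with ha
  set b := base₀ s with hb
  set c := base₁ s with hc
  have hpos : 0 < cross (b - a) (c - a) := cross_pos s
  set g₁ := dirDeriv (b - a) (q s) with hg₁
  set g₂ := dirDeriv (c - a) (q s) with hg₂
  -- Each summand is tangential to one dual edge and carries a factor that vanishes on the other, so
  -- `w` has no normal component on either; its flux through the primal edge is free in `H_h^B`. Its
  -- product with `∇ q` is a sum of squares with weights positive inside the triangle.
  set w : Fin 2 → Poly := dirField (affineForm (a - c) c * g₁) (b - a) +
    dirField (affineForm (b - a) a * g₂) (c - a) with hw
  have hev : ∀ x, evVec x w = (cross (a - c) (x - c) * ev x g₁) • (b - a).ofLp +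
      (cross (b - a) (x - a) * ev x g₂) • (c - a).ofLp := by
    intro x
    rw [hw, evVec_add, evVec_dirField, evVec_dirField]
    simp
  have hwdeg : ∀ i, (w i).totalDegree ≤ k := by
    intro i
    have hd : (q s).totalDegree - 1 ≤ k - 1 := Nat.sub_le_sub_right (hdeg s) 1
    -- This is where `k ≥ 1` is used: one affine factor plus a derivative of degree at most `k - 1`.
    have h1 : 1 + (k - 1) ≤ k := by omega
    exact totalDegree_add_le
      (totalDegree_dirField_le ((totalDegree_mul_le (totalDegree_affineForm_le _ _)
        ((totalDegree_dirDeriv_le _ _).trans hd)).trans h1) _ _)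
      (totalDegree_dirField_le ((totalDegree_mul_le (totalDegree_affineForm_le _ _)
        ((totalDegree_dirDeriv_le _ _).trans hd)).trans h1) _ _)
  have hn₁ : ∀ x ∈ segment ℝ a b, evVec x w ⬝ᵥ normal a b = 0 := by
    intro x hx
    rw [hev, cross_eq_zero_of_mem_segment hx, add_dotProduct, smul_dotProduct, smul_dotProduct,
      dotProduct_normal, cross_self]
    simp
  have hn₂ : ∀ x ∈ segment ℝ a c, evVec x w ⬝ᵥ normal a c = 0 := by
    intro x hx
    rw [segment_symm] at hx
    rw [hev, cross_eq_zero_of_mem_segment hx, add_dotProduct, smul_dotProduct, smul_dotProduct,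
      dotProduct_normal (c - a), cross_self]
    simp
  let v : T.B.Vec := fun t => if t = s then w else 0
  have hv : v ∈ T.HB k := by
    refine ⟨fun t i => ?_, fun t x hx => ?_⟩
    · by_cases ht : t = s
      · simpa [v, ht] using hwdeg i
      · simp [v, ht]
    · by_cases ht : t = s
      · subst ht
        have : v (prev t) = 0 := if_neg (prev_ne t)
        rw [this, evVec_zero, sub_zero, show v t = w from if_pos rfl]
        exact hn₁ x hx
      · rw [show v t = 0 from if_neg ht, evVec_zero, zero_sub, neg_dotProduct, neg_eq_zero]
        by_cases ht' : prev t = s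
        · rw [show v (prev t) = w from if_pos ht']
          have e1 : apex t = a := by rw [ha, ← ht', apex_prev]
          have e2 : base₀ t = c := by rw [hc, ← ht', base₁_prev]
          rw [e1, e2] at hx
          rw [dualNormal, e1, e2]
          exact hn₂ x hx
        · rw [show v (prev t) = 0 from if_neg ht', evVec_zero, zero_dotProduct]
  have hz := h v hv
  have hdual : ∀ t : T.B.Tri, (dualInt t fun x =>
      (evVec x (v t) ⬝ᵥ dualNormal t) * (ev x (q t) - ev x (q (prev t)))) = 0 := by
    intro t
    rw [dualInt, ← segInt_zero (apex t) (base₀ t)]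
    refine segInt_congr fun x hx => ?_
    by_cases ht : t = s
    · subst ht
      rw [show v t = w from if_pos rfl, dualNormal, hn₁ x hx, zero_mul]
    · rw [show v t = 0 from if_neg ht, evVec_zero, zero_dotProduct, zero_mul]
  rw [formb, Finset.sum_congr rfl fun t _ => hdual t, Finset.sum_const_zero, neg_zero, zero_add,
    elemInt, Finset.sum_eq_single s (fun t _ ht => by
      simp [show v t = 0 from if_neg ht]) (by simp), show v s = w from if_pos rfl] at hz
  have hdot : ∀ x, evVec x w ⬝ᵥ evVec x (grad (q s)) =
      cross (a - c) (x - c) * ev x g₁ ^ 2 + cross (b - a) (x - a) * ev x g₂ ^ 2 := by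
    intro x
    rw [hev, add_dotProduct, smul_dotProduct, smul_dotProduct, ← ev_dirDeriv, ← ev_dirDeriv,
      ← hg₁, ← hg₂]
    simp only [smul_eq_mul]; ring
  have hvan := eq_zero_of_setIntegral_eq_zero (a := a) (b := b) (c := c)
    (f := fun x => evVec x w ⬝ᵥ evVec x (grad (q s))) (by fun_prop) (fun x hx => by
      rw [mem_convexHull_iff_cross hpos] at hx
      have h1 := hx.1
      have h3 := hx.2.2
      simp only [hdot]
      positivity) hz
  have hzero : ∀ x ∈ openTri a b c, ev x g₁ = 0 ∧ ev x g₂ = 0 := by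
    intro x hx
    have h0 := hvan x (openTri_subset_interior hpos hx)
    simp only [hdot] at h0
    have h1 := hx.1
    have h3 := hx.2.2
    have n1 : 0 ≤ cross (a - c) (x - c) * ev x g₁ ^ 2 := by positivity
    have n2 : 0 ≤ cross (b - a) (x - a) * ev x g₂ ^ 2 := by positivity
    have z1 : cross (a - c) (x - c) * ev x g₁ ^ 2 = 0 := by linarith
    have z2 : cross (b - a) (x - a) * ev x g₂ ^ 2 = 0 := by linarith
    exact ⟨by simpa [h3.ne'] using z1, by simpa [h1.ne'] using z2⟩
  exact eq_C_of_dirDeriv_eq_zero hpos.ne'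
    (eq_zero_of_ev_eq_zero (isOpen_openTri a b c) (openTri_nonempty hpos) fun x hx =>
      (hzero x hx).1)
    (eq_zero_of_ev_eq_zero (isOpen_openTri a b c) (openTri_nonempty hpos) fun x hx =>
      (hzero x hx).2)

/-- An elementwise constant pressure that is orthogonal to all velocities does not jump across dual
edges. -/
lemma eq_prev_of_formb_eq_zero {q : T.B.Scalar} {c : T.B.Tri → ℝ}
    (hc : ∀ s, q s = MvPolynomial.C (c s)) (h : ∀ v ∈ T.HB k, formb v q = 0) (s : T.B.Tri) :
    c s = c (prev s) := by
  classical
  set D := cross (base₀ s - apex s) (base₁ s - apex s) with hD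
  set D' := cross (base₀ (prev s) - apex s) (base₀ s - apex s) with hD'
  have hpos : 0 < D := cross_pos s
  have hpos' : 0 < D' := by simpa [hD'] using cross_pos (prev s)
  -- Constant fields on the two triangles at one dual edge, each parallel to the other dual edge of
  -- its triangle. The scaling gives both the normal component `1 / |e|` on the shared edge, so the
  -- field is admissible and `formb` sees only the jump across that edge.
  let v : T.B.Vec := fun t =>
    if t = s then dirField (MvPolynomial.C (-D⁻¹)) (base₁ s - apex s)
    else if t = prev s then dirField (MvPolynomial.C D'⁻¹) (base₀ (prev s) - apex s) else 0
  have v1 : ∀ x, evVec x (v s) = (-D⁻¹) • (base₁ s - apex s).ofLp := fun x => by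
    simp only [v, if_true, evVec_dirField, ev_C]
  have v2 : ∀ x, evVec x (v (prev s)) = D'⁻¹ • (base₀ (prev s) - apex s).ofLp := fun x => by
    simp only [v, if_neg (prev_ne s), if_true, evVec_dirField, ev_C]
  have v3 : ∀ t, t ≠ s → t ≠ prev s → v t = 0 := fun t h1 h2 => by
    simp only [v, if_neg h1, if_neg h2]
  have n1 : ∀ x, evVec x (v s) ⬝ᵥ dualNormal s = (dist (apex s) (base₀ s))⁻¹ := by
    intro x
    rw [v1, smul_dotProduct, dualNormal, dotProduct_normal, cross_swap, ← hD, smul_eq_mul]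
    field_simp
  have n2 : ∀ x, evVec x (v (prev s)) ⬝ᵥ dualNormal s = (dist (apex s) (base₀ s))⁻¹ := by
    intro x
    rw [v2, smul_dotProduct, dualNormal, dotProduct_normal, ← hD', smul_eq_mul]
    field_simp
  have n3 : ∀ x, evVec x (v (prev s)) ⬝ᵥ dualNormal (prev s) = 0 := by
    intro x
    rw [v2, smul_dotProduct, dualNormal, dotProduct_normal, apex_prev, cross_self]
    simp
  have n4 : ∀ t, prev t = s → ∀ x, evVec x (v s) ⬝ᵥ dualNormal t = 0 := by
    rintro t rfl x
    rw [v1, smul_dotProduct, dualNormal, dotProduct_normal, apex_prev, base₁_prev, cross_self]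
    simp
  have hv : v ∈ T.HB k := by
    refine ⟨fun t i => ?_, fun t x _ => ?_⟩
    · simp only [v]
      split_ifs
      · exact totalDegree_dirField_le (by simp) _ _
      · exact totalDegree_dirField_le (by simp) _ _
      · simp
    · rw [sub_dotProduct]
      by_cases h1 : t = s
      · rw [h1, n1, n2, sub_self]
      · by_cases h2 : t = prev s
        · rw [h2, n3, v3 _ (prev_prev_ne s) (prev_ne _)]
          simp
        · rw [v3 t h1 h2]
          by_cases h3 : prev t = s
          · rw [h3, n4 t h3]; simp
          · rw [v3 (prev t) h3 fun h4 => h1 (prev_injective h4)]; simp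
  have hz := h v hv
  have hgrad : ∀ (t : T.B.Tri) x, evVec x (grad (q t)) = 0 := by
    intro t x
    ext i; simp [evVec, grad, hc]
  have hdual : ∀ t, t ≠ s → (dualInt t fun x =>
      (evVec x (v t) ⬝ᵥ dualNormal t) * (ev x (q t) - ev x (q (prev t)))) = 0 := by
    intro t ht
    rw [dualInt, ← segInt_zero (apex t) (base₀ t)]
    refine segInt_congr fun x hx => ?_
    by_cases h2 : t = prev s
    · rw [h2, n3, zero_mul]
    · rw [v3 t ht h2]; simp
  rw [formb, Finset.sum_eq_single s (fun t _ ht => hdual t ht) (by simp)] at hz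
  simp only [hgrad, dotProduct_zero, n1] at hz
  simp only [hc, ev_C, dualInt, segInt, elemInt] at hz
  simp [apex_ne_base₀ s] at hz
  linarith

/-- A pressure with mean value zero that is orthogonal to all velocities vanishes. -/
lemma eq_zero_of_formb_eq_zero (hk : 1 ≤ k) {q : T.B.Scalar} (hq : q ∈ T.Q0 k)
    (h : ∀ v ∈ T.HB k, formb v q = 0) : q = 0 := by
  choose c hc using exists_eq_C_of_formb_eq_zero hk hq.1.1 h
  have h1 : ∀ s, c s = c (prev s) := eq_prev_of_formb_eq_zero hc h
  -- Across primal edges the pressure is continuous by definition; one endpoint suffices to compare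
  -- constants.
  have hpair : ∀ s t, IsInteriorPair (s, t) → c s = c t := by
    intro s t hst
    have := hq.1.2 (s, t) (by simpa [primalInteriorB] using hst) (base₀ s)
      (left_mem_segment ℝ _ _)
    simpa [hc, sub_eq_zero] using this
  have h2 : ∀ s t, primalEdge s = primalEdge t → c s = c t := by
    intro s t hst
    by_cases he : s = t
    · rw [he]
    · rcases lt_or_gt_of_ne (T.confB.cell_ne he hst) with hlt | hlt
      · exact hpair s t ⟨hlt, hst⟩
      · exact (hpair t s ⟨hlt, hst.symm⟩).symm
  obtain ⟨s₀, -⟩ := T.interface_nonempty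
  have hall := T.confB.eq_of_adjacent T.connected_B c h1 h2 s₀
  have hmean := hq.2
  simp only [elemInt, hc, ev_C, hall] at hmean
  -- The vanishing mean is multiplied by the constant, which turns the integrand into a square and
  -- makes positivity available.
  have hsum : ∑ s : T.B.Tri, ∫ _ in tri s, c s₀ ^ 2 = 0 := by
    simp only [sq, integral_const_mul, ← Finset.mul_sum, hmean, mul_zero]
  have hs := (Finset.sum_eq_zero_iff_of_nonneg fun s _ =>
    integral_nonneg fun _ => sq_nonneg (c s₀)).1 hsum s₀ (Finset.mem_univ _)
  obtain ⟨x, hx⟩ := interior_tri_nonempty s₀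
  have := eq_zero_of_setIntegral_eq_zero (f := fun _ => c s₀ ^ 2) continuous_const
    (fun _ _ => sq_nonneg _) hs x hx
  funext s
  rw [hc, hall, pow_eq_zero_iff two_ne_zero |>.1 this]
  simp

end CoupledMesh

/-! ### Square linear systems -/

/-- A square linear system with trivial kernel is solvable. -/
lemma exists_solution_of_injective {V : Type*} [AddCommGroup V] [Module ℝ V] (X : Submodule ℝ V)
    [FiniteDimensional ℝ X] (A : V → V → ℝ) (hA₁ : ∀ y, IsLinearMap ℝ fun x => A x y)
    (hA₂ : ∀ x, IsLinearMap ℝ (A x)) (hinj : ∀ x ∈ X, (∀ y ∈ X, A x y = 0) → x = 0)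
    {l : V → ℝ} (hl : IsLinearMap ℝ l) : ∃ x ∈ X, ∀ y ∈ X, A x y = l y := by
  let Φ : X →ₗ[ℝ] Module.Dual ℝ X := LinearMap.mk₂ ℝ (fun x y => A x y)
    (fun x x' y => (hA₁ y).map_add x x') (fun c x y => (hA₁ y).map_smul c x)
    (fun x y y' => (hA₂ x).map_add y y') (fun c x y => (hA₂ x).map_smul c y)
  have hΦ : Function.Injective Φ := by
    rw [injective_iff_map_eq_zero]
    intro x hx
    refine Subtype.ext (hinj x x.2 fun y hy => ?_)
    exact LinearMap.congr_fun hx ⟨y, hy⟩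
  -- The space and its dual have the same finite dimension.
  have hsurj := (LinearMap.injective_iff_surjective_of_finrank_eq_finrank
    (Subspace.dual_finrank_eq (K := ℝ) (V := X)).symm).1 hΦ
  obtain ⟨x, hx⟩ := hsurj ((hl.mk' l).comp X.subtype)
  exact ⟨x, x.2, fun y hy => LinearMap.congr_fun hx ⟨y, hy⟩⟩

/-! ### The `L²` projection on an edge -/

/-- The normal equations have a trivial kernel: a polynomial with zero `L²` norm on the unit
interval vanishes at infinitely many points. -/
lemma exists_l2Projection_unitInterval (k : ℕ) {g : ℝ → ℝ} (hg : IntervalIntegrable g volume 0 1) :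
    ∃ P : Polynomial ℝ, P.natDegree ≤ k ∧ ∀ Q : Polynomial ℝ, Q.natDegree ≤ k →
      ∫ t in (0 : ℝ)..1, (g t - P.eval t) * Q.eval t = 0 := by
  have : FiniteDimensional ℝ (Polynomial.degreeLT ℝ (k + 1)) :=
    Module.Finite.equiv (Polynomial.degreeLTEquiv ℝ (k + 1)).symm
  have mem {P : Polynomial ℝ} : P ∈ Polynomial.degreeLT ℝ (k + 1) ↔ P.natDegree ≤ k := by
    rw [Polynomial.mem_degreeLT, ← Nat.lt_succ_iff]
    rcases eq_or_ne P 0 with rfl | h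
    · simp
    · exact (Polynomial.natDegree_lt_iff_degree_lt h).symm
  have ii : ∀ P Q : Polynomial ℝ, IntervalIntegrable (fun t => P.eval t * Q.eval t) volume 0 1 :=
    fun P Q => (P.continuous.mul Q.continuous).intervalIntegrable _ _
  have ig : ∀ Q : Polynomial ℝ, IntervalIntegrable (fun t => g t * Q.eval t) volume 0 1 :=
    fun Q => hg.mul_continuousOn Q.continuous.continuousOn
  obtain ⟨P, hP, hPQ⟩ := exists_solution_of_injective (Polynomial.degreeLT ℝ (k + 1))
    (fun P Q => ∫ t in (0 : ℝ)..1, P.eval t * Q.eval t)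
    (fun Q => ⟨fun P P' => by
      simp only [Polynomial.eval_add, add_mul]
      exact intervalIntegral.integral_add (ii P Q) (ii P' Q), fun c P => by
      simp only [Polynomial.eval_smul, smul_eq_mul, mul_assoc]
      exact intervalIntegral.integral_const_mul _ _⟩)
    (fun P => ⟨fun Q Q' => by
      simp only [Polynomial.eval_add, mul_add]
      exact intervalIntegral.integral_add (ii P Q) (ii P Q'), fun c Q => by
      simp only [Polynomial.eval_smul, smul_eq_mul, mul_left_comm _ c]
      exact intervalIntegral.integral_const_mul _ _⟩)
    (fun P hP h0 => by
      by_contra hne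
      obtain ⟨c, hc, hcP⟩ : ∃ c ∈ Set.Icc (0 : ℝ) 1, P.eval c ≠ 0 := by
        by_contra! hcon
        exact hne (Polynomial.eq_zero_of_infinite_isRoot P
          ((Set.Icc_infinite zero_lt_one).mono fun t ht => hcon t ht))
      have := intervalIntegral.integral_pos zero_lt_one
        (P.continuous.mul P.continuous).continuousOn
        (fun t _ => mul_self_nonneg (P.eval t)) ⟨c, hc, mul_self_pos.2 hcP⟩
      exact this.ne' (h0 P hP))
    (l := fun Q => ∫ t in (0 : ℝ)..1, g t * Q.eval t)
    ⟨fun Q Q' => by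
      simp only [Polynomial.eval_add, mul_add]
      exact intervalIntegral.integral_add (ig Q) (ig Q'), fun c Q => by
      simp only [Polynomial.eval_smul, smul_eq_mul, mul_left_comm _ c]
      exact intervalIntegral.integral_const_mul _ _⟩
  refine ⟨P, mem.1 hP, fun Q hQ => ?_⟩
  simp only [sub_mul]
  rw [intervalIntegral.integral_sub (ig Q) (ii P Q), hPQ Q (mem.2 hQ), sub_self]

lemma intervalIntegrable_of_memL2Seg {a b : Plane} {g : Plane → ℝ} (hg : MemL2Seg a b g) :
    IntervalIntegrable (fun t : ℝ => g (AffineMap.lineMap a b t)) volume 0 1 := by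
  rw [intervalIntegrable_iff_integrableOn_Icc_of_le zero_le_one]
  exact MemLp.integrable (by norm_num) hg

/-- The restriction of a polynomial to an edge. -/
def edgePoly (a b : Plane) (χ : Poly) : Polynomial ℝ :=
  MvPolynomial.aeval (fun i => Polynomial.C (b i - a i) * Polynomial.X + Polynomial.C (a i)) χ

lemma natDegree_edgePoly_le {a b : Plane} {χ : Poly} {k : ℕ} (h : χ.totalDegree ≤ k) :
    (edgePoly a b χ).natDegree ≤ k := by
  have := MvPolynomial.aeval_natDegree_le χ h
    (fun i => Polynomial.C (b i - a i) * Polynomial.X + Polynomial.C (a i))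
    (fun i => Polynomial.natDegree_linear_le (a := b i - a i) (b := a i))
  rwa [mul_one] at this

lemma eval_edgePoly (a b : Plane) (χ : Poly) (t : ℝ) :
    (edgePoly a b χ).eval t = ev (AffineMap.lineMap a b t) χ := by
  have h1 : ∀ i, (AffineMap.lineMap a b t : Plane) i = (b i - a i) * t + a i := by
    intro i; simp [AffineMap.lineMap_apply]; ring
  induction χ using MvPolynomial.induction_on with
  | C c => simp [edgePoly]
  | add p q hp hq =>
    rw [edgePoly, map_add, Polynomial.eval_add, ← edgePoly, ← edgePoly, hp, hq, ev_add]
  | mul_X p i hp =>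
    rw [edgePoly, map_mul, Polynomial.eval_mul, ← edgePoly, hp, ev_mul, ev_X, h1]
    simp

/-- Substitution of a bivariate polynomial into a univariate one. -/
lemma ev_aeval (x : Plane) (p : Poly) (R : Polynomial ℝ) :
    ev x (Polynomial.aeval p R) = R.eval (ev x p) := by
  induction R using Polynomial.induction_on' with
  | add R S hR hS => simp [hR, hS]
  | monomial n c =>
    rw [Polynomial.aeval_monomial, Polynomial.eval_monomial, MvPolynomial.algebraMap_eq, ev_mul,
      ev_C]
    simp [ev]

lemma totalDegree_aeval_le {p : Poly} (hp : p.totalDegree ≤ 1) (R : Polynomial ℝ) :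
    (Polynomial.aeval p R).totalDegree ≤ R.natDegree := by
  rw [Polynomial.aeval_eq_sum_range]
  refine MvPolynomial.totalDegree_finsetSum_le fun i hi => ?_
  refine (MvPolynomial.totalDegree_smul_le _ _).trans ((MvPolynomial.totalDegree_pow _ _).trans ?_)
  have : i ≤ R.natDegree := Nat.lt_succ_iff.1 (Finset.mem_range.1 hi)
  calc i * p.totalDegree ≤ i * 1 := Nat.mul_le_mul_left _ hp
    _ ≤ R.natDegree := by omega

/-- A polynomial field on a triangle with prescribed normal component on one edge and vanishing
normal components on the other edges. -/
lemma exists_field_normal_eq {a b c : Plane} (h : 0 < cross (b - a) (c - a)) {k : ℕ} (hk : 1 ≤ k)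
    {P : Polynomial ℝ} (hP : P.natDegree ≤ k) :
    ∃ w : Fin 2 → Poly, (∀ i, (w i).totalDegree ≤ k) ∧
      (∀ x ∈ segment ℝ a b, evVec x w ⬝ᵥ normal a b = 0) ∧
      (∀ x ∈ segment ℝ c a, evVec x w ⬝ᵥ normal c a = 0) ∧
      ∀ t : ℝ, evVec (AffineMap.lineMap b c t) w ⬝ᵥ normal b c = P.eval t := by
  set D := cross (b - a) (c - a) with hD
  have hbc : b ≠ c := by
    rintro rfl
    rw [hD, cross_self] at h
    exact lt_irrefl _ h
  have hd := dist_ne_zero.2 hbc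
  -- `μ` and `ν` are the barycentric coordinates of `b` and `c`; at parameter `t` of the edge `b c`
  -- they equal `1 - t` and `t`.
  set μ : Poly := MvPolynomial.C D⁻¹ * affineForm (a - c) c with hμ
  set ν : Poly := MvPolynomial.C D⁻¹ * affineForm (b - a) a with hν
  have dμ : μ.totalDegree ≤ 1 := (totalDegree_C_mul_le _ _).trans (totalDegree_affineForm_le _ _)
  have dν : ν.totalDegree ≤ 1 := (totalDegree_C_mul_le _ _).trans (totalDegree_affineForm_le _ _)
  set r := dist b c / D with hr
  -- Both directions `b - a` and `c - a` have the normal component `1 / r` on `b c`, so `w₁ + w₂`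
  -- must equal `r P(t)` there. With `P = P₀ + t R` one writes `P = (1 - t) P₀ + t (R + P₀)`: the
  -- first part carries `μ`, zero on `c a`, the second carries `ν`, zero on `a b`.
  set w₁ : Poly := MvPolynomial.C (r * P.coeff 0) * μ with hw₁
  set w₂ : Poly := ν * (MvPolynomial.C r *
    (Polynomial.aeval ν P.divX + MvPolynomial.C (P.coeff 0))) with hw₂
  have dw₁ : w₁.totalDegree ≤ k := (totalDegree_C_mul_le _ _).trans (dμ.trans hk)
  have dw₂ : w₂.totalDegree ≤ k := by
    have : (MvPolynomial.C r * (Polynomial.aeval ν P.divX + MvPolynomial.C (P.coeff 0)) :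
        Poly).totalDegree ≤ k - 1 := by
      refine (totalDegree_C_mul_le _ _).trans (totalDegree_add_le ?_ (by simp))
      refine (totalDegree_aeval_le dν _).trans ?_
      rw [Polynomial.natDegree_divX_eq_natDegree_tsub_one]
      omega
    exact (totalDegree_mul_le dν this).trans (by omega)
  have hev : ∀ x, evVec x (dirField w₁ (b - a) + dirField w₂ (c - a)) =
      ev x w₁ • (b - a).ofLp + ev x w₂ • (c - a).ofLp := by
    intro x
    rw [evVec_add, evVec_dirField, evVec_dirField]
  refine ⟨dirField w₁ (b - a) + dirField w₂ (c - a), fun i => totalDegree_add_le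
    (totalDegree_dirField_le dw₁ _ _) (totalDegree_dirField_le dw₂ _ _), ?_, ?_, ?_⟩
  · intro x hx
    have : ev x ν = 0 := by simp [hν, cross_eq_zero_of_mem_segment hx]
    rw [hev, add_dotProduct, smul_dotProduct, smul_dotProduct, dotProduct_normal, cross_self,
      hw₂, ev_mul x ν, this]
    simp
  · intro x hx
    have h1 : ev x μ = 0 := by simp [hμ, cross_eq_zero_of_mem_segment hx]
    have h2 : cross (c - a) (a - c) = 0 := by simp [cross]; ring
    rw [hev, add_dotProduct, smul_dotProduct, smul_dotProduct, dotProduct_normal (c - a), h2,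
      hw₁, ev_mul x _ μ, h1]
    simp
  · intro t
    have h1 : ev (AffineMap.lineMap b c t) μ = 1 - t := by
      simp only [hμ, ev_mul, ev_C, ev_affineForm, AffineMap.lineMap_apply_module]
      field_simp
      simp [hD, cross]; ring
    have h2 : ev (AffineMap.lineMap b c t) ν = t := by
      simp only [hν, ev_mul, ev_C, ev_affineForm, AffineMap.lineMap_apply_module]
      field_simp
      simp [hD, cross]; ring
    have h3 : cross (b - a) (c - b) = D := by simp [hD, cross]; ring
    have h4 : cross (c - a) (c - b) = D := by simp [hD, cross]; ring
    rw [hev, add_dotProduct, smul_dotProduct, smul_dotProduct, dotProduct_normal,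
      dotProduct_normal, h3, h4, hw₁, hw₂]
    simp only [ev_mul, ev_add, ev_C, ev_aeval, h1, h2, hr, smul_eq_mul]
    conv_rhs => rw [← Polynomial.divX_mul_X_add P]
    simp only [Polynomial.eval_add, Polynomial.eval_mul, Polynomial.eval_X, Polynomial.eval_C]
    field_simp
    ring

namespace CellFamily

variable {M : CellFamily}

/-! ### Opposite directed edges and fields without interior flux -/

lemma vtx_add_two_add_one (s : M.Tri) (i : Fin 3) : vtx s (i + 2 + 1) = vtx s i := by
  rw [show i + 2 + 1 = i by fin_cases i <;> rfl]

lemma vtx_injective (s : M.Tri) : Function.Injective (vtx s) := by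
  have h0 := apex_ne_base₀ s
  have h1 := base₀_ne_base₁ s
  have h2 := base₁_ne_apex s
  intro i j hij
  fin_cases i <;> fin_cases j <;> simp [vtx] at hij ⊢
  · exact h0 hij
  · exact h2 hij.symm
  · exact h0 hij.symm
  · exact h1 hij
  · exact h2 hij
  · exact h1 hij.symm

lemma ne_of_opposite_dedge {s t : M.Tri} {i j : Fin 3} (h : dedge t j = (dedge s i).swap) :
    s ≠ t := by
  rintro rfl
  simp only [dedge, Prod.swap_prod_mk, Prod.mk.injEq] at h
  have h1 := vtx_injective s h.1
  have h2 := vtx_injective s h.2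
  subst h1
  fin_cases i <;> simp at h2

lemma Conforming.not_opposite_of_isBoundary (hM : M.Conforming) {s : M.Tri} (hs : IsBoundary s)
    {t : M.Tri} {j : Fin 3} : dedge t j ≠ (dedge s 1).swap := fun h =>
  ne_of_opposite_dedge h (hs t ((hM.of_opposite_dedge h).2.2 rfl).symm).symm

/-- Fields whose normal components vanish on all edges between two subtriangles. -/
lemma normalContinuous_of_eq_zero {v : M.Vec}
    (h : ∀ (s t : M.Tri) (i j : Fin 3), dedge t j = (dedge s i).swap → ∀ x ∈ segment ℝ (vtx s i) (vtx s (i + 1)),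
      evVec x (v s) ⬝ᵥ normal (vtx s i) (vtx s (i + 1)) = 0) : NormalContinuous v := by
  intro s t i j hst x hx
  have h1 := h s t i j hst x hx
  have hst' : dedge s i = (dedge t j).swap := by rw [hst, Prod.swap_swap]
  have e : vtx t j = vtx s (i + 1) ∧ vtx t (j + 1) = vtx s i := by
    simpa [dedge] using hst
  have h2 := h t s j i hst' x (by rw [e.1, e.2, segment_symm]; exact hx)
  rw [e.1, e.2, normal_symm, dotProduct_neg, neg_eq_zero] at h2
  rw [sub_dotProduct, h1, h2, sub_zero]

end CellFamily

namespace CoupledMesh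

open CellFamily

variable {T : CoupledMesh} {k : ℕ}

/-! ### Admissible Darcy velocities and lifting of the boundary data -/

lemma mem_HD_of_normalContinuous {v : T.D.Vec} (hdeg : ∀ s i, (v s i).totalDegree ≤ k)
    (hv : NormalContinuous v) : v ∈ T.HD k := ⟨hdeg, T.confD.memHdiv_toFun hv⟩

lemma mem_edgesΓD {s : T.D.Tri} :
    s ∈ T.edgesΓD ↔ IsBoundary s ∧ ∀ t : T.B.Tri, primalEdge t ≠ primalEdge s := by
  simp [edgesΓD]

lemma mem_HDbc_zero {v : T.D.Vec} (hv : v ∈ T.HD k)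
    (h0 : ∀ s ∈ T.edgesΓD, ∀ x ∈ segment ℝ (base₀ s) (base₁ s),
      evVec x (v s) ⬝ᵥ outNormal s = 0) : v ∈ T.HDbc k 0 := by
  refine ⟨hv, fun s hs χ _ => ?_⟩
  rw [← segInt_zero (base₀ s) (base₁ s)]
  refine segInt_congr fun x hx => ?_
  have := h0 s hs x hx
  simp [this]

/-- The boundary condition on `Γ_D` can be satisfied. -/
lemma HDbc_nonempty (hk : 1 ≤ k) {g : Plane → ℝ}
    (hg : ∀ s ∈ T.edgesΓD, MemL2Seg (base₀ s) (base₁ s) g) : (T.HDbc k g).Nonempty := by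
  classical
  -- Each triangle at `Γ_D` gets a field without flux through its dual edges, so the triangles are
  -- independent of each other and the extension by zero stays in `H(div)`.
  have hex : ∀ s : T.D.Tri, ∃ w : Fin 2 → Poly, (∀ i, (w i).totalDegree ≤ k) ∧
      (s ∈ T.edgesΓD → (∀ x ∈ segment ℝ (apex s) (base₀ s),
          evVec x w ⬝ᵥ normal (apex s) (base₀ s) = 0) ∧
        (∀ x ∈ segment ℝ (base₁ s) (apex s), evVec x w ⬝ᵥ normal (base₁ s) (apex s) = 0) ∧
        IsEdgeProj k (base₀ s) (base₁ s) g (fun x => evVec x w ⬝ᵥ outNormal s)) ∧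
      (s ∉ T.edgesΓD → w = 0) := by
    intro s
    by_cases hs : s ∈ T.edgesΓD
    · obtain ⟨P, hP, hPQ⟩ := exists_l2Projection_unitInterval k
        (intervalIntegrable_of_memL2Seg (hg s hs))
      obtain ⟨w, hw, h1, h2, h3⟩ := exists_field_normal_eq (cross_pos s) hk hP
      refine ⟨w, hw, fun _ => ⟨h1, h2, fun χ hχ => ?_⟩, fun h => absurd hs h⟩
      have := hPQ _ (natDegree_edgePoly_le (a := base₀ s) (b := base₁ s) hχ)
      simp only [eval_edgePoly, ← h3] at this
      rw [segInt]
      simp only [outNormal, this, mul_zero]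
    · exact ⟨0, by simp, fun h => absurd h hs, fun _ => rfl⟩
  choose v hdeg hv h0 using hex
  refine ⟨v, mem_HD_of_normalContinuous hdeg (normalContinuous_of_eq_zero ?_),
    fun s hs => (hv s hs).2.2⟩
  intro s t i j hst x hx
  by_cases hs : s ∈ T.edgesΓD
  · have hi : i = 0 ∨ i = 1 ∨ i = 2 := by fin_cases i <;> simp
    rcases hi with rfl | rfl | rfl
    · exact (hv s hs).1 x hx
    · exact absurd hst (T.confD.not_opposite_of_isBoundary (mem_edgesΓD.1 hs).1)
    · exact (hv s hs).2.1 x hx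
  · rw [h0 s hs, evVec_zero, zero_dotProduct]

end CoupledMesh

/-! ### Injectivity on the Darcy side -/

/-- Integration by parts on a triangle, for a field without flux through the boundary. -/
lemma setIntegral_mul_div_of_normal_eq_zero {a b c : Plane} (h : 0 < cross (b - a) (c - a))
    (p : Poly) {w : Fin 2 → Poly} (h₁ : ∀ x ∈ segment ℝ a b, evVec x w ⬝ᵥ normal a b = 0)
    (h₂ : ∀ x ∈ segment ℝ b c, evVec x w ⬝ᵥ normal b c = 0)
    (h₃ : ∀ x ∈ segment ℝ c a, evVec x w ⬝ᵥ normal c a = 0) :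
    ∫ x in convexHull ℝ {a, b, c}, ev x p * ev x (div w) =
      -∫ x in convexHull ℝ {a, b, c}, evVec x w ⬝ᵥ evVec x (grad p) := by
  have key := setIntegral_div_triangle h (F := fun x => ev x p • evVec x w) (fun i => by
    simpa [evVec] using (contDiff_ev p).mul (contDiff_ev (w i)))
  have hdiv : ∀ x, ∑ i, fderiv ℝ (fun y => (ev y p • evVec y w) i) x
      (EuclideanSpace.single i 1) =
      ev x p * ev x (div w) + evVec x w ⬝ᵥ evVec x (grad p) := by
    intro x
    have : ∀ i, (fun y => (ev y p • evVec y w) i) = fun y => ev y (p * w i) := by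
      intro i; ext y; simp [evVec]
    simp only [this, fderiv_ev_single, MvPolynomial.pderiv_mul]
    simp [evVec, grad, div, dotProduct, Fin.sum_univ_two]
    ring
  have hfl : ∀ a' b' : Plane, (∀ x ∈ segment ℝ a' b', evVec x w ⬝ᵥ normal a' b' = 0) →
      flux a' b' (fun x => ev x p • evVec x w) = 0 := by
    intro a' b' h'
    rw [flux, ← segInt_zero a' b']
    refine segInt_congr fun x hx => ?_
    rw [smul_dotProduct, h' x hx, smul_zero]
  have hK := isCompact_convexHull_triple a b c
  have c1 : Continuous fun x => ev x p * ev x (div w) := by fun_prop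
  have c2 : Continuous fun x => evVec x w ⬝ᵥ evVec x (grad p) := by fun_prop
  simp only [hdiv] at key
  rw [hfl a b h₁, hfl b c h₂, hfl c a h₃, integral_add (c1.continuousOn.integrableOn_compact hK)
    (c2.continuousOn.integrableOn_compact hK)] at key
  linarith

/-- The lowest order Raviart-Thomas field of the edge from `a` to `b` of a triangle. -/
def raviartThomas (a b c : Plane) : Fin 2 → Poly := fun i =>
  MvPolynomial.C (cross (b - a) (c - a))⁻¹ * (MvPolynomial.X i - MvPolynomial.C (c i))

lemma totalDegree_raviartThomas_le (a b c : Plane) (i : Fin 2) :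
    (raviartThomas a b c i).totalDegree ≤ 1 :=
  (totalDegree_C_mul_le _ _).trans (totalDegree_X_sub_C_le _ _)

lemma evVec_raviartThomas (a b c x : Plane) :
    evVec x (raviartThomas a b c) = (cross (b - a) (c - a))⁻¹ • (x - c).ofLp := by
  ext i; simp [evVec, raviartThomas]

lemma raviartThomas_normal {a b c x : Plane} (h : 0 < cross (b - a) (c - a))
    (hx : x ∈ segment ℝ a b) :
    evVec x (raviartThomas a b c) ⬝ᵥ normal a b = (dist a b)⁻¹ := by
  have h1 : cross (x - c) (b - a) = cross (b - a) (c - a) := by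
    obtain ⟨u, v, -, -, huv, rfl⟩ := hx
    obtain rfl : u = 1 - v := by linarith
    simp [cross]; ring
  rw [evVec_raviartThomas, smul_dotProduct, dotProduct_normal, h1, smul_eq_mul]
  field_simp

/-- The field is a multiple of `x - c`, which is tangential to any edge through `c`. -/
lemma raviartThomas_normal_next {a b c x : Plane} (hx : x ∈ segment ℝ b c) :
    evVec x (raviartThomas a b c) ⬝ᵥ normal b c = 0 := by
  have h1 : cross (x - c) (c - b) = 0 := by
    obtain ⟨u, v, -, -, huv, rfl⟩ := hx
    obtain rfl : u = 1 - v := by linarith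
    simp [cross]; ring
  rw [evVec_raviartThomas, smul_dotProduct, dotProduct_normal, h1]
  simp

lemma raviartThomas_normal_prev {a b c x : Plane} (hx : x ∈ segment ℝ c a) :
    evVec x (raviartThomas a b c) ⬝ᵥ normal c a = 0 := by
  have h1 : cross (x - c) (a - c) = 0 := by
    obtain ⟨u, v, -, -, huv, rfl⟩ := hx
    obtain rfl : u = 1 - v := by linarith
    simp [cross]; ring
  rw [evVec_raviartThomas, smul_dotProduct, dotProduct_normal, h1]
  simp

/-- By the divergence theorem only the edge `a b` contributes, with its length times the reciprocal
of its length. -/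
lemma setIntegral_div_raviartThomas {a b c : Plane} (h : 0 < cross (b - a) (c - a)) :
    ∫ x in convexHull ℝ {a, b, c}, ev x (div (raviartThomas a b c)) = 1 := by
  have key := setIntegral_div_triangle h (F := fun x => evVec x (raviartThomas a b c))
    (fun i => contDiff_ev _)
  simp only [← ev_div] at key
  have hab : a ≠ b := by
    rintro rfl
    simp [cross] at h
  have hd := dist_ne_zero.2 hab
  have f1 : flux a b (fun x => evVec x (raviartThomas a b c)) = 1 := by
    rw [flux, segInt_congr (g := fun _ => (dist a b)⁻¹) fun x hx => raviartThomas_normal h hx]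
    simp [segInt, hd]
  have f2 : flux b c (fun x => evVec x (raviartThomas a b c)) = 0 := by
    rw [flux, segInt_congr fun x hx => raviartThomas_normal_next hx, segInt_zero]
  have f3 : flux c a (fun x => evVec x (raviartThomas a b c)) = 0 := by
    rw [flux, segInt_congr fun x hx => raviartThomas_normal_prev hx, segInt_zero]
  rw [key, f1, f2, f3]
  norm_num

namespace CellFamily

variable {M : CellFamily}

/-- The Raviart-Thomas field of an edge of a subtriangle. -/
def edgeField (s : M.Tri) (i : Fin 3) : Fin 2 → Poly :=
  raviartThomas (vtx s i) (vtx s (i + 1)) (vtx s (i + 2))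

open Classical in
lemma edgeField_normal (s : M.Tri) (i j : Fin 3) {x : Plane}
    (hx : x ∈ segment ℝ (vtx s j) (vtx s (j + 1))) :
    evVec x (edgeField s i) ⬝ᵥ normal (vtx s j) (vtx s (j + 1)) =
      if j = i then (dist (vtx s j) (vtx s (j + 1)))⁻¹ else 0 := by
  have hj : j = i ∨ j = i + 1 ∨ j = i + 2 := by fin_cases i <;> fin_cases j <;> simp
  rcases hj with rfl | rfl | rfl
  · rw [if_pos rfl]
    exact raviartThomas_normal (cross_vtx_pos s j) hx
  · rw [if_neg (by fin_cases i <;> simp)]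
    rw [show i + 1 + 1 = i + 2 by fin_cases i <;> rfl] at hx ⊢
    exact raviartThomas_normal_next hx
  · rw [if_neg (by fin_cases i <;> simp)]
    rw [vtx_add_two_add_one] at hx ⊢
    exact raviartThomas_normal_prev hx

lemma setIntegral_div_edgeField (s : M.Tri) (i : Fin 3) :
    ∫ x in tri s, ev x (div (edgeField s i)) = 1 := by
  rw [tri, verts_eq s i]
  exact setIntegral_div_raviartThomas (cross_vtx_pos s i)

end CellFamily

lemma div_neg (v : Fin 2 → Poly) : div (-v) = -div v := by
  simp [div]

lemma div_zero : div (0 : Fin 2 → Poly) = 0 := by simp [div]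

namespace CoupledMesh

open CellFamily

variable {T : CoupledMesh} {k : ℕ}

/-- A pressure that is orthogonal to all divergences is elementwise constant. -/
lemma exists_eq_C_of_formA_eq_zero {p : T.D.Scalar} (hp : p ∈ T.QD k)
    (h : ∀ v ∈ T.HDbc k 0, formA v p = 0) (s : T.D.Tri) : ∃ c, p s = MvPolynomial.C c := by
  classical
  -- A nonconstant pressure of degree at most `k - 1` forces `k ≥ 2`, which the degree count of the
  -- bubble field below requires.
  by_cases hdeg : (p s).totalDegree = 0
  · exact ⟨_, MvPolynomial.totalDegree_eq_zero_iff_eq_C.1 hdeg⟩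
  set a := apex s with ha
  set b := base₀ s with hb
  set c := base₁ s with hc
  have hpos : 0 < cross (b - a) (c - a) := cross_pos s
  set g₁ := dirDeriv (b - a) (p s) with hg₁
  set g₂ := dirDeriv (a - c) (p s) with hg₂
  -- Each summand is tangential to one edge and vanishes on the other two, so `w` has no flux
  -- through the boundary of the triangle, while `w ⬝ ∇ p` is a sum of squares with weights positive
  -- inside.
  set w : Fin 2 → Poly :=
    dirField (affineForm (c - b) b * (affineForm (a - c) c * g₁)) (b - a) +
      dirField (affineForm (b - a) a * (affineForm (c - b) b * g₂)) (a - c) with hw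
  have hev : ∀ x, evVec x w =
      (cross (c - b) (x - b) * (cross (a - c) (x - c) * ev x g₁)) • (b - a).ofLp +
      (cross (b - a) (x - a) * (cross (c - b) (x - b) * ev x g₂)) • (a - c).ofLp := by
    intro x
    rw [hw, evVec_add, evVec_dirField, evVec_dirField]
    simp
  have hwdeg : ∀ i, (w i).totalDegree ≤ k := by
    intro i
    have hp := hp s
    have e1 : ∀ d, (dirDeriv d (p s)).totalDegree ≤ k - 2 := fun d =>
      (totalDegree_dirDeriv_le d _).trans (by omega)
    have h1 : 1 + (1 + (k - 2)) ≤ k := by omega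
    exact totalDegree_add_le
      (totalDegree_dirField_le ((totalDegree_mul_le (totalDegree_affineForm_le _ _)
        (totalDegree_mul_le (totalDegree_affineForm_le _ _) (e1 _))).trans h1) _ _)
      (totalDegree_dirField_le ((totalDegree_mul_le (totalDegree_affineForm_le _ _)
        (totalDegree_mul_le (totalDegree_affineForm_le _ _) (e1 _))).trans h1) _ _)
  have hn₁ : ∀ x ∈ segment ℝ a b, evVec x w ⬝ᵥ normal a b = 0 := by
    intro x hx
    rw [hev, cross_eq_zero_of_mem_segment hx, add_dotProduct, smul_dotProduct, smul_dotProduct,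
      dotProduct_normal, cross_self]
    simp
  have hn₂ : ∀ x ∈ segment ℝ b c, evVec x w ⬝ᵥ normal b c = 0 := by
    intro x hx
    rw [hev, cross_eq_zero_of_mem_segment hx]
    simp
  have hn₃ : ∀ x ∈ segment ℝ c a, evVec x w ⬝ᵥ normal c a = 0 := by
    intro x hx
    rw [hev, cross_eq_zero_of_mem_segment hx, add_dotProduct, smul_dotProduct, smul_dotProduct,
      dotProduct_normal (a - c), cross_self]
    simp
  let v : T.D.Vec := fun t => if t = s then w else 0
  have hedge : ∀ t i, ∀ x ∈ segment ℝ (vtx t i) (vtx t (i + 1)),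
      evVec x (v t) ⬝ᵥ normal (vtx t i) (vtx t (i + 1)) = 0 := by
    intro t i x hx
    by_cases ht : t = s
    · subst ht
      rw [show v t = w from if_pos rfl]
      have hi : i = 0 ∨ i = 1 ∨ i = 2 := by fin_cases i <;> simp
      rcases hi with rfl | rfl | rfl
      · exact hn₁ x hx
      · exact hn₂ x hx
      · exact hn₃ x hx
    · rw [show v t = 0 from if_neg ht, evVec_zero, zero_dotProduct]
  have hv : v ∈ T.HDbc k 0 := by
    refine mem_HDbc_zero (mem_HD_of_normalContinuous (fun t i => ?_)
      (normalContinuous_of_eq_zero fun t _ i _ _ => hedge t i)) fun t _ => hedge t 1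
    by_cases ht : t = s
    · simpa [v, ht] using hwdeg i
    · simp [v, ht]
  have hz := h v hv
  rw [formA, elemInt, Finset.sum_eq_single s (fun t _ ht => by
      simp [show v t = 0 from if_neg ht, div_zero]) (by simp), show v s = w from if_pos rfl,
    tri_eq, setIntegral_mul_div_of_normal_eq_zero hpos _ hn₁ hn₂ hn₃, neg_eq_zero] at hz
  have hdot : ∀ x, evVec x w ⬝ᵥ evVec x (grad (p s)) =
      cross (c - b) (x - b) * (cross (a - c) (x - c) * ev x g₁ ^ 2) +
        cross (b - a) (x - a) * (cross (c - b) (x - b) * ev x g₂ ^ 2) := by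
    intro x
    rw [hev, add_dotProduct, smul_dotProduct, smul_dotProduct, ← ev_dirDeriv, ← ev_dirDeriv,
      ← hg₁, ← hg₂]
    simp only [smul_eq_mul]; ring
  have hvan := eq_zero_of_setIntegral_eq_zero (a := a) (b := b) (c := c)
    (f := fun x => evVec x w ⬝ᵥ evVec x (grad (p s))) (by fun_prop) (fun x hx => by
      rw [mem_convexHull_iff_cross hpos] at hx
      have h1 := hx.1
      have h2 := hx.2.1
      have h3 := hx.2.2
      simp only [hdot]
      positivity) hz
  have hzero : ∀ x ∈ openTri a b c, ev x g₁ = 0 ∧ ev x g₂ = 0 := by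
    intro x hx
    have h0 := hvan x (openTri_subset_interior hpos hx)
    simp only [hdot] at h0
    have h1 := hx.1
    have h2 := hx.2.1
    have h3 := hx.2.2
    have n1 : 0 ≤ cross (c - b) (x - b) * (cross (a - c) (x - c) * ev x g₁ ^ 2) := by positivity
    have n2 : 0 ≤ cross (b - a) (x - a) * (cross (c - b) (x - b) * ev x g₂ ^ 2) := by positivity
    have z1 : cross (c - b) (x - b) * (cross (a - c) (x - c) * ev x g₁ ^ 2) = 0 := by linarith
    have z2 : cross (b - a) (x - a) * (cross (c - b) (x - b) * ev x g₂ ^ 2) = 0 := by linarith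
    exact ⟨by simpa [h3.ne', h2.ne'] using z1, by simpa [h1.ne', h2.ne'] using z2⟩
  have hne : cross (b - a) (a - c) ≠ 0 := by
    have : cross (b - a) (a - c) = -cross (b - a) (c - a) := by simp [cross]; ring
    rw [this]
    exact neg_ne_zero.2 hpos.ne'
  exact eq_C_of_dirDeriv_eq_zero hne
    (eq_zero_of_ev_eq_zero (isOpen_openTri a b c) (openTri_nonempty hpos) fun x hx =>
      (hzero x hx).1)
    (eq_zero_of_ev_eq_zero (isOpen_openTri a b c) (openTri_nonempty hpos) fun x hx =>
      (hzero x hx).2)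

/-- An elementwise constant pressure that is orthogonal to all divergences does not jump across
interior edges. -/
lemma eq_of_formA_eq_zero (hk : 1 ≤ k) {p : T.D.Scalar} {c : T.D.Tri → ℝ}
    (hc : ∀ s, p s = MvPolynomial.C (c s)) (h : ∀ v ∈ T.HDbc k 0, formA v p = 0)
    {s₀ t₀ : T.D.Tri} {i₀ j₀ : Fin 3} (hop : dedge t₀ j₀ = (dedge s₀ i₀).swap) : c s₀ = c t₀ := by
  classical
  have hne : s₀ ≠ t₀ := ne_of_opposite_dedge hop
  have hop' : dedge s₀ i₀ = (dedge t₀ j₀).swap := by rw [hop, Prod.swap_swap]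
  -- Raviart-Thomas fields on the two sides of the edge, the second with a minus sign because both
  -- are normalised to unit outward flux. Their divergences have integrals `1` and `-1`, so `formA`
  -- returns the difference of the constants.
  let v : T.D.Vec := fun t => if t = s₀ then edgeField s₀ i₀ else
    if t = t₀ then -edgeField t₀ j₀ else 0
  have v1 : v s₀ = edgeField s₀ i₀ := if_pos rfl
  have v2 : v t₀ = -edgeField t₀ j₀ := by simp only [v, if_neg hne.symm, if_true]
  have v3 : ∀ t, t ≠ s₀ → t ≠ t₀ → v t = 0 := fun t h1 h2 => by simp only [v, if_neg h1, if_neg h2]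
  -- Written in terms of directed edges, the normal component is antisymmetric under reversal of the
  -- edge; normal continuity follows at once.
  have hN : ∀ s i, ∀ x ∈ segment ℝ (vtx s i) (vtx s (i + 1)),
      evVec x (v s) ⬝ᵥ normal (vtx s i) (vtx s (i + 1)) =
      (if dedge s i = dedge s₀ i₀ then (dist (vtx s i) (vtx s (i + 1)))⁻¹ else 0) -
        if dedge s i = dedge t₀ j₀ then (dist (vtx s i) (vtx s (i + 1)))⁻¹ else 0 := by
    intro s i x hx
    by_cases h1 : s = s₀
    · subst h1
      have z : dedge s i ≠ dedge t₀ j₀ := fun he => hne (T.confD.eq_of_dedge he)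
      rw [v1, edgeField_normal s i₀ i hx, if_neg z, sub_zero]
      by_cases hi : i = i₀
      · rw [if_pos hi, if_pos (by rw [hi])]
      · rw [if_neg hi, if_neg]
        intro he
        exact hi (vtx_injective s (congrArg Prod.fst he))
    · have z : dedge s i ≠ dedge s₀ i₀ := fun he => h1 (T.confD.eq_of_dedge he)
      rw [if_neg z, zero_sub]
      by_cases h2 : s = t₀
      · subst h2
        rw [v2, evVec_neg, neg_dotProduct, edgeField_normal s j₀ i hx]
        congr 1
        by_cases hi : i = j₀
        · rw [if_pos hi, if_pos (by rw [hi])]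
        · rw [if_neg hi, if_neg]
          intro he
          exact hi (vtx_injective s (congrArg Prod.fst he))
      · rw [v3 s h1 h2, if_neg fun he => h2 (T.confD.eq_of_dedge he)]
        simp
  have hv : v ∈ T.HDbc k 0 := by
    refine mem_HDbc_zero (mem_HD_of_normalContinuous (fun t i => ?_) ?_) ?_
    · simp only [v]
      split_ifs
      · exact (totalDegree_raviartThomas_le _ _ _ _).trans hk
      · rw [Pi.neg_apply, MvPolynomial.totalDegree_neg]
        exact (totalDegree_raviartThomas_le _ _ _ _).trans hk
      · simp
    · intro s t i j hst x hx
      have e : vtx t j = vtx s (i + 1) ∧ vtx t (j + 1) = vtx s i := by simpa [dedge] using hst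
      have h2 := hN t j x (by rw [e.1, e.2, segment_symm]; exact hx)
      have e1 : dedge t j = dedge s₀ i₀ ↔ dedge s i = dedge t₀ j₀ := by
        rw [hst, hop, Prod.swap_eq_iff_eq_swap]
      have e2 : dedge t j = dedge t₀ j₀ ↔ dedge s i = dedge s₀ i₀ := by
        rw [hst, hop, Prod.swap_inj]
      simp only [e1, e2, e.1, e.2, normal_symm (vtx s i), dotProduct_neg,
        dist_comm (vtx s (i + 1))] at h2
      rw [sub_dotProduct, hN s i x hx]
      linarith
    · intro s hs x hx
      have hb := (mem_edgesΓD.1 hs).1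
      have := hN s 1 x hx
      rw [if_neg, if_neg, sub_zero] at this
      · exact this
      · intro he
        exact T.confD.not_opposite_of_isBoundary hb (hop'.trans (congrArg Prod.swap he.symm))
      · intro he
        exact T.confD.not_opposite_of_isBoundary hb (hop.trans (congrArg Prod.swap he.symm))
  have hz := h v hv
  simp only [formA, elemInt, hc, ev_C, integral_const_mul] at hz
  rw [Finset.sum_eq_add s₀ t₀ hne (fun t _ ht => by
      rw [v3 t ht.1 ht.2, div_zero]; simp) (by simp) (by simp), v1, v2, div_neg] at hz
  simp only [ev_neg, integral_neg, setIntegral_div_edgeField] at hz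
  linarith

/-- A Darcy pressure that is orthogonal to all divergences vanishes. -/
lemma eq_zero_of_formA_eq_zero (hk : 1 ≤ k) {p : T.D.Scalar} (hp : p ∈ T.QD k)
    (h : ∀ v ∈ T.HDbc k 0, formA v p = 0) : p = 0 := by
  classical
  choose c hc using exists_eq_C_of_formA_eq_zero hp h
  obtain ⟨s₀, t₀, hst⟩ := T.interface_nonempty
  have h1 : ∀ s, c s = c (prev s) := fun s => eq_of_formA_eq_zero hk hc h (dedge_prev_two s)
  have h2 : ∀ s t, primalEdge s = primalEdge t → c s = c t := by
    intro s t hst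
    by_cases he : s = t
    · rw [he]
    · have e := T.confD.base_eq he hst
      exact eq_of_formA_eq_zero hk hc h (i₀ := 1) (j₀ := 1)
        (by rw [dedge_one, dedge_one, e.1, e.2]; rfl)
  have hall := T.confD.eq_of_adjacent T.connected_D c h1 h2 t₀
  -- The edge lies on `Γ`: it has no second triangle in `Ω_D` and no condition in `H_{h,0}^D`, so a
  -- field on one triangle is admissible and tests the constant itself.
  let v : T.D.Vec := fun t => if t = t₀ then edgeField t₀ 1 else 0
  have v1 : v t₀ = edgeField t₀ 1 := if_pos rfl
  have v2 : ∀ t, t ≠ t₀ → v t = 0 := fun t ht => if_neg ht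
  have hv : v ∈ T.HDbc k 0 := by
    refine mem_HDbc_zero (mem_HD_of_normalContinuous (fun t i => ?_)
      (normalContinuous_of_eq_zero ?_)) ?_
    · simp only [v]
      split_ifs
      · exact (totalDegree_raviartThomas_le _ _ _ _).trans hk
      · simp
    · intro s t i j hop x hx
      by_cases hs : s = t₀
      · subst hs
        rw [v1, edgeField_normal s 1 i hx, if_neg]
        rintro rfl
        exact T.confD.not_opposite_of_isBoundary (T.isBoundary_of_interface_right hst) hop
      · rw [v2 s hs, evVec_zero, zero_dotProduct]
    · intro s hs x _
      have hs' : s ≠ t₀ := by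
        rintro rfl
        exact (mem_edgesΓD.1 hs).2 s₀ hst
      rw [v2 s hs', evVec_zero, zero_dotProduct]
  have hz := h v hv
  simp only [formA, elemInt, hc, ev_C, integral_const_mul] at hz
  rw [Finset.sum_eq_single t₀ (fun t _ ht => by rw [v2 t ht, div_zero]; simp) (by simp), v1,
    setIntegral_div_edgeField, mul_one] at hz
  funext s
  rw [hc, hall, hz]
  simp

end CoupledMesh

/-! ### Linearity of the forms -/

section IsLinearMap

variable {V W : Type*} [AddCommGroup V] [Module ℝ V] [AddCommGroup W] [Module ℝ W]

lemma isLinearMap_comp {f : W → ℝ} (hf : IsLinearMap ℝ f) {g : V → W} (hg : IsLinearMap ℝ g) :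
    IsLinearMap ℝ fun v => f (g v) :=
  ((hf.mk' f).comp (hg.mk' g)).isLinear

lemma isLinearMap_add {f g : V → ℝ} (hf : IsLinearMap ℝ f) (hg : IsLinearMap ℝ g) :
    IsLinearMap ℝ fun v => f v + g v := (hf.mk' f + hg.mk' g).isLinear

lemma isLinearMap_sub {f g : V → ℝ} (hf : IsLinearMap ℝ f) (hg : IsLinearMap ℝ g) :
    IsLinearMap ℝ fun v => f v - g v := (hf.mk' f - hg.mk' g).isLinear

lemma isLinearMap_neg {f : V → ℝ} (hf : IsLinearMap ℝ f) :
    IsLinearMap ℝ fun v => -f v := (-hf.mk' f).isLinear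

lemma isLinearMap_sum {ι : Type*} (s : Finset ι) {f : ι → V → ℝ}
    (hf : ∀ i, IsLinearMap ℝ (f i)) : IsLinearMap ℝ fun v => ∑ i ∈ s, f i v :=
  ⟨fun v w => by simp only [(hf _).map_add, Finset.sum_add_distrib],
    fun c v => by simp only [(hf _).map_smul, Finset.smul_sum]⟩

lemma isLinearMap_segInt_of_integrable {a b : Plane} {F : V → Plane → ℝ}
    (hF : ∀ x, IsLinearMap ℝ fun v => F v x)
    (hi : ∀ v, IntervalIntegrable (fun t : ℝ => F v (AffineMap.lineMap a b t)) volume 0 1) :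
    IsLinearMap ℝ fun v => segInt a b (F v) := by
  constructor
  · intro v w
    simp only [segInt, (hF _).map_add]
    rw [intervalIntegral.integral_add (hi v) (hi w), mul_add]
  · intro c v
    simp only [segInt, (hF _).map_smul, smul_eq_mul]
    rw [intervalIntegral.integral_const_mul]
    ring

lemma isLinearMap_segInt {a b : Plane} {F : V → Plane → ℝ}
    (hF : ∀ x, IsLinearMap ℝ fun v => F v x) (hc : ∀ v, Continuous (F v)) :
    IsLinearMap ℝ fun v => segInt a b (F v) :=
  isLinearMap_segInt_of_integrable hF fun v =>
    ((hc v).comp (continuous_lineMap_plane a b)).intervalIntegrable _ _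

open CellFamily in
lemma isLinearMap_elemInt_of_integrable {M : CellFamily} {F : V → M.Tri → Plane → ℝ}
    (hF : ∀ s x, IsLinearMap ℝ fun v => F v s x) (hi : ∀ v s, IntegrableOn (F v s) (tri s)) :
    IsLinearMap ℝ fun v => elemInt (F v) := by
  refine isLinearMap_sum _ fun s => ⟨fun v w => ?_, fun c v => ?_⟩
  · simp only [(hF s _).map_add]
    exact integral_add (hi v s) (hi w s)
  · simp only [(hF s _).map_smul, smul_eq_mul]
    exact integral_const_mul _ _

lemma isLinearMap_elemInt {M : CellFamily} {F : V → M.Tri → Plane → ℝ}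
    (hF : ∀ s x, IsLinearMap ℝ fun v => F v s x) (hc : ∀ v s, Continuous (F v s)) :
    IsLinearMap ℝ fun v => CellFamily.elemInt (F v) :=
  isLinearMap_elemInt_of_integrable hF fun v s => CellFamily.integrableOn_tri (hc v s) s

end IsLinearMap

lemma evMat_apply (x : Plane) (G : Matrix (Fin 2) (Fin 2) Poly) (i j : Fin 2) :
    evMat x G i j = ev x (G i j) := rfl

@[fun_prop] lemma continuous_frob_evMat (G H : Matrix (Fin 2) (Fin 2) Poly) :
    Continuous fun x => frob (evMat x G) (evMat x H) := by
  simp only [frob, evMat, Fin.sum_univ_two]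
  fun_prop

namespace CoupledMesh

open CellFamily

variable {T : CoupledMesh}

lemma isLinearMap_formBstar_left (G : T.B.Tensor) :
    IsLinearMap ℝ fun u : T.B.Vec => formBstar u G := by
  refine isLinearMap_sub (isLinearMap_sum _ fun s => isLinearMap_segInt (fun x => ?_)
    fun u => by fun_prop) (isLinearMap_elemInt (fun s x => ?_) fun u s => by fun_prop)
  all_goals
    constructor <;> intros <;> simp [evVec, dotProduct, Fin.sum_univ_two] <;> ring

lemma isLinearMap_formBstar_right (u : T.B.Vec) :
    IsLinearMap ℝ fun G : T.B.Tensor => formBstar u G := by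
  refine isLinearMap_sub (isLinearMap_sum _ fun s => isLinearMap_segInt (fun x => ?_)
    fun u => by fun_prop) (isLinearMap_elemInt (fun s x => ?_) fun u s => by fun_prop)
  · constructor <;> intros <;>
      simp [evMat_apply, mulVec, dotProduct, Fin.sum_univ_two] <;> ring
  · constructor <;> intros <;>
      simp [evVec, divMat, dotProduct, Fin.sum_univ_two] <;> ring

lemma isLinearMap_formB_left (v : T.B.Vec) :
    IsLinearMap ℝ fun L : T.B.Tensor => formB L v := by
  refine isLinearMap_add (isLinearMap_sub (isLinearMap_neg (isLinearMap_sum _ fun p =>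
    isLinearMap_segInt (fun x => ?_) fun u => by fun_prop)) (isLinearMap_sum _ fun s =>
    isLinearMap_segInt (fun x => ?_) fun u => by fun_prop))
    (isLinearMap_elemInt (fun s x => ?_) fun u s => by fun_prop)
  all_goals
    constructor <;> intros <;>
      simp [evMat_apply, mulVec, dotProduct, frob, Fin.sum_univ_two] <;> ring

lemma isLinearMap_formB_right (L : T.B.Tensor) :
    IsLinearMap ℝ fun v : T.B.Vec => formB L v := by
  refine isLinearMap_add (isLinearMap_sub (isLinearMap_neg (isLinearMap_sum _ fun p =>
    isLinearMap_segInt (fun x => ?_) fun u => by fun_prop)) (isLinearMap_sum _ fun s =>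
    isLinearMap_segInt (fun x => ?_) fun u => by fun_prop))
    (isLinearMap_elemInt (fun s x => ?_) fun u s => by fun_prop)
  · constructor <;> intros <;> simp [evVec, dotProduct, Fin.sum_univ_two] <;> ring
  · constructor <;> intros <;> simp [evVec, dotProduct, Fin.sum_univ_two] <;> ring
  · constructor <;> intros <;> simp [evMat_apply, gradVec, frob, Fin.sum_univ_two] <;> ring

lemma isLinearMap_formbstar_left (v : T.B.Vec) :
    IsLinearMap ℝ fun p : T.B.Scalar => formbstar p v := by
  refine isLinearMap_sub (isLinearMap_add (isLinearMap_add (isLinearMap_sum _ fun p =>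
    isLinearMap_segInt (fun x => ?_) fun u => by fun_prop) (isLinearMap_sum _ fun s =>
    isLinearMap_segInt (fun x => ?_) fun u => by fun_prop)) (isLinearMap_sum _ fun s =>
    isLinearMap_segInt (fun x => ?_) fun u => by fun_prop))
    (isLinearMap_elemInt (fun s x => ?_) fun u s => by fun_prop)
  all_goals constructor <;> intros <;> simp <;> ring

lemma isLinearMap_formbstar_right (p : T.B.Scalar) :
    IsLinearMap ℝ fun v : T.B.Vec => formbstar p v := by
  refine isLinearMap_sub (isLinearMap_add (isLinearMap_add (isLinearMap_sum _ fun p =>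
    isLinearMap_segInt (fun x => ?_) fun u => by fun_prop) (isLinearMap_sum _ fun s =>
    isLinearMap_segInt (fun x => ?_) fun u => by fun_prop)) (isLinearMap_sum _ fun s =>
    isLinearMap_segInt (fun x => ?_) fun u => by fun_prop))
    (isLinearMap_elemInt (fun s x => ?_) fun u s => by fun_prop)
  all_goals
    constructor <;> intros <;> simp [evVec, dotProduct, div, Fin.sum_univ_two] <;> ring

lemma isLinearMap_formb_left (q : T.B.Scalar) :
    IsLinearMap ℝ fun u : T.B.Vec => formb u q := by
  refine isLinearMap_add (isLinearMap_neg (isLinearMap_sum _ fun p =>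
    isLinearMap_segInt (fun x => ?_) fun u => by fun_prop))
    (isLinearMap_elemInt (fun s x => ?_) fun u s => by fun_prop)
  all_goals
    constructor <;> intros <;> simp [evVec, dotProduct, Fin.sum_univ_two] <;> ring

lemma isLinearMap_formb_right (u : T.B.Vec) :
    IsLinearMap ℝ fun q : T.B.Scalar => formb u q := by
  refine isLinearMap_add (isLinearMap_neg (isLinearMap_sum _ fun p =>
    isLinearMap_segInt (fun x => ?_) fun u => by fun_prop))
    (isLinearMap_elemInt (fun s x => ?_) fun u s => by fun_prop)
  all_goals
    constructor <;> intros <;> simp [evVec, grad, dotProduct, Fin.sum_univ_two] <;> ring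

lemma isLinearMap_formA_left (p : T.D.Scalar) :
    IsLinearMap ℝ fun v : T.D.Vec => formA v p := by
  refine isLinearMap_elemInt (fun s x => ?_) fun u s => by fun_prop
  constructor <;> intros <;> simp [div, Fin.sum_univ_two] <;> ring

lemma isLinearMap_formA_right (v : T.D.Vec) :
    IsLinearMap ℝ fun p : T.D.Scalar => formA v p := by
  refine isLinearMap_elemInt (fun s x => ?_) fun u s => by fun_prop
  constructor <;> intros <;> simp <;> ring

lemma isLinearMap_formI_left (v : T.D.Vec) :
    IsLinearMap ℝ fun p : T.B.Scalar => formI p v := by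
  refine isLinearMap_sum _ fun s => isLinearMap_segInt (fun x => ?_) fun u => by fun_prop
  constructor <;> intros <;> simp <;> ring

lemma isLinearMap_formI_right (p : T.B.Scalar) :
    IsLinearMap ℝ fun v : T.D.Vec => formI p v := by
  refine isLinearMap_sum _ fun s => isLinearMap_segInt (fun x => ?_) fun u => by fun_prop
  constructor <;> intros <;> simp [evVec, dotProduct, Fin.sum_univ_two] <;> ring

end CoupledMesh

namespace CellFamily

variable {M : CellFamily}

/-! ### Integrability of the data and linearity of the loads -/

/-- A closed triangle may stick out of the open region, but only by a null set. -/
lemma integrableOn_tri_of_region {f : Plane → ℝ} (hf : IntegrableOn f M.region) (s : M.Tri) :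
    IntegrableOn f (tri s) :=
  (hf.mono_set (interior_tri_subset_region s)).congr_set_ae (interior_tri_ae_eq s).symm

lemma integrableOn_tri_mul {f g : Plane → ℝ} (hf : IntegrableOn f M.region) (hg : Continuous g)
    (s : M.Tri) : IntegrableOn (fun x => f x * g x) (tri s) :=
  (integrableOn_tri_of_region hf s).mul_continuousOn hg.continuousOn (isCompact_tri s)

lemma integrableOn_region_of_memLp {E : Type*} [NormedAddCommGroup E] {f : Plane → E}
    (hf : MemLp f 2 (volume.restrict M.region)) : IntegrableOn f M.region := by
  have : IsFiniteMeasure (volume.restrict M.region) := ⟨by simpa using measure_region_lt_top⟩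
  exact hf.integrable (by norm_num)

/-- Polynomials are bounded on a triangle, so integrable entries of the weight make all the
integrals finite. -/
lemma isLinearMap_weightedForm {K : Plane → Matrix (Fin 2) (Fin 2) ℝ}
    (hK : ∀ i j, IntegrableOn (fun x => K x i j) M.region) :
    (∀ v : M.Vec, IsLinearMap ℝ fun u : M.Vec =>
      elemInt fun s x => (K x *ᵥ evVec x (u s)) ⬝ᵥ evVec x (v s)) ∧
    (∀ u : M.Vec, IsLinearMap ℝ fun v : M.Vec =>
      elemInt fun s x => (K x *ᵥ evVec x (u s)) ⬝ᵥ evVec x (v s)) ∧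
    ∀ (u v : M.Vec) (s : M.Tri),
      IntegrableOn (fun x => (K x *ᵥ evVec x (u s)) ⬝ᵥ evVec x (v s)) (tri s) := by
  have key : ∀ (u v : M.Vec) (s : M.Tri),
      IntegrableOn (fun x => (K x *ᵥ evVec x (u s)) ⬝ᵥ evVec x (v s)) (tri s) := by
    intro u v s
    have e : ∀ x, (K x *ᵥ evVec x (u s)) ⬝ᵥ evVec x (v s) =
        ∑ i, ∑ j, K x i j * (ev x (u s j) * ev x (v s i)) := by
      intro x
      simp only [mulVec, dotProduct, evVec, Finset.sum_mul, mul_assoc]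
    simp only [e]
    exact integrable_finsetSum _ fun i _ => integrable_finsetSum _ fun j _ =>
      integrableOn_tri_mul (hK i j) (by fun_prop) s
  refine ⟨fun v => isLinearMap_elemInt_of_integrable (fun s x => ?_) fun u s => key u v s,
    fun u => isLinearMap_elemInt_of_integrable (fun s x => ?_) fun v s => key u v s, key⟩
  all_goals
    constructor <;> intros <;> simp [evVec, mulVec, dotProduct, Fin.sum_univ_two] <;> ring

lemma isLinearMap_load {f : Plane → Plane} (hf : MemLp f 2 (volume.restrict M.region)) :
    IsLinearMap ℝ fun v : M.Vec => elemInt fun s x => (f x).ofLp ⬝ᵥ evVec x (v s) := by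
  refine isLinearMap_elemInt_of_integrable (fun s x => ?_) fun v s => ?_
  · constructor <;> intros <;> simp [evVec, dotProduct, Fin.sum_univ_two] <;> ring
  · have hi : ∀ i, IntegrableOn (fun x => f x i) M.region := fun i =>
      (EuclideanSpace.proj i : Plane →L[ℝ] ℝ).integrable_comp (integrableOn_region_of_memLp hf)
    simp only [dotProduct, evVec]
    exact integrable_finsetSum _ fun i _ => integrableOn_tri_mul (hi i) (by fun_prop) s

lemma isLinearMap_scalarLoad {f : Plane → ℝ} (hf : MemLp f 2 (volume.restrict M.region)) :
    IsLinearMap ℝ fun q : M.Scalar => elemInt fun s x => f x * ev x (q s) := by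
  refine isLinearMap_elemInt_of_integrable (fun s x => ?_) fun v s =>
    integrableOn_tri_mul (integrableOn_region_of_memLp hf) (by fun_prop) s
  constructor <;> intros <;> simp <;> ring

lemma isLinearMap_boundaryLoad {g : Plane → ℝ} (E : Finset M.Tri)
    (hg : ∀ s ∈ E, MemL2Seg (base₀ s) (base₁ s) g) :
    IsLinearMap ℝ fun q : M.Scalar => ∑ s ∈ E, primalInt s fun x => g x * ev x (q s) := by
  simp only [← Finset.sum_coe_sort E]
  refine isLinearMap_sum _ fun s => isLinearMap_segInt_of_integrable (fun x => ?_) fun q => ?_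
  · constructor <;> intros <;> simp <;> ring
  · exact (intervalIntegrable_of_memL2Seg (hg s s.2)).mul_continuousOn
      ((continuous_ev (q s)).comp (continuous_lineMap_plane _ _)).continuousOn

end CellFamily

/-! ### The finite element spaces as subspaces -/

/-- A set that is closed under linear combinations. -/
def submoduleOfLinComb {V : Type*} [AddCommGroup V] [Module ℝ V] (S : Set V) (h0 : (0 : V) ∈ S)
    (h : ∀ (c : ℝ) x y, x ∈ S → y ∈ S → c • x + y ∈ S) : Submodule ℝ V where
  carrier := S
  zero_mem' := h0
  add_mem' {x y} hx hy := by simpa using h 1 x y hx hy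
  smul_mem' c x hx := by simpa using h c x 0 hx h0

lemma evVec_linComb (x : Plane) (c : ℝ) (v w : Fin 2 → Poly) :
    evVec x (c • v + w) = c • evVec x v + evVec x w := by
  ext i; simp [evVec]

lemma evMat_linComb (x : Plane) (c : ℝ) (G H : Matrix (Fin 2) (Fin 2) Poly) :
    evMat x (c • G + H) = c • evMat x G + evMat x H := by
  ext i j; simp [evMat_apply]

@[simp] lemma evMat_zero (x : Plane) : evMat x 0 = 0 := by
  ext i j; simp [evMat_apply]

lemma totalDegree_linComb_le {n : ℕ} (c : ℝ) {p q : Poly} (hp : p.totalDegree ≤ n)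
    (hq : q.totalDegree ≤ n) : (c • p + q).totalDegree ≤ n :=
  totalDegree_add_le ((MvPolynomial.totalDegree_smul_le _ _).trans hp) hq

namespace CoupledMesh

open CellFamily

variable (T : CoupledMesh) (k : ℕ)

lemma zero_mem_HB : (0 : T.B.Vec) ∈ T.HB k := ⟨by simp, by simp⟩

lemma zero_mem_WB : (0 : T.B.Tensor) ∈ T.WB k := ⟨by simp, by simp, by simp, by simp⟩

lemma zero_mem_Q0 : (0 : T.B.Scalar) ∈ T.Q0 k := ⟨⟨by simp, by simp⟩, by simp [elemInt]⟩

lemma zero_mem_QD : (0 : T.D.Scalar) ∈ T.QD k := fun _ => by simp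

lemma zero_mem_HDbc : (0 : T.D.Vec) ∈ T.HDbc k 0 :=
  mem_HDbc_zero (mem_HD_of_normalContinuous (by simp) (normalContinuous_of_eq_zero (by simp)))
    (by simp)

variable {T k}

lemma HB_linComb (c : ℝ) (v w : T.B.Vec) (hv : v ∈ T.HB k) (hw : w ∈ T.HB k) :
    c • v + w ∈ T.HB k := by
  refine ⟨fun s i => totalDegree_linComb_le c (hv.1 s i) (hw.1 s i), fun s x hx => ?_⟩
  simp only [Pi.add_apply, Pi.smul_apply, evVec_linComb]
  rw [show ∀ a b a' b' : Fin 2 → ℝ, c • a + b - (c • a' + b') = c • (a - a') + (b - b') by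
    intros; module, add_dotProduct, smul_dotProduct, hv.2 s x hx, hw.2 s x hx]
  simp

lemma WB_linComb (c : ℝ) (G H : T.B.Tensor) (hG : G ∈ T.WB k) (hH : H ∈ T.WB k) :
    c • G + H ∈ T.WB k := by
  have e : ∀ a b a' b' : Matrix (Fin 2) (Fin 2) ℝ,
      c • a + b - (c • a' + b') = c • (a - a') + (b - b') := by intros; module
  refine ⟨fun s i j => totalDegree_linComb_le c (hG.1 s i j) (hH.1 s i j), fun p hp x hx => ?_,
    fun s x hx => ?_, fun s hs x hx => ?_⟩
  · simp only [Pi.add_apply, Pi.smul_apply, evMat_linComb]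
    rw [e, add_mulVec, smul_mulVec, hG.2.1 p hp x hx, hH.2.1 p hp x hx]
    simp
  · simp only [Pi.add_apply, Pi.smul_apply, evMat_linComb]
    rw [e, add_mulVec, smul_mulVec, add_dotProduct, smul_dotProduct, hG.2.2.1 s x hx,
      hH.2.2.1 s x hx]
    simp
  · simp only [Pi.add_apply, Pi.smul_apply, evMat_linComb]
    rw [add_mulVec, smul_mulVec, hG.2.2.2 s hs x hx, hH.2.2.2 s hs x hx]
    simp

lemma Q0_linComb (c : ℝ) (p q : T.B.Scalar) (hp : p ∈ T.Q0 k) (hq : q ∈ T.Q0 k) :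
    c • p + q ∈ T.Q0 k := by
  refine ⟨⟨fun s => totalDegree_linComb_le c (hp.1.1 s) (hq.1.1 s), fun e he x hx => ?_⟩, ?_⟩
  · have h1 := hp.1.2 e he x hx
    have h2 := hq.1.2 e he x hx
    simp only [Pi.add_apply, Pi.smul_apply, ev_add, ev_smul]
    linear_combination c * h1 + h2
  · have : IsLinearMap ℝ fun p : T.B.Scalar => elemInt fun s x => ev x (p s) :=
      isLinearMap_elemInt (fun s x => ⟨fun _ _ => by simp, fun _ _ => by simp⟩)
        fun p s => by fun_prop
    have h := this.map_add (c • p) q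
    rw [this.map_smul, hp.2, hq.2] at h
    simpa using h

lemma QD_linComb (c : ℝ) (p q : T.D.Scalar) (hp : p ∈ T.QD k) (hq : q ∈ T.QD k) :
    c • p + q ∈ T.QD k := fun s => totalDegree_linComb_le c (hp s) (hq s)

/-- The boundary data combine along with the fields. This covers the test space, the addition of the
lift and the difference of two solutions. -/
lemma HDbc_linComb (c : ℝ) {g g' : Plane → ℝ} {v w : T.D.Vec}
    (hg : ∀ s ∈ T.edgesΓD, MemL2Seg (base₀ s) (base₁ s) g)
    (hg' : ∀ s ∈ T.edgesΓD, MemL2Seg (base₀ s) (base₁ s) g')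
    (hv : v ∈ T.HDbc k g) (hw : w ∈ T.HDbc k g') : c • v + w ∈ T.HDbc k (c • g + g') := by
  refine ⟨⟨fun s i => totalDegree_linComb_le c (hv.1.1 s i) (hw.1.1 s i), ?_⟩,
    fun s hs χ hχ => ?_⟩
  · rw [toFun_linear]
    exact MemHdiv.linear measure_region_lt_top c hv.1.2 hw.1.2
  · have int : ∀ (g : Plane → ℝ) (v : T.D.Vec), MemL2Seg (base₀ s) (base₁ s) g →
        IntervalIntegrable (fun t : ℝ => (g (AffineMap.lineMap (base₀ s) (base₁ s) t) -
          evVec (AffineMap.lineMap (base₀ s) (base₁ s) t) (v s) ⬝ᵥ outNormal s) *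
          ev (AffineMap.lineMap (base₀ s) (base₁ s) t) χ) volume 0 1 := by
      intro g v hg
      have cl := continuous_lineMap_plane (base₀ s) (base₁ s)
      have c1 : Continuous fun x => evVec x (v s) ⬝ᵥ outNormal s := by fun_prop
      exact ((intervalIntegrable_of_memL2Seg hg).sub
        ((c1.comp cl).intervalIntegrable _ _)).mul_continuousOn
          ((continuous_ev χ).comp cl).continuousOn
    have h1 := hv.2 s hs χ hχ
    have h2 := hw.2 s hs χ hχ
    rw [segInt] at h1 h2 ⊢
    have e : ∀ x, ((c • g + g') x - evVec x ((c • v + w) s) ⬝ᵥ outNormal s) * ev x χ =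
        c * ((g x - evVec x (v s) ⬝ᵥ outNormal s) * ev x χ) +
          (g' x - evVec x (w s) ⬝ᵥ outNormal s) * ev x χ := by
      intro x
      simp only [Pi.add_apply, Pi.smul_apply, evVec_linComb, add_dotProduct, smul_dotProduct,
        smul_eq_mul]
      ring
    simp only [e]
    rw [intervalIntegral.integral_add ((int g v (hg s hs)).const_mul c) (int g' w (hg' s hs)),
      intervalIntegral.integral_const_mul]
    linear_combination c * h1 + h2

lemma memL2Seg_zero (a b : Plane) : MemL2Seg a b 0 := MemLp.zero

/-- The tuples of a tensor, a velocity and a pressure in `Ω_B` and of a velocity and a pressure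
in `Ω_D`. -/
abbrev Fields (T : CoupledMesh) := T.B.Tensor × T.B.Vec × T.B.Scalar × T.D.Vec × T.D.Scalar

variable (T k)

/-- The space of test functions. -/
def testSpace : Submodule ℝ T.Fields :=
  submoduleOfLinComb {y | y.1 ∈ T.WB k ∧ y.2.1 ∈ T.HB k ∧ y.2.2.1 ∈ T.Q0 k ∧
      y.2.2.2.1 ∈ T.HDbc k 0 ∧ y.2.2.2.2 ∈ T.QD k}
    ⟨T.zero_mem_WB k, T.zero_mem_HB k, T.zero_mem_Q0 k, T.zero_mem_HDbc k, T.zero_mem_QD k⟩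
    fun c x y hx hy => ⟨WB_linComb c _ _ hx.1 hy.1, HB_linComb c _ _ hx.2.1 hy.2.1,
      Q0_linComb c _ _ hx.2.2.1 hy.2.2.1, by
        simpa using HDbc_linComb c (fun s _ => memL2Seg_zero _ _) (fun s _ => memL2Seg_zero _ _)
          hx.2.2.2.1 hy.2.2.2.1,
      QD_linComb c _ _ hx.2.2.2.2 hy.2.2.2.2⟩

variable {T k}

/-- Only the degree bounds matter: they embed the test space in a finite product of spaces of
polynomials of bounded degree. -/
instance : FiniteDimensional ℝ (T.testSpace k) := by
  let R : ℕ → Submodule ℝ Poly := MvPolynomial.restrictTotalDegree (Fin 2) ℝ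
  have hR : ∀ n, (R n).FG := fun n => (Submodule.fg_top _).1 Module.Finite.fg_top
  let Rt : Submodule ℝ (Matrix (Fin 2) (Fin 2) Poly) :=
    (Submodule.pi Set.univ fun _ : Fin 2 => Submodule.pi Set.univ fun _ : Fin 2 => R k :
      Submodule ℝ (Fin 2 → Fin 2 → Poly))
  have hRt : Rt.FG := Submodule.fg_pi (M := fun _ : Fin 2 => Fin 2 → Poly) fun _ =>
    Submodule.fg_pi fun _ => hR k
  let Rv : Submodule ℝ (Fin 2 → Poly) := Submodule.pi Set.univ fun _ : Fin 2 => R k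
  have hRv : Rv.FG := Submodule.fg_pi fun _ => hR k
  let S : Submodule ℝ T.Fields :=
    (Submodule.pi Set.univ fun _ : T.B.Tri => Rt).prod
      ((Submodule.pi Set.univ fun _ : T.B.Tri => Rv).prod
        ((Submodule.pi Set.univ fun _ : T.B.Tri => R k).prod
          ((Submodule.pi Set.univ fun _ : T.D.Tri => Rv).prod
            (Submodule.pi Set.univ fun _ : T.D.Tri => R (k - 1)))))
  have hS : S.FG := (Submodule.fg_pi fun _ => hRt).prod ((Submodule.fg_pi fun _ => hRv).prod
    ((Submodule.fg_pi fun _ => hR k).prod ((Submodule.fg_pi fun _ => hRv).prod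
      (Submodule.fg_pi fun _ => hR (k - 1)))))
  have : FiniteDimensional ℝ S := Module.Finite.iff_fg.2 hS
  have hmem : ∀ {n} {p : Poly}, p.totalDegree ≤ n → p ∈ R n := fun h =>
    (MvPolynomial.mem_restrictTotalDegree _ _ _).2 h
  refine Submodule.finiteDimensional_of_le (S₂ := S) fun y hy => ?_
  refine ⟨fun s _ i _ j _ => hmem (hy.1.1 s i j), fun s _ i _ => hmem (hy.2.1.1 s i),
    fun s _ => hmem (hy.2.2.1.1.1 s), fun s _ i _ => hmem (hy.2.2.2.1.1.1 s i),
    fun s _ => hmem (hy.2.2.2.2 s)⟩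

/-! ### The discrete problem as a square linear system -/

/-- Left-hand side of the first equation. -/
def lhs₁ (ε : ℝ) (K : Plane → Matrix (Fin 2) (Fin 2) ℝ) (x y : T.Fields) : ℝ :=
  (elemInt fun s z => ε⁻¹ * frob (evMat z (x.1 s)) (evMat z (y.1 s))) - formBstar x.2.1 y.1 +
    (elemInt fun s z => ((K z)⁻¹ *ᵥ evVec z (x.2.2.2.1 s)) ⬝ᵥ evVec z (y.2.2.2.1 s)) +
    formI x.2.2.1 y.2.2.2.1 - formA y.2.2.2.1 x.2.2.2.2

/-- Left-hand side of the second equation. -/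
def lhs₂ (α : Matrix (Fin 2) (Fin 2) ℝ) (x y : T.Fields) : ℝ :=
  formB x.1 y.2.1 + (elemInt fun s z => (α *ᵥ evVec z (x.2.1 s)) ⬝ᵥ evVec z (y.2.1 s)) +
    formbstar x.2.2.1 y.2.1 + formA x.2.2.2.1 y.2.2.2.2

/-- Left-hand side of the third equation. -/
def lhs₃ (x y : T.Fields) : ℝ := -formI y.2.2.1 x.2.2.2.1 - formb x.2.1 y.2.2.1

/-- The bilinear form of the whole system. -/
def system (ε : ℝ) (α : Matrix (Fin 2) (Fin 2) ℝ) (K : Plane → Matrix (Fin 2) (Fin 2) ℝ)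
    (x y : T.Fields) : ℝ := lhs₁ ε K x y + lhs₂ α x y + lhs₃ x y

/-- Right-hand side of the first equation. -/
def rhs₁ (fD : Plane → Plane) (y : T.Fields) : ℝ :=
  elemInt fun s x => (fD x).ofLp ⬝ᵥ evVec x (y.2.2.2.1 s)

/-- Right-hand side of the second equation. -/
def rhs₂ (fB : Plane → Plane) (f : Plane → ℝ) (y : T.Fields) : ℝ :=
  (elemInt fun s x => (fB x).ofLp ⬝ᵥ evVec x (y.2.1 s)) +
    elemInt fun s x => f x * ev x (y.2.2.2.2 s)

/-- Right-hand side of the third equation. -/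
def rhs₃ (g₁ : Plane → ℝ) (y : T.Fields) : ℝ :=
  -∑ s ∈ T.edgesΓB, primalInt s fun x => g₁ x * ev x (y.2.2.1 s)

/-- The linear form of the whole system. -/
def load (fB fD : Plane → Plane) (f g₁ : Plane → ℝ) (y : T.Fields) : ℝ :=
  rhs₁ fD y + rhs₂ fB f y + rhs₃ g₁ y

lemma isLinearMap_proj₁ : IsLinearMap ℝ fun x : T.Fields => x.1 :=
  ⟨fun _ _ => rfl, fun _ _ => rfl⟩
lemma isLinearMap_proj₂ : IsLinearMap ℝ fun x : T.Fields => x.2.1 :=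
  ⟨fun _ _ => rfl, fun _ _ => rfl⟩
lemma isLinearMap_proj₃ : IsLinearMap ℝ fun x : T.Fields => x.2.2.1 :=
  ⟨fun _ _ => rfl, fun _ _ => rfl⟩
lemma isLinearMap_proj₄ : IsLinearMap ℝ fun x : T.Fields => x.2.2.2.1 :=
  ⟨fun _ _ => rfl, fun _ _ => rfl⟩
lemma isLinearMap_proj₅ : IsLinearMap ℝ fun x : T.Fields => x.2.2.2.2 :=
  ⟨fun _ _ => rfl, fun _ _ => rfl⟩

lemma isLinearMap_frob_left (c : ℝ) (G : T.B.Tensor) : IsLinearMap ℝ fun L : T.B.Tensor =>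
    elemInt fun s z => c * frob (evMat z (L s)) (evMat z (G s)) := by
  refine isLinearMap_elemInt (fun s x => ?_) fun u s => by fun_prop
  constructor <;> intros <;> simp [evMat_apply, frob, Fin.sum_univ_two] <;> ring

lemma isLinearMap_frob_right (c : ℝ) (L : T.B.Tensor) : IsLinearMap ℝ fun G : T.B.Tensor =>
    elemInt fun s z => c * frob (evMat z (L s)) (evMat z (G s)) := by
  refine isLinearMap_elemInt (fun s x => ?_) fun u s => by fun_prop
  constructor <;> intros <;> simp [evMat_apply, frob, Fin.sum_univ_two] <;> ring

lemma isLinearMap_constForm (α : Matrix (Fin 2) (Fin 2) ℝ) :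
    (∀ v : T.B.Vec, IsLinearMap ℝ fun u : T.B.Vec =>
      elemInt fun s x => (α *ᵥ evVec x (u s)) ⬝ᵥ evVec x (v s)) ∧
    ∀ u : T.B.Vec, IsLinearMap ℝ fun v : T.B.Vec =>
      elemInt fun s x => (α *ᵥ evVec x (u s)) ⬝ᵥ evVec x (v s) := by
  have := isLinearMap_weightedForm (M := T.B) (K := fun _ => α)
    (fun i j => integrableOn_const measure_region_lt_top.ne)
  exact ⟨this.1, this.2.1⟩

lemma isLinearMap_system_left (ε : ℝ) (α : Matrix (Fin 2) (Fin 2) ℝ)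
    {K : Plane → Matrix (Fin 2) (Fin 2) ℝ}
    (hK : ∀ i j, IntegrableOn (fun x => (K x)⁻¹ i j) T.ΩD) (y : T.Fields) :
    IsLinearMap ℝ fun x => system ε α K x y := by
  have hw := isLinearMap_weightedForm (M := T.D) hK
  exact isLinearMap_add (isLinearMap_add
    (isLinearMap_sub (isLinearMap_add (isLinearMap_add (isLinearMap_sub
      (isLinearMap_comp (isLinearMap_frob_left _ _) isLinearMap_proj₁)
      (isLinearMap_comp (isLinearMap_formBstar_left _) isLinearMap_proj₂))
      (isLinearMap_comp (hw.1 _) isLinearMap_proj₄))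
      (isLinearMap_comp (isLinearMap_formI_left _) isLinearMap_proj₃))
      (isLinearMap_comp (isLinearMap_formA_right _) isLinearMap_proj₅))
    (isLinearMap_add (isLinearMap_add (isLinearMap_add
      (isLinearMap_comp (isLinearMap_formB_left _) isLinearMap_proj₁)
      (isLinearMap_comp ((isLinearMap_constForm α).1 _) isLinearMap_proj₂))
      (isLinearMap_comp (isLinearMap_formbstar_left _) isLinearMap_proj₃))
      (isLinearMap_comp (isLinearMap_formA_left _) isLinearMap_proj₄)))
    (isLinearMap_sub
      (isLinearMap_neg (isLinearMap_comp (isLinearMap_formI_right _) isLinearMap_proj₄))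
      (isLinearMap_comp (isLinearMap_formb_left _) isLinearMap_proj₂))

lemma isLinearMap_system_right (ε : ℝ) (α : Matrix (Fin 2) (Fin 2) ℝ)
    {K : Plane → Matrix (Fin 2) (Fin 2) ℝ}
    (hK : ∀ i j, IntegrableOn (fun x => (K x)⁻¹ i j) T.ΩD) (x : T.Fields) :
    IsLinearMap ℝ fun y => system ε α K x y := by
  have hw := isLinearMap_weightedForm (M := T.D) hK
  exact isLinearMap_add (isLinearMap_add
    (isLinearMap_sub (isLinearMap_add (isLinearMap_add (isLinearMap_sub
      (isLinearMap_comp (isLinearMap_frob_right _ _) isLinearMap_proj₁)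
      (isLinearMap_comp (isLinearMap_formBstar_right _) isLinearMap_proj₁))
      (isLinearMap_comp (hw.2.1 _) isLinearMap_proj₄))
      (isLinearMap_comp (isLinearMap_formI_right _) isLinearMap_proj₄))
      (isLinearMap_comp (isLinearMap_formA_left _) isLinearMap_proj₄))
    (isLinearMap_add (isLinearMap_add (isLinearMap_add
      (isLinearMap_comp (isLinearMap_formB_right _) isLinearMap_proj₂)
      (isLinearMap_comp ((isLinearMap_constForm α).2 _) isLinearMap_proj₂))
      (isLinearMap_comp (isLinearMap_formbstar_right _) isLinearMap_proj₂))
      (isLinearMap_comp (isLinearMap_formA_right _) isLinearMap_proj₅)))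
    (isLinearMap_sub
      (isLinearMap_neg (isLinearMap_comp (isLinearMap_formI_left _) isLinearMap_proj₃))
      (isLinearMap_comp (isLinearMap_formb_right _) isLinearMap_proj₃))

lemma isLinearMap_load {fB fD : Plane → Plane} {f g₁ : Plane → ℝ}
    (hfB : MemLp fB 2 (volume.restrict T.ΩB)) (hfD : MemLp fD 2 (volume.restrict T.ΩD))
    (hf : MemLp f 2 (volume.restrict T.ΩD))
    (hg₁ : ∀ s ∈ T.edgesΓB, MemL2Seg (base₀ s) (base₁ s) g₁) :
    IsLinearMap ℝ fun y : T.Fields => load fB fD f g₁ y :=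
  isLinearMap_add (isLinearMap_add
    (isLinearMap_comp (CellFamily.isLinearMap_load hfD) isLinearMap_proj₄)
    (isLinearMap_add (isLinearMap_comp (CellFamily.isLinearMap_load hfB) isLinearMap_proj₂)
      (isLinearMap_comp (isLinearMap_scalarLoad hf) isLinearMap_proj₅)))
    (isLinearMap_neg (isLinearMap_comp (isLinearMap_boundaryLoad _ hg₁) isLinearMap_proj₃))

/-- Each equation ignores the test components of the others; this recovers the single equations from
their sum. -/
lemma lhs₁_eq_zero (ε : ℝ) (K : Plane → Matrix (Fin 2) (Fin 2) ℝ) (x : T.Fields)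
    (v : T.B.Vec) (q : T.B.Scalar) (r : T.D.Scalar) : lhs₁ ε K x (0, v, q, 0, r) = 0 := by
  simp [lhs₁, (isLinearMap_formBstar_right x.2.1).map_zero, (isLinearMap_formI_right x.2.2.1).map_zero,
    (isLinearMap_formA_left x.2.2.2.2).map_zero, frob, elemInt]

lemma lhs₂_eq_zero (α : Matrix (Fin 2) (Fin 2) ℝ) (x : T.Fields)
    (G : T.B.Tensor) (q : T.B.Scalar) (v : T.D.Vec) : lhs₂ α x (G, 0, q, v, 0) = 0 := by
  simp [lhs₂, (isLinearMap_formB_right x.1).map_zero, (isLinearMap_formbstar_right x.2.2.1).map_zero,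
    (isLinearMap_formA_right x.2.2.2.1).map_zero, elemInt]

lemma lhs₃_eq_zero (x : T.Fields) (G : T.B.Tensor) (v : T.B.Vec) (w : T.D.Vec) (r : T.D.Scalar) :
    lhs₃ x (G, v, 0, w, r) = 0 := by
  simp [lhs₃, (isLinearMap_formI_left x.2.2.2.1).map_zero, (isLinearMap_formb_right x.2.1).map_zero]

lemma isDiscreteSolution_iff {ε : ℝ} {α : Matrix (Fin 2) (Fin 2) ℝ}
    {K : Plane → Matrix (Fin 2) (Fin 2) ℝ} {fB fD : Plane → Plane} {f g₁ g₂ : Plane → ℝ}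
    {x : T.Fields} :
    T.IsDiscreteSolution k ε α K fB fD f g₁ g₂ x.1 x.2.1 x.2.2.1 x.2.2.2.1 x.2.2.2.2 ↔
      (x.1 ∈ T.WB k ∧ x.2.1 ∈ T.HB k ∧ x.2.2.1 ∈ T.Q0 k ∧ x.2.2.2.1 ∈ T.HDbc k g₂ ∧
        x.2.2.2.2 ∈ T.QD k) ∧
      ∀ y ∈ T.testSpace k, system ε α K x y = load fB fD f g₁ y := by
  constructor
  · intro h
    refine ⟨⟨h.mem_L, h.mem_uB, h.mem_pB, h.mem_uD, h.mem_pD⟩, fun y hy => ?_⟩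
    exact congrArg₂ (· + ·) (congrArg₂ (· + ·) (h.eq₁ y.1 hy.1 y.2.2.2.1 hy.2.2.2.1)
      (h.eq₂ y.2.1 hy.2.1 y.2.2.2.2 hy.2.2.2.2)) (h.eq₃ y.2.2.1 hy.2.2.1)
  · rintro ⟨⟨h1, h2, h3, h4, h5⟩, h⟩
    refine ⟨h1, h2, h3, h4, h5, fun G hG vD hvD => ?_, fun vB hvB qD hqD => ?_, fun qB hqB => ?_⟩
    · have := h (G, 0, 0, vD, 0)
        ⟨hG, T.zero_mem_HB k, T.zero_mem_Q0 k, hvD, T.zero_mem_QD k⟩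
      rw [system, load, lhs₂_eq_zero, lhs₃_eq_zero] at this
      simpa [lhs₁, rhs₁, rhs₂, rhs₃, elemInt, primalInt, segInt] using this
    · have := h (0, vB, 0, 0, qD)
        ⟨T.zero_mem_WB k, hvB, T.zero_mem_Q0 k, T.zero_mem_HDbc k, hqD⟩
      rw [system, load, lhs₁_eq_zero, lhs₃_eq_zero] at this
      simpa [lhs₂, rhs₁, rhs₂, rhs₃, elemInt, primalInt, segInt] using this
    · have := h (0, 0, qB, 0, 0)
        ⟨T.zero_mem_WB k, T.zero_mem_HB k, hqB, T.zero_mem_HDbc k, T.zero_mem_QD k⟩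
      rw [system, load, lhs₁_eq_zero, lhs₂_eq_zero] at this
      simpa [lhs₃, rhs₁, rhs₂, rhs₃, elemInt, primalInt, segInt] using this

end CoupledMesh

/-! ### Unique solvability -/

namespace CellFamily

variable {M : CellFamily}

lemma eq_zero_of_elemInt_eq_zero {f : M.Tri → Plane → ℝ} (hf : ∀ s, Continuous (f s))
    (h0 : ∀ s x, 0 ≤ f s x) (h : elemInt f = 0) (s : M.Tri) :
    ∀ x ∈ interior (tri s), f s x = 0 :=
  eq_zero_of_setIntegral_eq_zero (hf s) (fun x _ => h0 s x)
    ((Finset.sum_eq_zero_iff_of_nonneg fun s _ => integral_nonneg fun x => h0 s x).1 h s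
      (Finset.mem_univ s))

lemma elemInt_nonneg {f : M.Tri → Plane → ℝ} (h0 : ∀ s, 0 ≤ᵐ[volume.restrict (tri s)] f s) :
    0 ≤ elemInt f := Finset.sum_nonneg fun s _ => integral_nonneg_of_ae (h0 s)

lemma vec_eq_zero {v : M.Vec} (h : ∀ s, ∀ x ∈ interior (tri s), evVec x (v s) = 0) : v = 0 := by
  funext s i
  exact eq_zero_of_ev_eq_zero isOpen_interior (interior_tri_nonempty s) fun x hx =>
    congrFun (h s x hx) i

lemma tensor_eq_zero {G : M.Tensor} (h : ∀ s, ∀ x ∈ interior (tri s), evMat x (G s) = 0) :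
    G = 0 := by
  funext s
  ext1 i j
  exact eq_zero_of_ev_eq_zero isOpen_interior (interior_tri_nonempty s) fun x hx =>
    congrFun (congrFun (h s x hx) i) j

lemma ae_restrict_tri {p : Plane → Prop} (h : ∀ᵐ x ∂volume.restrict M.region, p x) (s : M.Tri) :
    ∀ᵐ x ∂volume.restrict (tri s), p x := by
  rw [← Measure.restrict_congr_set (interior_tri_ae_eq s)]
  exact ae_mono (Measure.restrict_mono (interior_tri_subset_region s) le_rfl) h

/-- The weighted energy is nonnegative. -/
lemma weightedForm_nonneg {K : Plane → Matrix (Fin 2) (Fin 2) ℝ}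
    (hK : ∀ᵐ x ∂volume.restrict M.region, (K x).PosDef) (v : M.Vec) (s : M.Tri) :
    0 ≤ᵐ[volume.restrict (tri s)] fun x => (K x *ᵥ evVec x (v s)) ⬝ᵥ evVec x (v s) := by
  filter_upwards [ae_restrict_tri hK s] with x hx
  rw [dotProduct_comm]
  simpa using hx.posSemidef.dotProduct_mulVec_nonneg (evVec x (v s))

/-- The weighted energy is definite. -/
lemma eq_zero_of_weightedForm_eq_zero {K : Plane → Matrix (Fin 2) (Fin 2) ℝ}
    (hK : ∀ᵐ x ∂volume.restrict M.region, (K x).PosDef)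
    (hKint : ∀ i j, IntegrableOn (fun x => K x i j) M.region) {v : M.Vec}
    (h : (elemInt fun s x => (K x *ᵥ evVec x (v s)) ⬝ᵥ evVec x (v s)) = 0) : v = 0 := by
  refine vec_eq_zero fun s => ?_
  have hs := (Finset.sum_eq_zero_iff_of_nonneg fun s _ =>
    integral_nonneg_of_ae (weightedForm_nonneg hK v s)).1 h s (Finset.mem_univ s)
  rw [setIntegral_eq_zero_iff_of_nonneg_ae (weightedForm_nonneg hK v s)
    ((isLinearMap_weightedForm hKint).2.2 v v s)] at hs
  -- The weight is definite only almost everywhere, so the field first vanishes almost everywhere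
  -- and then, by continuity, everywhere inside.
  have hae : (fun x => evVec x (v s)) =ᵐ[volume.restrict (tri s)] fun _ => 0 := by
    filter_upwards [hs, ae_restrict_tri hK s] with x hx hpos
    by_contra hne
    have := hpos.dotProduct_mulVec_pos hne
    rw [dotProduct_comm] at this
    simp only [star_trivial] at this
    exact this.ne' hx
  exact Measure.eqOn_open_of_ae_eq (ae_restrict_of_ae_restrict_of_subset interior_subset hae)
    isOpen_interior (continuous_evVec (v s)).continuousOn continuousOn_const

end CellFamily

lemma frob_self_nonneg (A : Matrix (Fin 2) (Fin 2) ℝ) : 0 ≤ frob A A :=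
  Finset.sum_nonneg fun _ _ => Finset.sum_nonneg fun _ _ => mul_self_nonneg _

lemma eq_zero_of_frob_self_eq_zero {A : Matrix (Fin 2) (Fin 2) ℝ} (h : frob A A = 0) : A = 0 := by
  ext i j
  have h1 := (Finset.sum_eq_zero_iff_of_nonneg fun i _ =>
    Finset.sum_nonneg fun j _ => mul_self_nonneg (A i j)).1 h i (Finset.mem_univ i)
  have h2 := (Finset.sum_eq_zero_iff_of_nonneg fun j _ => mul_self_nonneg (A i j)).1 h1 j
    (Finset.mem_univ j)
  simpa using h2

namespace CoupledMesh

open CellFamily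

variable {T : CoupledMesh} {k : ℕ}

/-- The homogeneous problem has only the trivial solution. -/
lemma eq_zero_of_system_eq_zero (hk : 1 ≤ k) {ε : ℝ} (hε : 0 < ε)
    {α : Matrix (Fin 2) (Fin 2) ℝ} (hα : α.PosDef) {K : Plane → Matrix (Fin 2) (Fin 2) ℝ}
    (hK : ∀ᵐ x ∂(volume.restrict T.ΩD), (K x).PosDef)
    (hKint : ∀ i j, IntegrableOn (fun x => (K x)⁻¹ i j) T.ΩD) {x : T.Fields}
    (hx : x ∈ T.testSpace k) (h : ∀ y ∈ T.testSpace k, system ε α K x y = 0) : x = 0 := by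
  obtain ⟨L, uB, pB, uD, pD⟩ := x
  obtain ⟨hL, hu, hp, hw, hr⟩ := hx
  simp only at hL hu hp hw hr
  have hKinv : ∀ᵐ x ∂(volume.restrict T.D.region), (K x)⁻¹.PosDef := by
    filter_upwards [hK] with x hx using hx.inv
  have hα' : ∀ᵐ x ∂(volume.restrict T.B.region), (fun _ : Plane => α) x |>.PosDef :=
    Filter.Eventually.of_forall fun _ => hα
  have hαint : ∀ i j, IntegrableOn (fun x => (fun _ : Plane => α) x i j) T.B.region :=
    fun i j => integrableOn_const measure_region_lt_top.ne
  have energy := h (L, uB, pB, uD, pD) ⟨hL, hu, hp, hw, hr⟩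
  simp only [system, lhs₁, lhs₂, lhs₃] at energy
  -- With the adjoint forms identified, all coupling terms cancel and three nonnegative energies add
  -- up to zero.
  rw [formBstar_eq_formB hu hL, formbstar_eq_formb hp.1 hu] at energy
  have n1 : 0 ≤ elemInt fun s z => ε⁻¹ * frob (evMat z (L s)) (evMat z (L s)) :=
    elemInt_nonneg fun s => Filter.Eventually.of_forall fun x =>
      mul_nonneg (inv_nonneg.2 hε.le) (frob_self_nonneg _)
  have n2 : 0 ≤ elemInt fun s z => (α *ᵥ evVec z (uB s)) ⬝ᵥ evVec z (uB s) :=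
    elemInt_nonneg fun s => weightedForm_nonneg hα' uB s
  have n3 : 0 ≤ elemInt fun s z => ((K z)⁻¹ *ᵥ evVec z (uD s)) ⬝ᵥ evVec z (uD s) :=
    elemInt_nonneg fun s => weightedForm_nonneg hKinv uD s
  have z1 : (elemInt fun s z => ε⁻¹ * frob (evMat z (L s)) (evMat z (L s))) = 0 := by linarith
  have z2 : (elemInt fun s z => (α *ᵥ evVec z (uB s)) ⬝ᵥ evVec z (uB s)) = 0 := by linarith
  have z3 : (elemInt fun s z => ((K z)⁻¹ *ᵥ evVec z (uD s)) ⬝ᵥ evVec z (uD s)) = 0 := by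
    linarith
  obtain rfl : L = 0 := by
    refine tensor_eq_zero fun s x hx => eq_zero_of_frob_self_eq_zero ?_
    have := eq_zero_of_elemInt_eq_zero (fun s => by fun_prop) (fun s x =>
      mul_nonneg (inv_nonneg.2 hε.le) (frob_self_nonneg _)) z1 s x hx
    simpa [hε.ne'] using this
  obtain rfl : uB = 0 := eq_zero_of_weightedForm_eq_zero hα' hαint z2
  obtain rfl : uD = 0 := eq_zero_of_weightedForm_eq_zero hKinv hKint z3
  obtain rfl : pB = 0 := by
    -- With the other fields gone, the second equation says that `pB` is orthogonal to every
    -- Brinkman velocity.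
    refine eq_zero_of_formb_eq_zero hk hp fun v hv => ?_
    have := h (0, v, 0, 0, 0)
      ⟨T.zero_mem_WB k, hv, T.zero_mem_Q0 k, T.zero_mem_HDbc k, T.zero_mem_QD k⟩
    rw [system, lhs₁_eq_zero, lhs₃_eq_zero] at this
    rw [← formbstar_eq_formb hp.1 hv]
    simpa [lhs₂, (isLinearMap_formB_left v).map_zero, (isLinearMap_formA_left 0).map_zero,
      elemInt] using this
  obtain rfl : pD = 0 := by
    -- Likewise the first equation leaves only `formA` with `pD`.
    refine eq_zero_of_formA_eq_zero hk hr fun v hv => ?_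
    have := h (0, 0, 0, v, 0)
      ⟨T.zero_mem_WB k, T.zero_mem_HB k, T.zero_mem_Q0 k, hv, T.zero_mem_QD k⟩
    rw [system, lhs₂_eq_zero, lhs₃_eq_zero] at this
    simpa [lhs₁, (isLinearMap_formBstar_left 0).map_zero, (isLinearMap_formI_left v).map_zero,
      elemInt, frob] using this
  rfl

end CoupledMesh

end BrinkmanDarcy
end

open BrinkmanDarcy BrinkmanDarcy.CoupledMesh in
theorem mainTheorem5 (T : BrinkmanDarcy.CoupledMesh) (k : ℕ) (hk : 1 ≤ k)
    (ε : ℝ) (hε : 0 < ε)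
    (α : Matrix (Fin 2) (Fin 2) ℝ) (hα : α.PosDef)
    (K : BrinkmanDarcy.Plane → Matrix (Fin 2) (Fin 2) ℝ)
    (hK : ∀ᵐ x ∂(volume.restrict T.ΩD), (K x).PosDef)
    (hKint : ∀ i j, IntegrableOn (fun x => (K x)⁻¹ i j) T.ΩD)
    (fB fD : BrinkmanDarcy.Plane → BrinkmanDarcy.Plane) (f g₁ g₂ : BrinkmanDarcy.Plane → ℝ)
    (hfB : MemLp fB 2 (volume.restrict T.ΩB)) (hfD : MemLp fD 2 (volume.restrict T.ΩD))
    (hf : MemLp f 2 (volume.restrict T.ΩD))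
    (hg₁ : ∀ s ∈ T.edgesΓB, BrinkmanDarcy.MemL2Seg
      (BrinkmanDarcy.CellFamily.base₀ s) (BrinkmanDarcy.CellFamily.base₁ s) g₁)
    (hg₂ : ∀ s ∈ T.edgesΓD, BrinkmanDarcy.MemL2Seg
      (BrinkmanDarcy.CellFamily.base₀ s) (BrinkmanDarcy.CellFamily.base₁ s) g₂) :
    ∃! x : T.B.Tensor × T.B.Vec × T.B.Scalar × T.D.Vec × T.D.Scalar,
      T.IsDiscreteSolution k ε α K fB fD f g₁ g₂ x.1 x.2.1 x.2.2.1 x.2.2.2.1 x.2.2.2.2 := by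
  have hl := isLinearMap_system_left ε α hKint
  have hr := isLinearMap_system_right ε α hKint
  obtain ⟨w, hw⟩ := HDbc_nonempty hk hg₂
  have zero : ∀ s ∈ T.edgesΓD, MemL2Seg (CellFamily.base₀ s) (CellFamily.base₁ s) 0 :=
    fun s _ => memL2Seg_zero _ _
  -- The lift `w` moves to the right-hand side, so the remaining unknown lies in the test space.
  obtain ⟨x, hx, hxy⟩ := exists_solution_of_injective (T.testSpace k) (system ε α K) hl hr
    (fun x hx h => eq_zero_of_system_eq_zero hk hε hα hK hKint hx h)
    (l := fun y => load fB fD f g₁ y - system ε α K (0, 0, 0, w, 0) y)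
    (isLinearMap_sub (CoupledMesh.isLinearMap_load hfB hfD hf hg₁) (hr _))
  refine ⟨x + (0, 0, 0, w, 0), isDiscreteSolution_iff.2 ⟨?_, fun y hy => ?_⟩, fun z hz => ?_⟩
  · have hD := HDbc_linComb 1 zero hg₂ hx.2.2.2.1 hw
    simp only [one_smul, zero_add] at hD
    simp only [Prod.fst_add, Prod.snd_add, add_zero]
    exact ⟨hx.1, hx.2.1, hx.2.2.1, hD, hx.2.2.2.2⟩
  · rw [(hl y).map_add, hxy y hy, sub_add_cancel]
  · obtain ⟨⟨h1, h2, h3, h4, h5⟩, hsol⟩ := isDiscreteSolution_iff.1 hz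
    -- The difference of two solutions: the data `g₂` cancel, so it lies in the test space and
    -- solves the homogeneous problem.
    let d : T.Fields := (-1 : ℝ) • (x + (0, 0, 0, w, 0)) + z
    have hd : d = 0 := by
      refine eq_zero_of_system_eq_zero hk hε hα hK hKint (k := k) ⟨?_, ?_, ?_, ?_, ?_⟩
        fun y hy => ?_
      · simpa [d] using WB_linComb (-1) _ _ hx.1 h1
      · simpa [d] using HB_linComb (-1) _ _ hx.2.1 h2
      · simpa [d] using Q0_linComb (-1) _ _ hx.2.2.1 h3
      · have hD := HDbc_linComb 1 zero hg₂ hx.2.2.2.1 hw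
        have := HDbc_linComb (-1) (g := (1 : ℝ) • 0 + g₂) (by simpa using hg₂) hg₂ hD h4
        simpa [d] using this
      · simpa [d] using QD_linComb (-1) _ _ hx.2.2.2.2 h5
      · rw [(hl y).map_add, (hl y).map_smul, (hl y).map_add, hxy y hy, hsol y hy]
        simp
    have : -(x + (0, 0, 0, w, 0)) + z = 0 := by
      rw [← hd]
      simp only [d, neg_smul, one_smul]
    exact (neg_add_eq_zero.1 this).symm
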